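/- Let $q\in\mathbb{C}$ with $0<|q|<1$. Put $(x;q)_\infty=\prod_{i\ge 0}(1-q^ix)$, $j(x;q)=(x;q)_\infty(q/x;q)_\infty(q;q)_\infty$, $J_m=\prod_{i\ge1}(1-q^{mi})$, $$m(x,q,z)=\frac{1}{j(z;q)}\sum_{r\in\mathbb{Z}}\frac{(-1)^rq^{r(r-1)/2}z^r}{1-q^{r-1}xz},$$ and $\mathrm{sg}(r)=1$ for $r\ge 0$, $\mathrm{sg}(r)=-1$ for $r<0$. Define \begin{align*} G(x,y,z;q)={}&\frac{J_4^3\,j(y^2z^2;q^4)}{j(y^2;q^4)j(z^2;q^4)}\,m\Big(-\frac{qx}{yz},q^2,-yz\Big)+\frac{J_4^3\,j(x^2z^2;q^4)}{j(x^2;q^4)j(z^2;q^4)}\,m\Big(-\frac{qy}{xz},q^2,-xz\Big)\\ &+\frac{J_1^3J_2^3}{j(x;q)j(y;q)j(z;q)}\cdot\frac{j(xy;q^2)j(xz;q^2)j(yz;q^2)}{j(-x;q^2)j(-y;q^2)j(-z;q^2)}+\frac{J_4^3\,j(x^2y^2;q^4)}{j(x^2;q^4)j(y^2;q^4)}\,m\Big(-\frac{qz}{xy},q^2,-xy\Big)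 \end{align*} and $$F(x,y,z;q)=\sum_{\mathrm{sg}(s)=\mathrm{sg}(t)}\mathrm{sg}(s)\frac{q^{4st}y^{2s}z^{2t}}{1-x^2q^{4s+4t}}+x\sum_{\mathrm{sg}(s)=\mathrm{sg}(t)}\mathrm{sg}(s)\frac{q^{4st+4s+4t+3}y^{2s+1}z^{2t+1}}{1-x^2q^{4s+4t+4}},$$ the sums being over $s,t\in\mathbb{Z}$. (1) If $x,y,z\in\mathbb{C}$ satisfy $|q|<|x|<1$, $|q|<|y|<1$ and $|q|<|z|<1$, then, the series being absolutely convergent, $$\sum_{\substack{\mathrm{sg}(r)=\mathrm{sg}(s)=\mathrm{sg}(t)\\ r\equiv s\equiv t\ (\mathrm{mod}\ 2)}}q^{rs+rt+st}x^ry^sz^t=G(x,y,z;q).$$ (2) More strongly, let $x,y,z\in\mathbb{C}$ with $|q|<|y|<1$, $|q|<|z|<1$, $x\neq0$ and $x\neq\pm q^{2n}$ for all $n\in\mathbb{Z}$. Then both series in $F(x,y,z;q)$ converge absolutely and $F(x,y,z;q)=G(x,y,z;q)$. Here, at the points $x$ where a denominator in $G$ vanishes (those with $x=q^{2n+1}$,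 $xy=-q^{2n}$ or $xz=-q^{2n}$ for some $n\in\mathbb{Z}$), $G$ has a removable singularity in $x$, and its value is understood as the limit $\lim_{w\to x}G(w,y,z;q)$. -/

import Mathlib

open Filter Topology

noncomputable section

namespace TripleSum

/-- The infinite `q`-Pochhammer symbol `(x;q)_∞ = ∏_{i ≥ 0} (1 - q^i x)`. -/
def qPoch (x q : ℂ) : ℂ := ∏' i : ℕ, (1 - q ^ i * x)

/-- The theta function `j(x;q) = (x;q)_∞ (q/x;q)_∞ (q;q)_∞`. -/
def j (x q : ℂ) : ℂ := qPoch x q * qPoch (q / x) q * qPoch q q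

/-- `J_m = ∏_{i ≥ 1} (1 - q^{m i}) = (q^m;q^m)_∞`. -/
def J (q : ℂ) (m : ℕ) : ℂ := qPoch (q ^ m) (q ^ m)

/-- The Appell-Lerch function
`m(x,q,z) = j(z;q)⁻¹ ∑_{r ∈ ℤ} (-1)^r q^{r(r-1)/2} z^r / (1 - q^{r-1} x z)`.
The integer division in the exponent is exact. -/
def appellLerch (x q z : ℂ) : ℂ :=
  1 / j z q *
    ∑' r : ℤ, (-1) ^ r * q ^ (r * (r - 1) / 2) * z ^ r / (1 - q ^ (r - 1) * x * z)

/-- `sg r = 1` if `r ≥ 0` and `sg r = -1` if `r < 0`. -/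
def sg (r : ℤ) : ℤ := if 0 ≤ r then 1 else -1

/-- Triples with `sg r = sg s = sg t` and `r ≡ s ≡ t (mod 2)`. -/
def sameParityTriples : Set (ℤ × ℤ × ℤ) :=
  {p | (sg p.1 = sg p.2.1 ∧ sg p.2.1 = sg p.2.2) ∧
    (p.1 ≡ p.2.1 [ZMOD 2] ∧ p.2.1 ≡ p.2.2 [ZMOD 2])}

/-- The term `q^{rs+rt+st} x^r y^s z^t`, with `p = (r, s, t)`. -/
def tripleTerm (x y z q : ℂ) (p : ℤ × ℤ × ℤ) : ℂ :=
  q ^ (p.1 * p.2.1 + p.1 * p.2.2 + p.2.1 * p.2.2) * x ^ p.1 * y ^ p.2.1 * z ^ p.2.2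

/-- Pairs with `sg s = sg t`. -/
def sameSignPairs : Set (ℤ × ℤ) := {p | sg p.1 = sg p.2}

/-- The term `sg(s) q^{4st} y^{2s} z^{2t} / (1 - x² q^{4s+4t})`, with `p = (s, t)`. -/
def evenTerm (x y z q : ℂ) (p : ℤ × ℤ) : ℂ :=
  (sg p.1 : ℂ) * (q ^ (4 * p.1 * p.2) * y ^ (2 * p.1) * z ^ (2 * p.2) /
    (1 - x ^ 2 * q ^ (4 * p.1 + 4 * p.2)))

/-- The term `sg(s) q^{4st+4s+4t+3} y^{2s+1} z^{2t+1} / (1 - x² q^{4s+4t+4})`,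
with `p = (s, t)`. -/
def oddTerm (x y z q : ℂ) (p : ℤ × ℤ) : ℂ :=
  (sg p.1 : ℂ) * (q ^ (4 * p.1 * p.2 + 4 * p.1 + 4 * p.2 + 3) *
    y ^ (2 * p.1 + 1) * z ^ (2 * p.2 + 1) / (1 - x ^ 2 * q ^ (4 * p.1 + 4 * p.2 + 4)))

/-- The double-sum side of the stronger identity. -/
def F (x y z q : ℂ) : ℂ :=
  (∑' p : sameSignPairs, evenTerm x y z q p) + x * (∑' p : sameSignPairs, oddTerm x y z q p)

/-- The Appell-Lerch and theta side. -/
def G (x y z q : ℂ) : ℂ :=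
  J q 4 ^ 3 * j (y ^ 2 * z ^ 2) (q ^ 4) / (j (y ^ 2) (q ^ 4) * j (z ^ 2) (q ^ 4)) *
      appellLerch (-(q * x / (y * z))) (q ^ 2) (-(y * z))
    + J q 4 ^ 3 * j (x ^ 2 * z ^ 2) (q ^ 4) / (j (x ^ 2) (q ^ 4) * j (z ^ 2) (q ^ 4)) *
      appellLerch (-(q * y / (x * z))) (q ^ 2) (-(x * z))
    + J q 1 ^ 3 * J q 2 ^ 3 / (j x q * j y q * j z q) *
      (j (x * y) (q ^ 2) * j (x * z) (q ^ 2) * j (y * z) (q ^ 2) /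
        (j (-x) (q ^ 2) * j (-y) (q ^ 2) * j (-z) (q ^ 2)))
    + J q 4 ^ 3 * j (x ^ 2 * y ^ 2) (q ^ 4) / (j (x ^ 2) (q ^ 4) * j (y ^ 2) (q ^ 4)) *
      appellLerch (-(q * z / (x * y))) (q ^ 2) (-(x * y))

end TripleSum

end

noncomputable section

namespace TripleSum

/-! ### The q-Pochhammer symbol as an entire function of its argument. -/

section QPoch

variable {q : ℂ}

/-! Fix q, y, z and regard both sides as functions of x on the punctured plane. Under x → q²x, F is
multiplied by qx/(yz), up to theta quotients supplied by Kronecker's identity (`F_mul`): with p = q⁴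
the shift exchanges the two double sums, by `pairSum_mul_sub` and `pairSum_mul_sq`. The Appell-Lerch
side obeys the same law with the same inhomogeneous terms, so the difference D satisfies D(q²x) =
(qx/(yz)) D(x) (`sub_regG_mul`).

Such a D with only removable singularities is zero (`eventually_eq_zero_of_qShift`). The multiplier
is small near the origin, which forces D = o(1/x) there, so D extends to an entire function; a
leading Taylor term of degree n would require q^{2n} to equal the multiplier at 0, which is 0. The
same principle, with other multipliers, proves Kronecker's identity (`kronecker`) and the change of
parameter formula for Appell-Lerch functions (`appellM_sub`).

It remains to remove the poles, which lie on the q²-orbits of 1, -1 and q. At q, the pole of one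
Appell-Lerch summand cancels that of the theta summand. At ε = ±1, F and three summands of G
contribute, and the total vanishes by `appellSum_add_appellSum`, an instance of the change of
parameter formula.

The zeros of denominators at xy = -q^{2n} and xz = -q^{2n} are spurious: j(y²z²;q⁴) and its
analogues contain the theta function in the denominator of m, and `regG` is G after this
cancellation. The triple sum becomes F when one index is summed as a geometric series
(`hasSum_tripleTerm`). -/

lemma summable_norm_pow_mul (hq : ‖q‖ < 1) (x : ℂ) : Summable fun i : ℕ => ‖q ^ i * x‖ := by
  simp only [norm_mul, norm_pow]
  exact (summable_geometric_of_lt_one (norm_nonneg _) hq).mul_right _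

lemma multipliable_qPoch (hq : ‖q‖ < 1) (x : ℂ) : Multipliable fun i : ℕ => 1 - q ^ i * x := by
  simp only [sub_eq_add_neg]
  exact multipliable_one_add_of_summable (by simpa using summable_norm_pow_mul hq x)

lemma qPoch_eq_mul (hq : ‖q‖ < 1) (x : ℂ) : qPoch x q = (1 - x) * qPoch (q * x) q := by
  have h : ∀ i : ℕ, 1 - q ^ (i + 1) * x = 1 - q ^ i * (q * x) := fun i => by ring
  have hm := multipliable_qPoch hq (q * x)
  simp only [← h] at hm
  have h2 := tprod_eq_zero_mul' (f := fun i : ℕ => 1 - q ^ i * x) hm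
  simp only [h, pow_zero, one_mul] at h2
  exact h2

lemma qPoch_ne_zero (hq : ‖q‖ < 1) {x : ℂ} (hx : ∀ i : ℕ, q ^ i * x ≠ 1) : qPoch x q ≠ 0 := by
  unfold qPoch
  simp only [sub_eq_add_neg]
  refine tprod_one_add_ne_zero_of_summable (fun i h => hx i ?_)
    (by simpa using summable_norm_pow_mul hq x)
  linear_combination -h

lemma qPoch_ne_zero_of_norm_lt_one (hq : ‖q‖ < 1) {x : ℂ} (hx : ‖x‖ < 1) : qPoch x q ≠ 0 := by
  refine qPoch_ne_zero hq fun i h => ?_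
  have h1 : ‖q ^ i * x‖ = 1 := by rw [h, norm_one]
  rw [norm_mul, norm_pow] at h1
  have h2 : ‖q‖ ^ i ≤ 1 := pow_le_one₀ (norm_nonneg _) hq.le
  nlinarith [norm_nonneg x]

lemma qPoch_one (hq : ‖q‖ < 1) : qPoch 1 q = 0 := by
  rw [qPoch_eq_mul hq]; simp

lemma qPoch_zero : qPoch 0 q = 1 := by
  simp [qPoch]

lemma differentiable_qPoch (hq : ‖q‖ < 1) : Differentiable ℂ fun x => qPoch x q := by
  intro x
  have hK : IsOpen (Metric.ball (0 : ℂ) (‖x‖ + 1)) := Metric.isOpen_ball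
  have hu : Summable fun i : ℕ => ‖q‖ ^ i * (‖x‖ + 1) :=
    (summable_geometric_of_lt_one (norm_nonneg _) hq).mul_right _
  have hl := Summable.hasProdLocallyUniformlyOn_one_add (f := fun (i : ℕ) (w : ℂ) => -(q ^ i * w)) hK hu
    (Eventually.of_forall fun i w hw => by
      rw [norm_neg, norm_mul, norm_pow]
      exact mul_le_mul_of_nonneg_left (by simpa using (mem_ball_zero_iff.1 hw).le)
        (pow_nonneg (norm_nonneg _) _)) (fun i => by fun_prop)
  have hd : DifferentiableOn ℂ (fun w => ∏' i : ℕ, (1 + -(q ^ i * w)))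
      (Metric.ball (0 : ℂ) (‖x‖ + 1)) := by
    refine TendstoLocallyUniformlyOn.differentiableOn hl (Eventually.of_forall fun s => ?_) hK
    fun_prop
  have h := hd.differentiableAt (hK.mem_nhds (x := x) (by simp))
  simpa only [qPoch, sub_eq_add_neg] using h

lemma qPoch_sq (hq : ‖q‖ < 1) (x : ℂ) :
    qPoch (x ^ 2) (q ^ 2) = qPoch x q * qPoch (-x) q := by
  unfold qPoch
  rw [← (multipliable_qPoch hq x).tprod_mul (multipliable_qPoch hq (-x))]
  refine tprod_congr fun i => ?_
  ring

lemma norm_sq_lt_one (hq : ‖q‖ < 1) : ‖q ^ 2‖ < 1 := by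
  rw [norm_pow]; exact pow_lt_one₀ (norm_nonneg _) hq two_ne_zero

lemma qPoch_even_odd (hq : ‖q‖ < 1) (x : ℂ) :
    qPoch x q = qPoch x (q ^ 2) * qPoch (q * x) (q ^ 2) := by
  have h1 : ∀ i : ℕ, 1 - (q ^ 2) ^ i * x = 1 - q ^ (2 * i) * x := fun i => by ring
  have h2 : ∀ i : ℕ, 1 - (q ^ 2) ^ i * (q * x) = 1 - q ^ (2 * i + 1) * x := fun i => by ring
  have m1 := multipliable_qPoch (norm_sq_lt_one hq) x
  have m2 := multipliable_qPoch (norm_sq_lt_one hq) (q * x)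
  unfold qPoch
  simp only [h1, h2] at m1 m2 ⊢
  exact (tprod_even_mul_odd (f := fun i : ℕ => 1 - q ^ i * x) m1 m2).symm

end QPoch

/-! ### Theta functions: quasi-periodicity, dissections and special values. -/

section Theta

variable {q : ℂ}

/-- Shifting x by q removes the factor 1 - x from one product and adds 1 - 1/x to the other; their
ratio gives -1/x. -/
lemma j_mul_self (hq0 : q ≠ 0) (hq : ‖q‖ < 1) {x : ℂ} (hx : x ≠ 0) :
    j (q * x) q = -x⁻¹ * j x q := by
  unfold j
  have h1 := qPoch_eq_mul hq x
  have h2 := qPoch_eq_mul hq x⁻¹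
  rw [show q / (q * x) = x⁻¹ by field_simp, h1, h2, ← div_eq_mul_inv]
  field_simp
  ring

lemma j_self_div (hq0 : q ≠ 0) {x : ℂ} (hx : x ≠ 0) : j (q / x) q = j x q := by
  unfold j
  rw [show q / (q / x) = x by field_simp]
  ring

lemma j_inv (hq0 : q ≠ 0) (hq : ‖q‖ < 1) {x : ℂ} (hx : x ≠ 0) :
    j x⁻¹ q = -x⁻¹ * j x q := by
  rw [← j_self_div hq0 (inv_ne_zero hx), div_inv_eq_mul, j_mul_self hq0 hq hx]

/-- The value of `j(x;q) / (1 - x)`, extended to `x = 1`. -/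
def jDiv (x q : ℂ) : ℂ := qPoch (q * x) q * qPoch (q / x) q * qPoch q q

lemma j_eq_mul_jDiv (hq : ‖q‖ < 1) (x : ℂ) : j x q = (1 - x) * jDiv x q := by
  unfold j jDiv
  rw [qPoch_eq_mul hq x]
  ring

lemma jDiv_one : jDiv 1 q = qPoch q q ^ 3 := by
  simp [jDiv]; ring

lemma differentiableAt_j (hq : ‖q‖ < 1) {x : ℂ} (hx : x ≠ 0) :
    DifferentiableAt ℂ (fun x => j x q) x := by
  have hd := differentiable_qPoch hq
  unfold j
  refine ((hd x).mul ?_).mul_const _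
  exact (hd (q / x)).comp x ((differentiableAt_const q).div differentiableAt_id hx)

lemma differentiableAt_jDiv (hq : ‖q‖ < 1) {x : ℂ} (hx : x ≠ 0) :
    DifferentiableAt ℂ (fun x => jDiv x q) x := by
  have hd := differentiable_qPoch hq
  unfold jDiv
  refine (DifferentiableAt.mul ?_ ?_).mul_const _
  · exact (hd (q * x)).comp x (differentiableAt_id.const_mul q)
  · exact (hd (q / x)).comp x ((differentiableAt_const q).div differentiableAt_id hx)

lemma qPoch_self_ne_zero (hq : ‖q‖ < 1) : qPoch q q ≠ 0 :=
  qPoch_ne_zero_of_norm_lt_one hq hq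

lemma j_ne_zero (hq0 : q ≠ 0) (hq : ‖q‖ < 1) {x : ℂ} (hx : x ≠ 0) (h : ∀ n : ℤ, x ≠ q ^ n) :
    j x q ≠ 0 := by
  refine mul_ne_zero (mul_ne_zero (qPoch_ne_zero hq fun i hi => ?_) (qPoch_ne_zero hq fun i hi => ?_))
    (qPoch_self_ne_zero hq)
  · refine h (-i) ?_
    rw [zpow_neg, zpow_natCast]
    exact eq_inv_of_mul_eq_one_right hi
  · refine h (i + 1) ?_
    rw [zpow_add_one₀ hq0, zpow_natCast]
    field_simp at hi
    linear_combination -hi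

/-- Pair 1 - q^i x with 1 + q^i x. With q² in place of q, this is what cancels the denominator of m
in the summands of `G`. -/
lemma j_sq (hq : ‖q‖ < 1) (x : ℂ) :
    j (x ^ 2) (q ^ 2) * qPoch q q ^ 2 = qPoch (q ^ 2) (q ^ 2) * (j x q * j (-x) q) := by
  unfold j
  rw [← div_pow, qPoch_sq hq x, qPoch_sq hq (q / x), div_neg]
  ring

lemma j_even_odd (hq0 : q ≠ 0) (hq : ‖q‖ < 1) {x : ℂ} (hx : x ≠ 0) :
    j x q * qPoch (q ^ 2) (q ^ 2) ^ 2 = qPoch q q * (j x (q ^ 2) * j (q * x) (q ^ 2)) := by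
  unfold j
  rw [qPoch_even_odd hq x, qPoch_even_odd hq (q / x),
    show q * (q / x) = q ^ 2 / x by ring, show q ^ 2 / (q * x) = q / x by field_simp]
  ring

lemma qPoch_self_eq (hq : ‖q‖ < 1) : qPoch q q = qPoch q (q ^ 2) * qPoch (q ^ 2) (q ^ 2) := by
  rw [qPoch_even_odd hq q, ← sq]

lemma j_self_sq (hq0 : q ≠ 0) (hq : ‖q‖ < 1) :
    j q (q ^ 2) * qPoch (q ^ 2) (q ^ 2) = qPoch q q ^ 2 := by
  rw [qPoch_self_eq hq, j, show q ^ 2 / q = q by field_simp]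
  ring

lemma j_neg_one (hq : ‖q‖ < 1) : j (-1) q * qPoch q q = 2 * qPoch (q ^ 2) (q ^ 2) ^ 2 := by
  rw [qPoch_sq hq q, j, qPoch_eq_mul hq (-1)]
  simp only [div_neg, div_one, mul_neg, mul_one]
  ring

/-- Comes from squaring (q²;q²)_∞ = (q;q²)_∞ (-q;q²)_∞ (q⁴;q⁴)_∞. The value enters the residues of
the theta summand at 1 and at q. -/
lemma j_neg_self_sq (hq0 : q ≠ 0) (hq : ‖q‖ < 1) :
    j (-q) (q ^ 2) * qPoch q q ^ 2 * qPoch (q ^ 4) (q ^ 4) ^ 2 = qPoch (q ^ 2) (q ^ 2) ^ 5 := by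
  have h1 := qPoch_self_eq (norm_sq_lt_one hq)
  have h2 := qPoch_sq (norm_sq_lt_one hq) q
  rw [show (q ^ 2) ^ 2 = q ^ 4 by ring] at h1 h2
  rw [h2] at h1
  have h3 := qPoch_self_eq hq
  rw [j, show q ^ 2 / -q = -q by field_simp, h3]
  have h4 : qPoch (q ^ 2) (q ^ 2) ^ 2 =
    (qPoch q (q ^ 2) * qPoch (-q) (q ^ 2) * qPoch (q ^ 4) (q ^ 4)) ^ 2 := by rw [← h1]
  linear_combination -(qPoch (q ^ 2) (q ^ 2)) ^ 3 * h4

end Theta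

/-! ### Triangular exponents and shifts of sums over the integers. -/

/-- The exponent `r(r-1)/2`. -/
def tri (r : ℤ) : ℤ := r * (r - 1) / 2

lemma two_mul_tri (r : ℤ) : 2 * tri r = r * (r - 1) :=
  Int.mul_ediv_cancel' (by
    rcases Int.even_or_odd r with h | h
    · exact (even_iff_two_dvd.1 h).mul_right _
    · exact (even_iff_two_dvd.1 (h.sub_odd odd_one)).mul_left _)

lemma tri_add_one (r : ℤ) : tri (r + 1) = tri r + r := by
  have h1 := two_mul_tri r
  have h2 := two_mul_tri (r + 1)
  nlinarith

lemma tri_one_sub (r : ℤ) : tri (1 - r) = tri r := by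
  unfold tri; congr 1; ring

lemma zpow_tri_add_one {K : Type*} [Field K] {q : K} (hq0 : q ≠ 0) (r : ℤ) :
    q ^ tri (r + 1) = q ^ tri r * q ^ r := by
  rw [tri_add_one, zpow_add₀ hq0]

lemma summable_zpow_tri_real {ρ R : ℝ} (h0 : 0 < ρ) (h1 : ρ < 1) (hR : 0 < R) :
    Summable fun r : ℤ => ρ ^ tri r * R ^ r := by
  have hpow : Tendsto (fun n : ℕ => ρ ^ n) atTop (𝓝 0) :=
    tendsto_pow_atTop_nhds_zero_of_lt_one h0.le h1
  refine Summable.of_nat_of_neg ?_ ?_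
  · refine summable_of_ratio_test_tendsto_lt_one (l := 0) one_pos
      (Eventually.of_forall fun n => by positivity) ?_
    have h : ∀ n : ℕ, ‖ρ ^ tri ((n + 1 : ℕ) : ℤ) * R ^ ((n + 1 : ℕ) : ℤ)‖ /
        ‖ρ ^ tri (n : ℤ) * R ^ (n : ℤ)‖ = ρ ^ n * R := fun n => by
      rw [Real.norm_of_nonneg (by positivity), Real.norm_of_nonneg (by positivity)]
      push_cast
      rw [zpow_tri_add_one h0.ne', zpow_add_one₀ hR.ne', zpow_natCast ρ n]
      field_simp
    simp only [h]
    simpa using hpow.mul_const R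
  · refine summable_of_ratio_test_tendsto_lt_one (l := 0) one_pos
      (Eventually.of_forall fun n => by positivity) ?_
    have h : ∀ n : ℕ, ‖ρ ^ tri (-((n + 1 : ℕ) : ℤ)) * R ^ (-((n + 1 : ℕ) : ℤ))‖ /
        ‖ρ ^ tri (-(n : ℤ)) * R ^ (-(n : ℤ))‖ = ρ ^ n * (ρ / R) := fun n => by
      rw [Real.norm_of_nonneg (by positivity), Real.norm_of_nonneg (by positivity)]
      have e1 : (-(n : ℤ)) = (-((n + 1 : ℕ) : ℤ)) + 1 := by push_cast; ring
      rw [e1, zpow_tri_add_one h0.ne', zpow_add_one₀ hR.ne', zpow_neg ρ, zpow_natCast ρ]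
      field_simp
      ring
    simp only [h]
    simpa using hpow.mul_const (ρ / R)

lemma summable_int_add {f : ℤ → ℂ} (hf : Summable f) (m : ℤ) : Summable fun k => f (k + m) :=
  (Equiv.addRight m).summable_iff (f := f) |>.2 hf

lemma tsum_int_add (f : ℤ → ℂ) (m : ℤ) : ∑' k, f (k + m) = ∑' k, f k :=
  (Equiv.addRight m).tsum_eq f

/-! ### The Jacobi triple product identity. -/

section TripleProduct

variable {q : ℂ}

lemma summable_norm_zpow_tri (hq0 : q ≠ 0) (hq : ‖q‖ < 1) {b : ℂ} (hb : b ≠ 0) :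
    Summable fun r : ℤ => ‖q ^ tri r * b ^ r‖ := by
  simp only [norm_mul, norm_zpow]
  exact summable_zpow_tri_real (norm_pos_iff.2 hq0) hq (norm_pos_iff.2 hb)

/-- `(q^{m+1};q)_∞`, which is `(q;q)_∞ / (q;q)_m` for `m ≥ 0` and `0` for `m < 0`. -/
def qTail (q : ℂ) (m : ℤ) : ℂ := qPoch (q ^ (m + 1)) q

lemma qTail_sub_one (hq0 : q ≠ 0) (hq : ‖q‖ < 1) (m : ℤ) :
    qTail q (m - 1) = (1 - q ^ m) * qTail q m := by
  unfold qTail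
  rw [qPoch_eq_mul hq, sub_add_cancel, mul_comm q, ← zpow_add_one₀ hq0]

/-- The zero of (1;q)_∞ at m = -1 is carried downward by the recurrence. Hence the sum over all
integers in `tsum_tri_qTail` has only the terms with |k| ≤ n. -/
lemma qTail_neg (hq0 : q ≠ 0) (hq : ‖q‖ < 1) (n : ℕ) : qTail q (-n - 1) = 0 := by
  induction n with
  | zero => simp [qTail, qPoch_one hq]
  | succ n ih =>
    rw [qTail_sub_one hq0 hq, show (-((n + 1 : ℕ) : ℤ)) = -n - 1 by push_cast; ring, ih, mul_zero]

lemma qTail_of_neg (hq0 : q ≠ 0) (hq : ‖q‖ < 1) {m : ℤ} (hm : m < 0) : qTail q m = 0 := by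
  have h := qTail_neg hq0 hq (-m - 1).toNat
  rwa [Int.toNat_of_nonneg (by omega), show -(-m - 1) - 1 = m by ring] at h

lemma tendsto_qTail (hq0 : q ≠ 0) (hq : ‖q‖ < 1) (k : ℤ) :
    Tendsto (fun n : ℕ => qTail q (n + k)) atTop (𝓝 1) := by
  have h1 : Tendsto (fun n : ℕ => q ^ n * q ^ (k + 1)) atTop (𝓝 0) := by
    simpa using (tendsto_pow_atTop_nhds_zero_of_norm_lt_one hq).mul_const (q ^ (k + 1))
  have h2 := ((differentiable_qPoch hq).continuous.tendsto 0).comp h1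
  rw [qPoch_zero] at h2
  refine h2.congr fun n => ?_
  rw [qTail, add_assoc, zpow_add₀ hq0 (n : ℤ), zpow_natCast, Function.comp_apply]

lemma exists_norm_qTail_le (hq0 : q ≠ 0) (hq : ‖q‖ < 1) : ∃ C, 0 ≤ C ∧ ∀ m, ‖qTail q m‖ ≤ C := by
  obtain ⟨C, hC⟩ := (isCompact_closedBall (0 : ℂ) 1).exists_bound_of_continuousOn
    (differentiable_qPoch hq).continuous.continuousOn
  refine ⟨C, (norm_nonneg _).trans (hC 0 (by simp)), fun m => ?_⟩
  rcases lt_or_ge m 0 with hm | hm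
  · rw [qTail_of_neg hq0 hq hm, norm_zero]
    exact (norm_nonneg _).trans (hC 0 (by simp))
  · refine hC _ ?_
    lift m to ℕ using hm
    rw [mem_closedBall_zero_iff, ← Nat.cast_add_one, zpow_natCast, norm_pow]
    exact pow_le_one₀ (norm_nonneg _) hq.le

lemma summable_tri_qTail (hq0 : q ≠ 0) (hq : ‖q‖ < 1) {b : ℂ} (hb : b ≠ 0) (n : ℤ) :
    Summable fun k : ℤ => q ^ tri k * b ^ k * (qTail q (n - k) * qTail q (n + k)) := by
  obtain ⟨C, hC0, hC⟩ := exists_norm_qTail_le hq0 hq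
  refine Summable.of_norm_bounded ((summable_norm_zpow_tri hq0 hq hb).mul_right (C * C)) fun k => ?_
  rw [norm_mul, norm_mul (qTail q _)]
  exact mul_le_mul_of_nonneg_left (mul_le_mul (hC _) (hC _) (norm_nonneg _) hC0) (norm_nonneg _)

/-- Finite form of the Jacobi triple product identity. -/
lemma tsum_tri_qTail (hq0 : q ≠ 0) (hq : ‖q‖ < 1) {b : ℂ} (hb : b ≠ 0) (n : ℕ) :
    ∑' k : ℤ, q ^ tri k * b ^ k * (qTail q (n - k) * qTail q (n + k)) =
      (∏ i ∈ Finset.range n, (1 - q ^ i * -b)) * (∏ i ∈ Finset.range n, (1 - q ^ i * (q / -b))) *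
        (qTail q (2 * n) * qTail q 0) := by
  induction n with
  | zero =>
    rw [tsum_eq_single 0]
    · simp [tri]
    · intro k hk
      rcases lt_or_gt_of_ne hk with h | h
      · rw [qTail_of_neg hq0 hq (m := _ + k) (by simpa using h)]; simp
      · rw [qTail_of_neg hq0 hq (m := _ - k) (by simpa using h)]; simp
  | succ n ih =>
    set T : ℤ → ℂ := fun k => q ^ tri k * b ^ k * (qTail q (n - k) * qTail q (n + k)) with hT
    have hs : Summable T := summable_tri_qTail hq0 hq hb n
    have hs1 : Summable fun k => T (k - 1) := summable_int_add hs (-1)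
    have hs2 : Summable fun k => T (k + 1) := summable_int_add hs 1
    have e1 : ∑' k, T (k - 1) = ∑' k, T k := tsum_int_add T (-1)
    have e2 : ∑' k, T (k + 1) = ∑' k, T k := tsum_int_add T 1
    -- Passing from n to n + 1 multiplies the product side by (1 + q^n b)(1 + q^(n+1)/b); the
    -- coefficients on the left are those of its expansion, with b and 1/b realised as shifts of k.
    have key : ∀ k : ℤ, (1 + q ^ (2 * n + 1)) * T k + q ^ n * b * T (k - 1)
        + q ^ (n + 1) / b * T (k + 1) = (1 - q ^ (2 * n + 1)) * (1 - q ^ (2 * n + 2)) *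
        (q ^ tri k * b ^ k * (qTail q ((n + 1 : ℕ) - k) * qTail q ((n + 1 : ℕ) + k))) := by
      intro k
      have t1 : q ^ tri (k - 1) = q ^ tri k * (q ^ k)⁻¹ * q := by
        have := zpow_tri_add_one hq0 (k - 1)
        rw [sub_add_cancel, zpow_sub_one₀ hq0] at this
        rw [this]
        have := zpow_ne_zero k hq0
        field_simp
      have a1 := qTail_sub_one hq0 hq ((n : ℤ) + 1 - k)
      have a2 := qTail_sub_one hq0 hq ((n : ℤ) + 1 + k)
      have a3 := qTail_sub_one hq0 hq ((n : ℤ) - k)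
      have a4 := qTail_sub_one hq0 hq ((n : ℤ) + k)
      rw [show (n : ℤ) + 1 - k - 1 = n - k by ring] at a1
      rw [show (n : ℤ) + 1 + k - 1 = n + k by ring] at a2
      rw [zpow_sub₀ hq0, zpow_add_one₀ hq0, zpow_natCast] at a1
      rw [zpow_add₀ hq0, zpow_add_one₀ hq0, zpow_natCast] at a2
      rw [zpow_sub₀ hq0, zpow_natCast, a1] at a3
      rw [zpow_add₀ hq0, zpow_natCast, a2] at a4
      simp only [hT]
      rw [t1, zpow_tri_add_one hq0, zpow_sub_one₀ hb, zpow_add_one₀ hb,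
        show (n : ℤ) - (k - 1) = n + 1 - k by ring, show (n : ℤ) + (k - 1) = n + k - 1 by ring,
        show (n : ℤ) - (k + 1) = n - k - 1 by ring, show (n : ℤ) + (k + 1) = n + 1 + k by ring,
        a3, a4, a1, a2]
      push_cast
      have hk := zpow_ne_zero k hq0
      field_simp
      ring
    have hsum := ((hs.mul_left (1 + q ^ (2 * n + 1))).add (hs1.mul_left (q ^ n * b))).tsum_add
      (hs2.mul_left (q ^ (n + 1) / b))
    rw [(hs.mul_left _).tsum_add (hs1.mul_left _), tsum_mul_left, tsum_mul_left, tsum_mul_left,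
      e1, e2, tsum_congr key, tsum_mul_left, ih] at hsum
    have hne : ∀ m : ℕ, 1 - q ^ (m + 1) ≠ 0 := fun m h => by
      have h' : ‖q ^ (m + 1)‖ = 1 := by rw [← sub_eq_zero.1 h, norm_one]
      rw [norm_pow] at h'
      exact (pow_lt_one₀ (norm_nonneg q) hq (Nat.succ_ne_zero m)).ne h'
    have b1 := qTail_sub_one hq0 hq (2 * (n : ℤ) + 1)
    have b2 := qTail_sub_one hq0 hq (2 * (n : ℤ) + 2)
    rw [show 2 * (n : ℤ) + 2 - 1 = 2 * n + 1 by ring] at b2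
    rw [show 2 * (n : ℤ) + 1 - 1 = 2 * n by ring, b2] at b1
    rw [show 2 * (n : ℤ) + 1 = ((2 * n + 1 : ℕ) : ℤ) by push_cast; ring, zpow_natCast,
      show 2 * (n : ℤ) + 2 = ((2 * n + 2 : ℕ) : ℤ) by push_cast; ring, zpow_natCast] at b1
    refine mul_left_cancel₀ (mul_ne_zero (hne (2 * n)) (hne (2 * n + 1))) (hsum.trans ?_)
    rw [Finset.prod_range_succ, Finset.prod_range_succ,
      show 2 * ((n + 1 : ℕ) : ℤ) = ((2 * n + 2 : ℕ) : ℤ) by push_cast; ring, b1]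
    field_simp
    ring_nf

/-- The **Jacobi triple product identity**. -/
theorem tsum_tri_eq_j (hq0 : q ≠ 0) (hq : ‖q‖ < 1) {b : ℂ} (hb : b ≠ 0) :
    ∑' k : ℤ, q ^ tri k * b ^ k = j (-b) q := by
  obtain ⟨C, hC0, hC⟩ := exists_norm_qTail_le hq0 hq
  -- Let n → ∞ in the finite form: each `qTail` factor tends to 1 and is bounded by C uniformly, so
  -- the theta series dominates.
  have hlim : Tendsto
      (fun n : ℕ => ∑' k : ℤ, q ^ tri k * b ^ k * (qTail q (n - k) * qTail q (n + k)))
      atTop (𝓝 (∑' k : ℤ, q ^ tri k * b ^ k * (1 * 1))) := by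
    refine tendsto_tsum_of_dominated_convergence
      (bound := fun k => ‖q ^ tri k * b ^ k‖ * (C * C))
      ((summable_norm_zpow_tri hq0 hq hb).mul_right (C * C)) (fun k => ?_)
      (Eventually.of_forall fun n k => ?_)
    · refine Tendsto.const_mul _ (Tendsto.mul ?_ (tendsto_qTail hq0 hq k))
      simpa only [sub_eq_add_neg] using tendsto_qTail hq0 hq (-k)
    · rw [norm_mul, norm_mul (qTail q _)]
      exact mul_le_mul_of_nonneg_left (mul_le_mul (hC _) (hC _) (norm_nonneg _) hC0)
        (norm_nonneg _)
  have hlim' : Tendsto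
      (fun n : ℕ => ∑' k : ℤ, q ^ tri k * b ^ k * (qTail q (n - k) * qTail q (n + k)))
      atTop (𝓝 (qPoch (-b) q * qPoch (q / -b) q * (1 * qTail q 0))) := by
    simp only [tsum_tri_qTail hq0 hq hb]
    refine Tendsto.mul (Tendsto.mul (multipliable_qPoch hq _).tendsto_prod_tprod_nat
      (multipliable_qPoch hq _).tendsto_prod_tprod_nat) (Tendsto.mul_const _ ?_)
    refine ((tendsto_qTail hq0 hq 0).comp (tendsto_id.const_mul_atTop' two_pos)).congr fun n => ?_
    simp
  have h := tendsto_nhds_unique hlim hlim'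
  simpa [j, qTail] using h

end TripleProduct

/-! ### Removable singularities. -/

section Removable

/-- The limit of `f` along punctured neighbourhoods. -/
def reg (f : ℂ → ℂ) (x : ℂ) : ℂ := limUnder (𝓝[≠] x) f

lemma reg_eq {f : ℂ → ℂ} {x : ℂ} (h : ContinuousAt f x) : reg f x = f x :=
  (h.tendsto.mono_left nhdsWithin_le_nhds).limUnder_eq

/-- Riemann's theorem, with its hypothesis in the form of a vanishing residue limit, so that poles
of several summands can be cancelled by adding limits. -/
lemma tendsto_reg {f : ℂ → ℂ} {c : ℂ} (hd : ∀ᶠ w in 𝓝[≠] c, DifferentiableAt ℂ f w)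
    (hr : Tendsto (fun w => (w - c) * f w) (𝓝[≠] c) (𝓝 0)) :
    Tendsto f (𝓝[≠] c) (𝓝 (reg f c)) := by
  refine Complex.tendsto_limUnder_of_differentiable_on_punctured_nhds_of_isLittleO hd ?_
  rw [Asymptotics.isLittleO_iff_tendsto']
  -- The criterion concerns f w - f c, where f c is an arbitrary value at the singular point; its
  -- contribution (w - c) f c tends to 0 anyway.
  · have h1 : Tendsto (fun w => (w - c) * f c) (𝓝[≠] c) (𝓝 0) := by
      have : ContinuousAt (fun w => (w - c) * f c) c := by fun_prop
      simpa using this.tendsto.mono_left nhdsWithin_le_nhds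
    have h2 := hr.sub h1
    rw [sub_zero] at h2
    refine h2.congr fun w => ?_
    rw [div_inv_eq_mul]; ring
  · filter_upwards [self_mem_nhdsWithin] with w hw h
    exact absurd (inv_eq_zero.1 h) (sub_ne_zero.2 hw)

lemma eventually_reg_eventuallyEq {f : ℂ → ℂ} {c : ℂ}
    (hd : ∀ᶠ w in 𝓝[≠] c, DifferentiableAt ℂ f w) : ∀ᶠ w in 𝓝[≠] c, reg f =ᶠ[𝓝 w] f := by
  filter_upwards [eventually_eventually_nhdsWithin.2 hd, self_mem_nhdsWithin] with w hw hwc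
  rw [(isOpen_compl_singleton.nhdsWithin_eq hwc)] at hw
  filter_upwards [hw] with v hv using reg_eq hv.continuousAt

lemma analyticAt_reg {f : ℂ → ℂ} {c : ℂ} (hd : ∀ᶠ w in 𝓝[≠] c, DifferentiableAt ℂ f w)
    (hr : Tendsto (fun w => (w - c) * f w) (𝓝[≠] c) (𝓝 0)) : AnalyticAt ℂ (reg f) c := by
  have he := eventually_reg_eventuallyEq hd
  refine Complex.analyticAt_of_differentiable_on_punctured_nhds_of_continuousAt ?_ ?_
  · filter_upwards [he, hd] with w h1 h2 using h1.differentiableAt_iff.2 h2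
  · rw [← continuousWithinAt_compl_self]
    refine (tendsto_reg hd hr).congr' ?_
    filter_upwards [he] with w hw using hw.eq_of_nhds.symm

end Removable

/-! ### Functions with a q-shift equation on the punctured plane. -/

section Vanishing

variable {q : ℂ} {D μ : ℂ → ℂ}

lemma tendsto_const_mul_punctured {q : ℂ} (hq0 : q ≠ 0) (x : ℂ) :
    Tendsto (fun w => q * w) (𝓝[≠] x) (𝓝[≠] (q * x)) := by
  refine tendsto_nhdsWithin_iff.2 ⟨?_, ?_⟩
  · exact ((continuous_const_mul q).tendsto x).mono_left nhdsWithin_le_nhds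
  · filter_upwards [self_mem_nhdsWithin] with w hw h
    exact hw (mul_left_cancel₀ hq0 h)

lemma tendsto_residue_mul (hq0 : q ≠ 0) (hμ : Continuous μ) {x : ℂ}
    (hf : ∀ᶠ w in 𝓝[≠] x, D (q * w) = μ w * D w)
    (hr : Tendsto (fun w => (w - x) * D w) (𝓝[≠] x) (𝓝 0)) :
    Tendsto (fun w => (w - q * x) * D w) (𝓝[≠] (q * x)) (𝓝 0) := by
  have h1 : Tendsto (fun w => q * μ w * ((w - x) * D w)) (𝓝[≠] x) (𝓝 0) := by
    have := (((hμ.const_mul q).tendsto x).mono_left nhdsWithin_le_nhds).mul hr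
    simpa using this
  have h2 := tendsto_const_mul_punctured (inv_ne_zero hq0) (q * x)
  rw [inv_mul_cancel_left₀ hq0] at h2
  refine (h1.comp h2).congr' ?_
  filter_upwards [h2.eventually hf] with w hw
  rw [mul_inv_cancel_left₀ hq0] at hw
  simp only [Function.comp_apply]
  rw [hw]
  field_simp

lemma tendsto_residue_of_mul (hq0 : q ≠ 0) (hμ : Continuous μ) {x : ℂ} (hμx : μ x ≠ 0)
    (hf : ∀ᶠ w in 𝓝[≠] x, D (q * w) = μ w * D w)
    (hr : Tendsto (fun w => (w - q * x) * D w) (𝓝[≠] (q * x)) (𝓝 0)) :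
    Tendsto (fun w => (w - x) * D w) (𝓝[≠] x) (𝓝 0) := by
  have h1 : Tendsto (fun w => (q * μ w)⁻¹ * ((q * w - q * x) * D (q * w))) (𝓝[≠] x) (𝓝 0) := by
    have := ((((hμ.const_mul q).tendsto x).inv₀ (mul_ne_zero hq0 hμx)).mono_left
      nhdsWithin_le_nhds).mul (hr.comp (tendsto_const_mul_punctured hq0 x))
    simpa using this
  refine h1.congr' ?_
  have h3 : ∀ᶠ w in 𝓝[≠] x, μ w ≠ 0 :=
    nhdsWithin_le_nhds (hμ.continuousAt.eventually_ne hμx)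
  filter_upwards [hf, h3] with w hw hw3
  rw [hw]
  field_simp

/-- The functional equation carries a vanishing residue in both directions along a q-orbit,
backwards because μ has no zeros off the origin. One representative per orbit then suffices. -/
lemma tendsto_residue_zpow (hq0 : q ≠ 0) (hμ : Continuous μ) (hμ0 : ∀ x, x ≠ 0 → μ x ≠ 0)
    (hf : ∀ x, x ≠ 0 → ∀ᶠ w in 𝓝[≠] x, D (q * w) = μ w * D w) {x : ℂ} (hx : x ≠ 0)
    (hr : Tendsto (fun w => (w - x) * D w) (𝓝[≠] x) (𝓝 0)) (n : ℤ) :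
    Tendsto (fun w => (w - q ^ n * x) * D w) (𝓝[≠] (q ^ n * x)) (𝓝 0) := by
  induction n with
  | zero => simpa using hr
  | succ n ih =>
    have h := tendsto_residue_mul hq0 hμ (hf _ (mul_ne_zero (zpow_ne_zero _ hq0) hx)) ih
    rwa [← mul_assoc, ← zpow_one_add₀ hq0, add_comm] at h
  | pred n ih =>
    have hy : q ^ (-(n : ℤ) - 1) * x ≠ 0 := mul_ne_zero (zpow_ne_zero _ hq0) hx
    refine tendsto_residue_of_mul hq0 hμ (hμ0 _ hy) (hf _ hy) ?_
    rwa [← mul_assoc, ← zpow_one_add₀ hq0, add_sub_cancel]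

/-- A function on the punctured plane contracted by `‖μ x‖ ‖q‖ < 1` near the origin is `o(1/x)`. -/
lemma tendsto_mul_self_zero (hq0 : q ≠ 0) (hq : ‖q‖ < 1) (hμ : Continuous μ)
    (hμ1 : ‖q * μ 0‖ < 1) (hc : ∀ x, x ≠ 0 → ContinuousAt D x)
    (hf : ∀ x, x ≠ 0 → D (q * x) = μ x * D x) :
    Tendsto (fun x => x * D x) (𝓝[≠] 0) (𝓝 0) := by
  obtain ⟨ρ, hρ1, hρ2⟩ := exists_between hμ1
  have hρ0 : 0 < ρ := (norm_nonneg _).trans_lt hρ1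
  have hnhds : ∀ᶠ x in 𝓝 (0 : ℂ), ‖q * μ x‖ < ρ :=
    (hμ.const_mul q).norm.continuousAt.eventually_lt continuousAt_const hρ1
  obtain ⟨r, hr0, hr⟩ := Metric.eventually_nhds_iff_ball.1 hnhds
  have hq0' : 0 < ‖q‖ := norm_pos_iff.2 hq0
  set R := r / 2 with hR
  have hR0 : 0 < R := by positivity
  -- A fundamental annulus: every x with 0 < ‖x‖ ≤ R is q^n y with y in this compact set, where x D
  -- x is bounded by M; each application of the functional equation then gains a factor ρ < 1.
  have hcomp : IsCompact (Metric.closedBall (0 : ℂ) R \ Metric.ball 0 (‖q‖ * R)) :=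
    (isCompact_closedBall _ _).diff Metric.isOpen_ball
  obtain ⟨M, hM⟩ := hcomp.exists_bound_of_continuousOn (f := fun x => x * D x) (by
    intro x hx
    have hx0 : x ≠ 0 := by
      rintro rfl
      exact hx.2 (by simpa using mul_pos hq0' hR0)
    exact (continuousAt_id.mul (hc x hx0)).continuousWithinAt)
  have hiter : ∀ n : ℕ, ∀ y : ℂ, y ≠ 0 → ‖y‖ ≤ R →
      ‖q ^ n * y * D (q ^ n * y)‖ ≤ ρ ^ n * ‖y * D y‖ := by
    intro n y hy hyR
    induction n with
    | zero => simp
    | succ n ih =>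
      have hne : q ^ n * y ≠ 0 := mul_ne_zero (pow_ne_zero _ hq0) hy
      have hle : ‖q ^ n * y‖ ≤ R := by
        rw [norm_mul, norm_pow]
        exact (mul_le_of_le_one_left (norm_nonneg _)
          (pow_le_one₀ (norm_nonneg _) hq.le)).trans hyR
      have hlt : ‖q * μ (q ^ n * y)‖ < ρ := hr _ (by
        rw [mem_ball_zero_iff]; linarith)
      rw [show q ^ (n + 1) * y = q * (q ^ n * y) by ring, hf _ hne,
        show q * (q ^ n * y) * (μ (q ^ n * y) * D (q ^ n * y)) =
          (q * μ (q ^ n * y)) * (q ^ n * y * D (q ^ n * y)) by ring, norm_mul, pow_succ']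
      calc _ ≤ ρ * (ρ ^ n * ‖y * D y‖) := mul_le_mul hlt.le ih (norm_nonneg _) hρ0.le
        _ = _ := by ring
  rw [Metric.tendsto_nhds]
  intro ε hε
  have hpow : Tendsto (fun n : ℕ => ρ ^ n * M) atTop (𝓝 0) := by
    simpa using (tendsto_pow_atTop_nhds_zero_of_lt_one hρ0.le hρ2).mul_const M
  obtain ⟨N, hN⟩ := eventually_atTop.1 (hpow.eventually_lt_const hε)
  have hball : ∀ᶠ x in 𝓝[≠] (0 : ℂ), ‖x‖ < ‖q‖ ^ N * R :=
    nhdsWithin_le_nhds (by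
      filter_upwards [Metric.ball_mem_nhds (0 : ℂ) (mul_pos (pow_pos hq0' N) hR0)] with x hx
      exact mem_ball_zero_iff.1 hx)
  filter_upwards [hball, self_mem_nhdsWithin] with x hx hx0
  have hxpos : 0 < ‖x‖ := norm_pos_iff.2 hx0
  have hx1 : ‖x‖ / R ≤ 1 := by
    rw [div_le_one hR0]
    exact hx.le.trans (mul_le_of_le_one_left hR0.le (pow_le_one₀ hq0'.le hq.le))
  obtain ⟨n, hn1, hn2⟩ := exists_nat_pow_near_of_lt_one (div_pos hxpos hR0) hx1 hq0' hq
  rw [lt_div_iff₀ hR0] at hn1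
  rw [div_le_iff₀ hR0] at hn2
  have hNn : N ≤ n := by
    by_contra hlt
    have : ‖q‖ ^ N ≤ ‖q‖ ^ (n + 1) := pow_le_pow_of_le_one hq0'.le hq.le (by omega)
    nlinarith
  set y := (q ^ n)⁻¹ * x with hy
  have hqn : q ^ n ≠ 0 := pow_ne_zero n hq0
  have hxy : q ^ n * y = x := mul_inv_cancel_left₀ hqn x
  have hy0 : y ≠ 0 := mul_ne_zero (inv_ne_zero hqn) hx0
  have hnormx : ‖x‖ = ‖q‖ ^ n * ‖y‖ := by rw [← hxy, norm_mul, norm_pow]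
  have hqpos : 0 < ‖q‖ ^ n := pow_pos hq0' n
  have hyR : ‖y‖ ≤ R := by
    rw [hnormx] at hn2; exact le_of_mul_le_mul_left hn2 hqpos
  have hyR' : ‖q‖ * R ≤ ‖y‖ := by
    rw [hnormx, pow_succ, mul_assoc] at hn1; exact (lt_of_mul_lt_mul_left hn1 hqpos.le).le
  have h1 := hiter n y hy0 hyR
  rw [hxy] at h1
  have h2 := hM y ⟨by simpa using hyR, by simpa using hyR'⟩
  rw [dist_zero_right]
  exact h1.trans_lt ((mul_le_mul_of_nonneg_left h2 (pow_nonneg hρ0.le _)).trans_lt (hN n hNn))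

/-- A meromorphic function on the punctured plane with at most removable singularities that
satisfies `D (q x) = μ x * D x` vanishes if `μ 0` is small and is not a power of `q`. -/
theorem eventually_eq_zero_of_qShift (hq0 : q ≠ 0) (hq : ‖q‖ < 1) (hμ : Continuous μ)
    (hμ1 : ‖q * μ 0‖ < 1) (hμ2 : ∀ k : ℕ, μ 0 ≠ q ^ k)
    (hd : ∀ x, x ≠ 0 → ∀ᶠ w in 𝓝[≠] x, DifferentiableAt ℂ D w)
    (hr : ∀ x, x ≠ 0 → Tendsto (fun w => (w - x) * D w) (𝓝[≠] x) (𝓝 0))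
    (hf : ∀ x, x ≠ 0 → ∀ᶠ w in 𝓝[≠] x, D (q * w) = μ w * D w) :
    ∀ x, x ≠ 0 → ∀ᶠ w in 𝓝[≠] x, D w = 0 := by
  have han : ∀ x, x ≠ 0 → AnalyticAt ℂ (reg D) x := fun x hx => analyticAt_reg (hd x hx) (hr x hx)
  have hfun : ∀ x, x ≠ 0 → reg D (q * x) = μ x * reg D x := by
    intro x hx
    have h1 := (tendsto_reg (hd _ (mul_ne_zero hq0 hx)) (hr _ (mul_ne_zero hq0 hx))).comp
      (tendsto_const_mul_punctured hq0 x)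
    have h2 := ((hμ.tendsto x).mono_left nhdsWithin_le_nhds).mul (tendsto_reg (hd x hx) (hr x hx))
    exact tendsto_nhds_unique_of_eventuallyEq h1 h2 (hf x hx)
  -- The first `reg` fills the singularities off the origin. The result is o(1/x) at 0, so a second
  -- `reg` fills the origin and gives an entire function.
  have hres := tendsto_mul_self_zero hq0 hq hμ hμ1 (fun x hx => (han x hx).continuousAt) hfun
  have hreg : ∀ x, x ≠ 0 → reg (reg D) x = reg D x := fun x hx => reg_eq (han x hx).continuousAt
  have han0 : AnalyticAt ℂ (reg (reg D)) 0 := by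
    refine analyticAt_reg ?_ (by simpa using hres)
    filter_upwards [self_mem_nhdsWithin] with w hw using (han w hw).differentiableAt
  have hana : AnalyticOnNhd ℂ (reg (reg D)) Set.univ := by
    intro x _
    rcases eq_or_ne x 0 with rfl | hx
    · exact han0
    · refine (han x hx).congr ?_
      filter_upwards [isOpen_ne.mem_nhds hx] with w hw using (hreg w hw).symm
  have hzero : ∀ᶠ w in 𝓝 (0 : ℂ), reg (reg D) w = 0 := by
    -- Otherwise the function is w^n g(w) near 0 with g(0) ≠ 0, and comparing leading coefficients
    -- in the functional equation gives q^n = μ 0.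
    by_contra hne
    obtain ⟨n, g, hg, hg0, hgn⟩ := han0.exists_eventuallyEq_pow_smul_nonzero_iff.2 hne
    have hgc := hg.continuousAt
    have hmul : Tendsto (fun w => q * w) (𝓝 (0 : ℂ)) (𝓝 0) := by
      simpa using (continuous_const_mul q).tendsto 0
    have he : ∀ᶠ w in 𝓝[≠] (0 : ℂ), q ^ n * g (q * w) = μ w * g w := by
      filter_upwards [nhdsWithin_le_nhds hgn, nhdsWithin_le_nhds (hmul.eventually hgn),
        self_mem_nhdsWithin] with w h1 h2 hw
      have h3 := hfun w hw
      rw [← hreg w hw, ← hreg _ (mul_ne_zero hq0 hw), h1, h2] at h3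
      simp only [sub_zero, smul_eq_mul] at h3
      refine mul_left_cancel₀ (pow_ne_zero n hw) ?_
      linear_combination h3
    have l1 : Tendsto (fun w => q ^ n * g (q * w)) (𝓝[≠] (0 : ℂ)) (𝓝 (q ^ n * g 0)) :=
      ((hgc.tendsto.comp hmul).const_mul _).mono_left nhdsWithin_le_nhds
    have l2 : Tendsto (fun w => μ w * g w) (𝓝[≠] (0 : ℂ)) (𝓝 (μ 0 * g 0)) :=
      ((hμ.tendsto 0).mul hgc.tendsto).mono_left nhdsWithin_le_nhds
    exact hμ2 n (mul_right_cancel₀ hg0 (tendsto_nhds_unique_of_eventuallyEq l1 l2 he)).symm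
  have hall := hana.eqOn_zero_of_preconnected_of_eventuallyEq_zero isPreconnected_univ
    (Set.mem_univ 0) hzero
  intro x hx
  filter_upwards [hd x hx, nhdsWithin_le_nhds (isOpen_ne.mem_nhds hx)] with w hw hw0
  rw [← reg_eq hw.continuousAt, ← hreg w hw0]
  exact hall (Set.mem_univ w)

end Vanishing

/-! ### The vanishing principle with explicit regular points. -/

section Vanishing

variable {q : ℂ} {D μ : ℂ → ℂ}

lemma tendsto_residue_zero_of_continuousAt {x : ℂ} (h : ContinuousAt D x) :
    Tendsto (fun w => (w - x) * D w) (𝓝[≠] x) (𝓝 0) := by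
  have h1 : ContinuousAt (fun w => (w - x) * D w) x := by fun_prop
  simpa using h1.tendsto.mono_left nhdsWithin_le_nhds

lemma tendsto_punctured {f : ℂ → ℂ} {x : ℂ} (h : ContinuousAt f x) :
    Tendsto f (𝓝[≠] x) (𝓝 (f x)) :=
  h.tendsto.mono_left nhdsWithin_le_nhds

lemma eq_of_eventually_eq_punctured {f g : ℂ → ℂ} {x : ℂ} (hf : ContinuousAt f x)
    (hg : ContinuousAt g x) (h : ∀ᶠ w in 𝓝[≠] x, f w = g w) : f x = g x :=
  tendsto_nhds_unique_of_eventuallyEq (hf.tendsto.mono_left nhdsWithin_le_nhds)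
    (hg.tendsto.mono_left nhdsWithin_le_nhds) h

/-- Form of `eventually_eq_zero_of_qShift` with an explicit set of regular points, residues being
checked at one point of each `q`-orbit. -/
theorem eq_zero_of_qShift (hq0 : q ≠ 0) (hq : ‖q‖ < 1) (hμ : Continuous μ)
    (hμ0 : ∀ x, x ≠ 0 → μ x ≠ 0) (hμ1 : ‖q * μ 0‖ < 1) (hμ2 : ∀ k : ℕ, μ 0 ≠ q ^ k)
    {S : Set ℂ} (hS : ∀ x, x ≠ 0 → ∀ᶠ w in 𝓝[≠] x, w ∈ S)
    (hd : ∀ x ∈ S, x ≠ 0 → DifferentiableAt ℂ D x)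
    (hf : ∀ x ∈ S, x ≠ 0 → D (q * x) = μ x * D x)
    (hr : ∀ x, x ≠ 0 → x ∉ S → ∃ y, y ≠ 0 ∧ (∃ n : ℤ, x = q ^ n * y) ∧
      Tendsto (fun w => (w - y) * D w) (𝓝[≠] y) (𝓝 0)) :
    ∀ x ∈ S, x ≠ 0 → D x = 0 := by
  have hev : ∀ x, x ≠ 0 → ∀ᶠ w in 𝓝[≠] x, w ∈ S ∧ w ≠ 0 := fun x hx =>
    (hS x hx).and (nhdsWithin_le_nhds (isOpen_ne.mem_nhds hx))
  have hf' : ∀ x, x ≠ 0 → ∀ᶠ w in 𝓝[≠] x, D (q * w) = μ w * D w := fun x hx =>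
    (hev x hx).mono fun w hw => hf w hw.1 hw.2
  have hd' : ∀ x, x ≠ 0 → ∀ᶠ w in 𝓝[≠] x, DifferentiableAt ℂ D w := fun x hx =>
    (hev x hx).mono fun w hw => hd w hw.1 hw.2
  have hz := eventually_eq_zero_of_qShift hq0 hq hμ hμ1 hμ2 hd' (fun x hx => by
    by_cases hxS : x ∈ S
    · exact tendsto_residue_zero_of_continuousAt (hd x hxS hx).continuousAt
    · obtain ⟨y, hy, ⟨n, rfl⟩, hres⟩ := hr x hx hxS
      exact tendsto_residue_zpow hq0 hμ hμ0 hf' hy hres n) hf'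
  intro x hxS hx
  exact eq_of_eventually_eq_punctured (hd x hxS hx).continuousAt
    (continuousAt_const (y := (0 : ℂ))) (hz x hx)

end Vanishing

/-! ### Series of simple fractions with poles at powers of p. -/

section PoleSum

variable {p : ℂ}

/-- The quotient of the two sides tends to 1 as n → ∞ and to 1/‖u‖ as n → -∞, hence is bounded. This
makes convergence of a series with denominators 1 - u p^n a condition on the coefficients alone. -/
lemma exists_one_add_norm_zpow_le (hp0 : p ≠ 0) (hp : ‖p‖ < 1) {u : ℂ} (hu : u ≠ 0) :
    ∃ M : ℝ, 0 < M ∧ ∀ n : ℤ, u * p ^ n ≠ 1 → 1 + ‖p ^ n‖ ≤ M * ‖1 - u * p ^ n‖ := by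
  have hp1 : Tendsto (fun n : ℕ => p ^ n) atTop (𝓝 0) :=
    tendsto_pow_atTop_nhds_zero_of_norm_lt_one hp
  have h1 : Tendsto (fun n : ℕ => (1 + ‖p ^ n‖) / ‖1 - u * p ^ n‖) atTop
      (𝓝 ((1 + ‖(0 : ℂ)‖) / ‖1 - u * 0‖)) :=
    (hp1.norm.const_add 1).div ((hp1.const_mul u).const_sub 1).norm (by simp)
  have h2 : Tendsto (fun n : ℕ => (‖p ^ n‖ + 1) / ‖p ^ n - u‖) atTop
      (𝓝 ((‖(0 : ℂ)‖ + 1) / ‖0 - u‖)) :=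
    (hp1.norm.add_const 1).div (hp1.sub_const u).norm (by simpa using hu)
  obtain ⟨M1, hM1⟩ := h1.bddAbove_range
  obtain ⟨M2, hM2⟩ := h2.bddAbove_range
  refine ⟨max 1 (max M1 M2), by positivity, fun n hn => ?_⟩
  have hpos : 0 < ‖1 - u * p ^ n‖ := norm_pos_iff.2 (sub_ne_zero.2 (Ne.symm hn))
  rw [← div_le_iff₀ hpos]
  obtain ⟨m, rfl | rfl⟩ := n.eq_nat_or_neg
  · have := hM1 (Set.mem_range_self m)
    simp only [zpow_natCast]
    exact this.trans ((le_max_left _ _).trans (le_max_right _ _))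
  · have := hM2 (Set.mem_range_self m)
    refine le_trans (le_of_eq ?_) (this.trans ((le_max_right _ _).trans (le_max_right _ _)))
    have hpm : p ^ m ≠ 0 := pow_ne_zero m hp0
    have e : 1 - u * p ^ (-(m : ℤ)) = (p ^ m - u) / p ^ m := by
      rw [zpow_neg, zpow_natCast]; field_simp
    rw [e, zpow_neg, zpow_natCast, norm_div, norm_inv]
    have : ‖p ^ m‖ ≠ 0 := norm_ne_zero_iff.2 hpm
    field_simp

/-- Moving u by less than 1/(2M) costs at most half of the previous bound, so 2M works on a whole
disc. Only the indices singular at the centre are excluded. -/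
lemma exists_one_add_norm_zpow_le_ball (hp0 : p ≠ 0) (hp : ‖p‖ < 1) {u₀ : ℂ} (hu : u₀ ≠ 0) :
    ∃ M : ℝ, 0 < M ∧ ∃ r : ℝ, 0 < r ∧ ∀ u ∈ Metric.ball u₀ r, ∀ n : ℤ, u₀ * p ^ n ≠ 1 →
      1 + ‖p ^ n‖ ≤ M * ‖1 - u * p ^ n‖ := by
  obtain ⟨M, hM0, hM⟩ := exists_one_add_norm_zpow_le hp0 hp hu
  refine ⟨2 * M, by positivity, 1 / (2 * M), by positivity, fun u hub n hn => ?_⟩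
  have h1 := hM n hn
  have h2 : ‖1 - u₀ * p ^ n‖ ≤ ‖1 - u * p ^ n‖ + ‖u - u₀‖ * ‖p ^ n‖ := by
    rw [← norm_mul]
    refine le_trans (le_of_eq ?_) (norm_add_le _ _)
    congr 1; ring
  have h3 : ‖u - u₀‖ < 1 / (2 * M) := by rwa [← dist_eq_norm]
  have h4 : M * (‖u - u₀‖ * ‖p ^ n‖) ≤ 1 / 2 * ‖p ^ n‖ := by
    rw [← mul_assoc]
    refine mul_le_mul_of_nonneg_right ?_ (norm_nonneg _)
    rw [lt_div_iff₀ (by positivity)] at h3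
    nlinarith
  have h5 := mul_le_mul_of_nonneg_left h2 hM0.le
  nlinarith [norm_nonneg (p ^ n)]

lemma ne_of_one_add_norm_le {M : ℝ} {u v : ℂ} (h : 1 + ‖v‖ ≤ M * ‖1 - u‖) : u ≠ 1 := by
  rintro rfl
  simp only [sub_self, norm_zero, mul_zero] at h
  linarith [norm_nonneg v]

lemma eventually_mul_zpow_ne_one (hp0 : p ≠ 0) (hp : ‖p‖ < 1) {u₀ : ℂ} (hu : u₀ ≠ 0) :
    ∀ᶠ u in 𝓝[≠] u₀, ∀ n : ℤ, u * p ^ n ≠ 1 := by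
  obtain ⟨M, hM0, r, hr, h⟩ := exists_one_add_norm_zpow_le_ball hp0 hp hu
  filter_upwards [nhdsWithin_le_nhds (Metric.ball_mem_nhds u₀ hr), self_mem_nhdsWithin]
    with u hub hne n
  by_cases hn : u₀ * p ^ n = 1
  · intro h'
    exact hne (mul_right_cancel₀ (zpow_ne_zero n hp0) (h'.trans hn.symm))
  · exact ne_of_one_add_norm_le (h u hub n hn)

lemma mul_zpow_ne_one_iff (hp0 : p ≠ 0) {u : ℂ} :
    (∀ n : ℤ, u * p ^ n ≠ 1) ↔ ∀ n : ℤ, u ≠ p ^ n := by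
  constructor
  · intro h n hn
    refine h (-n) ?_
    rw [hn, ← zpow_add₀ hp0, add_neg_cancel, zpow_zero]
  · intro h n hn
    refine h (-n) ?_
    rw [zpow_neg]
    exact eq_inv_of_mul_eq_one_left hn

lemma eventually_ne_zpow (hp0 : p ≠ 0) (hp : ‖p‖ < 1) {u₀ : ℂ} (hu : u₀ ≠ 0) :
    ∀ᶠ u in 𝓝[≠] u₀, ∀ n : ℤ, u ≠ p ^ n :=
  (eventually_mul_zpow_ne_one hp0 hp hu).mono fun _ h => (mul_zpow_ne_one_iff hp0).1 h

variable {ι : Type*} {n : ι → ℤ} {c : ι → ℂ}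

/-- The sum `∑ c_i / (1 - u p^{n_i})`. -/
def poleSum (p : ℂ) (n : ι → ℤ) (c : ι → ℂ) (u : ℂ) : ℂ := ∑' i, c i / (1 - u * p ^ n i)

lemma norm_div_le_of_one_add_norm_le {M : ℝ} {u v c : ℂ}
    (h : 1 + ‖v‖ ≤ M * ‖1 - u‖) : ‖c / (1 - u)‖ ≤ M * (‖c‖ / (1 + ‖v‖)) := by
  have hpos : 0 < ‖1 - u‖ :=
    norm_pos_iff.2 (sub_ne_zero.2 (Ne.symm (ne_of_one_add_norm_le h)))
  have hv : 0 < 1 + ‖v‖ := by positivity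
  rw [norm_div, mul_div_assoc', div_le_div_iff₀ hpos hv]
  nlinarith [mul_le_mul_of_nonneg_left h (norm_nonneg c)]

lemma summable_poleSum (hp0 : p ≠ 0) (hp : ‖p‖ < 1)
    (hc : Summable fun i => ‖c i‖ / (1 + ‖p ^ n i‖)) {u : ℂ} (hu : u ≠ 0) :
    Summable fun i => c i / (1 - u * p ^ n i) := by
  obtain ⟨M, hM0, hM⟩ := exists_one_add_norm_zpow_le hp0 hp hu
  refine Summable.of_norm_bounded (hc.mul_left M) fun i => ?_
  by_cases h : u * p ^ n i = 1
  · rw [h, sub_self, div_zero, norm_zero]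
    positivity
  · exact norm_div_le_of_one_add_norm_le (hM _ h)

lemma differentiableAt_poleSum (hp0 : p ≠ 0) (hp : ‖p‖ < 1)
    (hc : Summable fun i => ‖c i‖ / (1 + ‖p ^ n i‖)) {u : ℂ} (hu : u ≠ 0)
    (h : ∀ i, c i = 0 ∨ u * p ^ n i ≠ 1) : DifferentiableAt ℂ (poleSum p n c) u := by
  obtain ⟨M, hM0, r, hr, hM⟩ := exists_one_add_norm_zpow_le_ball hp0 hp hu
  have hd : DifferentiableOn ℂ (poleSum p n c) (Metric.ball u r) := by
    refine Complex.differentiableOn_tsum_of_summable_norm (hc.mul_left M) (fun i => ?_) Metric.isOpen_ball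
      (fun i w hw => ?_)
    · rcases h i with hi | hi
      · simp only [hi, zero_div]; fun_prop
      · intro w hw
        have := ne_of_one_add_norm_le (hM w hw _ hi)
        refine DifferentiableAt.differentiableWithinAt ?_
        exact (differentiableAt_const _).div (by fun_prop) (sub_ne_zero.2 (Ne.symm this))
    · rcases h i with hi | hi
      · simp [hi]
      · exact norm_div_le_of_one_add_norm_le (hM w hw _ hi)
  exact hd.differentiableAt (Metric.ball_mem_nhds u hr)

/-- Set the coefficient at i₀ to zero: the remaining series is holomorphic at u₀, because any other
singular index carries a zero coefficient. As p^(n i₀) = 1/u₀, the isolated term is -u₀ c / (u -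
u₀). -/
lemma tendsto_residue_poleSum (hp0 : p ≠ 0) (hp : ‖p‖ < 1)
    (hc : Summable fun i => ‖c i‖ / (1 + ‖p ^ n i‖)) {u₀ : ℂ} (hu : u₀ ≠ 0) {i₀ : ι}
    (hi₀ : u₀ * p ^ n i₀ = 1) (h : ∀ i, c i ≠ 0 → u₀ * p ^ n i = 1 → i = i₀) :
    Tendsto (fun u => (u - u₀) * poleSum p n c u) (𝓝[≠] u₀) (𝓝 (-u₀ * c i₀)) := by
  classical
  set c' : ι → ℂ := Function.update c i₀ 0 with hc'
  have hs' : Summable fun i => ‖c' i‖ / (1 + ‖p ^ n i‖) := by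
    refine Summable.of_nonneg_of_le (fun i => by positivity) (fun i => ?_) hc
    by_cases hi : i = i₀
    · rw [hc', hi, Function.update_self, norm_zero, zero_div]; positivity
    · rw [hc', Function.update_of_ne hi]
  have hd : DifferentiableAt ℂ (poleSum p n c') u₀ :=
    differentiableAt_poleSum hp0 hp hs' hu fun i => by
      by_cases hi : i = i₀
      · left; rw [hc', hi, Function.update_self]
      · by_cases hci : c i = 0
        · left; rw [hc', Function.update_of_ne hi, hci]
        · right; exact fun h' => hi (h i hci h')
  have h1 := (tendsto_residue_zero_of_continuousAt hd.continuousAt).add_const (-u₀ * c i₀)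
  rw [zero_add] at h1
  refine h1.congr' ?_
  filter_upwards [self_mem_nhdsWithin, nhdsWithin_le_nhds (isOpen_ne.mem_nhds hu)] with u hne hu0
  have hsplit : poleSum p n c u = c i₀ / (1 - u * p ^ n i₀) + poleSum p n c' u := by
    unfold poleSum
    rw [(summable_poleSum hp0 hp hc hu0).tsum_eq_add_tsum_ite i₀]
    congr 1
    refine tsum_congr fun i => ?_
    by_cases hi : i = i₀
    · simp [hc', hi]
    · simp [hc', hi]
  have hpn : p ^ n i₀ = u₀⁻¹ := eq_inv_of_mul_eq_one_right hi₀
  have hne' : u - u₀ ≠ 0 := sub_ne_zero.2 hne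
  rw [hsplit, hpn, show 1 - u * u₀⁻¹ = -(u - u₀) / u₀ by field_simp; ring]
  field_simp
  ring

end PoleSum

/-! ### Kronecker's identity. -/

section Kronecker

variable {p : ℂ}

/-- For t ≥ 0 the terms are dominated by ‖b‖^t; for t < 0 the weight ‖p^t‖ dominates and leaves
(‖p‖/‖b‖)^|t|. -/
lemma summable_zpow_div (hp0 : p ≠ 0) {b : ℂ} (hpb : ‖p‖ < ‖b‖) (hb : ‖b‖ < 1) :
    Summable fun t : ℤ => ‖b ^ t‖ / (1 + ‖p ^ t‖) := by
  have hb0 : 0 < ‖b‖ := (norm_nonneg p).trans_lt hpb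
  have hp0' : 0 < ‖p‖ := norm_pos_iff.2 hp0
  refine Summable.of_nat_of_neg ?_ ?_
  · refine Summable.of_nonneg_of_le (fun t => by positivity) (fun t => ?_)
      (summable_geometric_of_lt_one (norm_nonneg b) hb)
    rw [zpow_natCast, norm_pow]
    exact div_le_self (by positivity) (by linarith [norm_nonneg (p ^ (t : ℤ))])
  · refine Summable.of_nonneg_of_le (fun t => by positivity) (fun t => ?_)
      (summable_geometric_of_lt_one (div_nonneg (norm_nonneg p) hb0.le) ((div_lt_one hb0).2 hpb))
    rw [zpow_neg, zpow_neg, norm_inv, norm_inv, zpow_natCast, zpow_natCast, norm_pow, norm_pow,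
      div_pow, div_le_div_iff₀ (by positivity) (by positivity)]
    field_simp
    nlinarith [pow_pos hp0' t]

lemma ne_zpow_of_norm (hp0 : p ≠ 0) (hp : ‖p‖ < 1) {b : ℂ} (hpb : ‖p‖ < ‖b‖) (hb : ‖b‖ < 1)
    (n : ℤ) : b ≠ p ^ n := by
  rintro rfl
  rw [norm_zpow] at hpb hb
  have hp0' : 0 < ‖p‖ := norm_pos_iff.2 hp0
  have h1 : n < 1 := by
    by_contra h
    have := zpow_right_anti₀ hp0' hp.le (not_lt.1 h)
    simp only [zpow_one] at this
    linarith
  have h2 : 0 < n := by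
    by_contra h
    have := zpow_right_anti₀ hp0' hp.le (not_lt.1 h)
    simp only [zpow_zero] at this
    linarith
  omega

lemma zpow_eq_one_iff_of_norm_lt (hp : ‖p‖ < 1) (n : ℤ) : p ^ n = 1 ↔ n = 0 := by
  refine ⟨fun h => ?_, fun h => by rw [h, zpow_zero]⟩
  have h1 : ‖p‖ ^ n = 1 := by rw [← norm_zpow, h, norm_one]
  exact (zpow_eq_one_iff_right₀ (norm_nonneg p) hp.ne).1 h1

lemma poleSum_mul_self (hp0 : p ≠ 0) {b : ℂ} (hb0 : b ≠ 0) (a : ℂ) :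
    poleSum p id (fun t => b ^ t) (p * a) = b⁻¹ * poleSum p id (fun t => b ^ t) a := by
  unfold poleSum
  rw [← tsum_int_add (fun t : ℤ => b ^ t / (1 - a * p ^ id t)) 1, ← tsum_mul_left]
  refine tsum_congr fun t => ?_
  simp only [id]
  rw [zpow_add_one₀ hb0, zpow_add_one₀ hp0, show p * a * p ^ t = a * (p ^ t * p) by ring]
  field_simp

/-- Kronecker's identity as a Lambert-type series. -/
theorem kronecker (hp0 : p ≠ 0) (hp : ‖p‖ < 1) {b : ℂ} (hpb : ‖p‖ < ‖b‖) (hb : ‖b‖ < 1)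
    {a : ℂ} (ha0 : a ≠ 0) (ha : ∀ n : ℤ, a ≠ p ^ n) :
    poleSum p id (fun t => b ^ t) a = qPoch p p ^ 3 * j (a * b) p / (j a p * j b p) := by
  have hb0 : b ≠ 0 := norm_pos_iff.1 ((norm_nonneg p).trans_lt hpb)
  have hjb : j b p ≠ 0 := j_ne_zero hp0 hp hb0 (ne_zpow_of_norm hp0 hp hpb hb)
  have hs := summable_zpow_div hp0 hpb hb
  rw [← sub_eq_zero]
  -- Both sides acquire the constant factor 1/b under a → pa. The condition ‖p‖ < ‖b‖ makes p/b a
  -- contraction, and ‖b‖ < 1 keeps 1/b from being a nonnegative power of p.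
  refine eq_zero_of_qShift (q := p) (S := {a | ∀ n : ℤ, a ≠ p ^ n}) (μ := fun _ => b⁻¹)
    (D := fun a => poleSum p id (fun t => b ^ t) a -
      qPoch p p ^ 3 * j (a * b) p / (j a p * j b p)) hp0 hp
    continuous_const (fun _ _ => inv_ne_zero hb0) ?_ ?_ (fun x hx => eventually_ne_zpow hp0 hp hx)
    ?_ ?_ ?_ a ha ha0
  · rw [← div_eq_mul_inv, norm_div]
    exact (div_lt_one ((norm_nonneg p).trans_lt hpb)).2 hpb
  · intro k hk
    have h1 : ‖b‖⁻¹ = ‖p‖ ^ k := by rw [← norm_inv, hk, norm_pow]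
    have h2 : 1 < ‖b‖⁻¹ := (one_lt_inv₀ (norm_pos_iff.2 hb0)).2 hb
    have h3 := pow_le_one₀ (n := k) (norm_nonneg p) hp.le
    linarith
  · intro x hx hx0
    refine (differentiableAt_poleSum hp0 hp hs hx0 fun i =>
      Or.inr ((mul_zpow_ne_one_iff hp0).2 hx i)).sub ?_
    have h1 : DifferentiableAt ℂ (fun a => j (a * b) p) x :=
      (differentiableAt_j hp (mul_ne_zero hx0 hb0)).comp x (differentiableAt_id.mul_const b)
    exact (h1.const_mul _).div ((differentiableAt_j hp hx0).mul_const _)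
      (mul_ne_zero (j_ne_zero hp0 hp hx0 hx) hjb)
  · intro x hx hx0
    have hj := j_ne_zero hp0 hp hx0 hx
    rw [poleSum_mul_self hp0 hb0, mul_assoc, j_mul_self hp0 hp (mul_ne_zero hx0 hb0),
      j_mul_self hp0 hp hx0]
    field_simp
  · intro x hx0 hx
    simp only [Set.mem_ofPred_eq, not_forall, not_not] at hx
    obtain ⟨n, rfl⟩ := hx
    -- All poles form the orbit of 1, where both sides have residue -1.
    refine ⟨1, one_ne_zero, ⟨n, (mul_one _).symm⟩, ?_⟩
    have h1 := tendsto_residue_poleSum (n := id) (c := fun t => b ^ t) hp0 hp hs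
      one_ne_zero (i₀ := 0) (by simp)
      (fun i _ hi => (zpow_eq_one_iff_of_norm_lt hp i).1 (by simpa using hi))
    have hJ := qPoch_self_ne_zero hp
    have h2 : ContinuousAt (fun w => -(qPoch p p ^ 3 * j (w * b) p / (jDiv w p * j b p))) 1 := by
      have c1 : ContinuousAt (fun a => j (a * b) p) 1 :=
        ((differentiableAt_j hp (mul_ne_zero one_ne_zero hb0)).comp 1
          (differentiableAt_id.mul_const b)).continuousAt
      refine ((continuousAt_const.mul c1).div
        ((differentiableAt_jDiv hp one_ne_zero).continuousAt.mul continuousAt_const) ?_).neg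
      simp only [Pi.mul_apply, jDiv_one]
      exact mul_ne_zero (pow_ne_zero 3 hJ) hjb
    have h3 := h1.sub (h2.tendsto.mono_left nhdsWithin_le_nhds)
    rw [jDiv_one, one_mul, mul_div_mul_left _ _ (pow_ne_zero 3 hJ), div_self hjb, zpow_zero,
      mul_one, sub_self] at h3
    refine h3.congr' ?_
    filter_upwards [self_mem_nhdsWithin] with w hw
    have hw1 : 1 - w ≠ 0 := sub_ne_zero.2 (Ne.symm hw)
    rw [mul_sub, j_eq_mul_jDiv hp w]
    congr 1
    rw [show (w - 1) * (qPoch p p ^ 3 * j (w * b) p / ((1 - w) * jDiv w p * j b p)) =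
      -((1 - w) * (qPoch p p ^ 3 * j (w * b) p) / ((1 - w) * (jDiv w p * j b p))) by
        rw [mul_assoc (1 - w)]; ring, mul_div_mul_left _ _ hw1]

end Kronecker

/-! ### Appell sums: functional equations, reflection and analyticity. -/

section AppellSum

variable {p : ℂ}

/-- The sum `∑_r p^{r(r-1)/2} b^r / (1 - p^r a)`. -/
def appellSum (a b p : ℂ) : ℂ := poleSum p id (fun r : ℤ => p ^ tri r * b ^ r) a

lemma summable_appell_coeff (hp0 : p ≠ 0) (hp : ‖p‖ < 1) {b : ℂ} (hb : b ≠ 0) :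
    Summable fun r : ℤ => ‖p ^ tri r * b ^ r‖ / (1 + ‖p ^ r‖) :=
  Summable.of_nonneg_of_le (fun r => by positivity)
    (fun r => div_le_self (norm_nonneg _) (by linarith [norm_nonneg (p ^ r)]))
    (summable_norm_zpow_tri hp0 hp hb)

lemma summable_appellSum (hp0 : p ≠ 0) (hp : ‖p‖ < 1) {a b : ℂ} (ha : a ≠ 0) (hb : b ≠ 0) :
    Summable fun r : ℤ => p ^ tri r * b ^ r / (1 - a * p ^ r) :=
  summable_poleSum (n := id) hp0 hp (summable_appell_coeff hp0 hp hb) ha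

lemma appellLerch_eq (x p z : ℂ) (hp0 : p ≠ 0) :
    appellLerch x p z = appellSum (x * z / p) (-z) p / j z p := by
  unfold appellLerch appellSum poleSum
  rw [one_div, inv_mul_eq_div]
  congr 1
  refine tsum_congr fun r => ?_
  simp only [id]
  rw [show (-z) ^ r = (-1) ^ r * z ^ r by rw [← mul_zpow, neg_one_mul], zpow_sub_one₀ hp0]
  congr 1
  · change _ = p ^ (r * (r - 1) / 2) * _; ring
  · field_simp

/-- After the sum for a is shifted by one index, both sums have denominator 1 - a p^(r+1), and it
divides the combined numerator. What is left is the theta series of `tsum_tri_eq_j`. -/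
lemma appellSum_mul_left (hp0 : p ≠ 0) (hp : ‖p‖ < 1) {a b : ℂ} (ha : a ≠ 0) (hb : b ≠ 0)
    (han : ∀ n : ℤ, a ≠ p ^ n) :
    appellSum (p * a) b p = j (-b) p + p * a / b * appellSum a b p := by
  rw [← sub_eq_iff_eq_add, ← tsum_tri_eq_j hp0 hp hb]
  unfold appellSum poleSum
  rw [← tsum_int_add (fun t : ℤ => p ^ tri t * b ^ t / (1 - a * p ^ id t)) 1, ← tsum_mul_left,
    ← Summable.tsum_sub]
  · refine tsum_congr fun r => ?_
    have h : 1 - a * p ^ (r + 1) ≠ 0 :=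
      sub_ne_zero.2 (Ne.symm ((mul_zpow_ne_one_iff hp0).2 han (r + 1)))
    simp only [id]
    rw [show p * a * p ^ r = a * p ^ (r + 1) by rw [zpow_add_one₀ hp0]; ring,
      zpow_tri_add_one hp0, zpow_add_one₀ hb]
    rw [mul_div_assoc', ← sub_div, div_eq_iff h, zpow_add_one₀ hp0]
    field_simp
  · exact summable_appellSum hp0 hp (mul_ne_zero hp0 ha) hb
  · exact (summable_int_add (summable_appellSum hp0 hp ha hb) 1).mul_left _

/-- Write a p^r = 1 - (1 - a p^r) in the numerator; the second part cancels the denominator and sums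
to a theta function. -/
lemma appellSum_mul_right (hp0 : p ≠ 0) (hp : ‖p‖ < 1) {a b : ℂ} (ha : a ≠ 0) (hb : b ≠ 0)
    (han : ∀ n : ℤ, a ≠ p ^ n) :
    appellSum a (p * b) p = a⁻¹ * (appellSum a b p - j (-b) p) := by
  rw [← tsum_tri_eq_j hp0 hp hb]
  unfold appellSum poleSum
  rw [← Summable.tsum_sub, ← tsum_mul_left]
  · refine tsum_congr fun r => ?_
    have h : 1 - a * p ^ r ≠ 0 :=
      sub_ne_zero.2 (Ne.symm ((mul_zpow_ne_one_iff hp0).2 han r))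
    simp only [id]
    rw [mul_zpow]
    generalize p ^ r = P at h ⊢
    have h' : 1 - P * a ≠ 0 := by rwa [mul_comm]
    field_simp
    ring
  · exact summable_appellSum hp0 hp ha hb
  · exact (summable_norm_zpow_tri hp0 hp hb).of_norm

/-- The reflection r → 1 - r fixes the triangular exponent and inverts both arguments up to p. -/
lemma appellSum_symm (hp0 : p ≠ 0) {a b : ℂ} (ha : a ≠ 0) (hb : b ≠ 0)
    (han : ∀ n : ℤ, a ≠ p ^ n) :
    appellSum a b p = -(b / (p * a)) * appellSum (1 / (p * a)) (p / b) p := by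
  unfold appellSum poleSum
  rw [← (Equiv.subLeft (1 : ℤ)).tsum_eq, ← tsum_mul_left]
  refine tsum_congr fun r => ?_
  have h : 1 - a * p ^ (1 - r) ≠ 0 :=
    sub_ne_zero.2 (Ne.symm ((mul_zpow_ne_one_iff hp0).2 han (1 - r)))
  have hr := zpow_ne_zero r hp0
  have hbr := zpow_ne_zero r hb
  have e : a * p ^ (1 - r) = p * a / p ^ r := by
    rw [zpow_sub₀ hp0, zpow_one]; ring
  rw [e] at h
  have h' : p * a - p ^ r ≠ 0 := by
    intro h0
    apply h
    rw [sub_eq_zero.1 h0, div_self hr, sub_self]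
  have h1 : 1 - p * a / p ^ r = -(p * a - p ^ r) / p ^ r := by field_simp; ring
  have h2 : 1 - 1 / (p * a) * p ^ r = (p * a - p ^ r) / (p * a) := by field_simp
  simp only [Equiv.subLeft_apply, id]
  rw [tri_one_sub, e, div_zpow, zpow_sub₀ hb, zpow_one, h1, h2]
  field_simp

lemma differentiableAt_appellSum_left (hp0 : p ≠ 0) (hp : ‖p‖ < 1) {a b : ℂ} (ha : a ≠ 0)
    (hb : b ≠ 0) (han : ∀ n : ℤ, a ≠ p ^ n) :
    DifferentiableAt ℂ (fun a => appellSum a b p) a :=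
  differentiableAt_poleSum hp0 hp (summable_appell_coeff hp0 hp hb) ha fun i =>
    Or.inr ((mul_zpow_ne_one_iff hp0).2 han i)

lemma tendsto_residue_appellSum (hp0 : p ≠ 0) (hp : ‖p‖ < 1) {b : ℂ} (hb : b ≠ 0) :
    Tendsto (fun a => (a - 1) * appellSum a b p) (𝓝[≠] 1) (𝓝 (-1)) := by
  have h := tendsto_residue_poleSum (n := id) (c := fun r : ℤ => p ^ tri r * b ^ r) hp0 hp
    (summable_appell_coeff hp0 hp hb) one_ne_zero (i₀ := 0) (by simp)
    (fun i _ hi => (zpow_eq_one_iff_of_norm_lt hp i).1 (by simpa using hi))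
  simpa [tri, appellSum] using h

/-- For ‖b‖/2 ≤ ‖w‖ ≤ 2‖b‖, ‖w‖^r is at most the sum of the r-th powers of the two extreme radii,
whatever the sign of r, and both dominating series converge. The denominators do not depend on w; a
zero one just makes its term 0. -/
lemma differentiableAt_appellSum_right (hp0 : p ≠ 0) (hp : ‖p‖ < 1) {a b : ℂ} (ha : a ≠ 0)
    (hb : b ≠ 0) : DifferentiableAt ℂ (fun b => appellSum a b p) b := by
  obtain ⟨M, hM0, hM⟩ := exists_one_add_norm_zpow_le hp0 hp ha
  have hb0 : 0 < ‖b‖ := norm_pos_iff.2 hb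
  have hp0' : 0 < ‖p‖ := norm_pos_iff.2 hp0
  have hne : ∀ w ∈ Metric.ball b (‖b‖ / 2), ‖b‖ / 2 ≤ ‖w‖ ∧ ‖w‖ ≤ 2 * ‖b‖ := by
    intro w hw
    rw [Metric.mem_ball, dist_eq_norm] at hw
    have h1 : ‖b‖ ≤ ‖w‖ + ‖w - b‖ := by
      have := norm_sub_le w (w - b); simpa using this
    have h2 : ‖w‖ ≤ ‖w - b‖ + ‖b‖ := by
      have := norm_add_le (w - b) b; simpa using this
    constructor <;> linarith
  have hd : DifferentiableOn ℂ (fun b => appellSum a b p) (Metric.ball b (‖b‖ / 2)) := by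
    refine Complex.differentiableOn_tsum_of_summable_norm
      (u := fun r : ℤ => (‖p‖ ^ tri r * (‖b‖ / 2) ^ r + ‖p‖ ^ tri r * (2 * ‖b‖) ^ r) * M)
      (((summable_zpow_tri_real hp0' hp (by positivity)).add
      (summable_zpow_tri_real hp0' hp (by positivity))).mul_right M) (fun r => ?_)
      Metric.isOpen_ball (fun r w hw => ?_)
    · intro w hw
      have hw0 : w ≠ 0 := norm_pos_iff.1 (lt_of_lt_of_le (by positivity) (hne w hw).1)
      exact (((differentiableAt_zpow.2 (Or.inl hw0)).const_mul _).div_const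
        _).differentiableWithinAt
    · obtain ⟨h1, h2⟩ := hne w hw
      have hw0 : 0 < ‖w‖ := lt_of_lt_of_le (by positivity) h1
      have hwr : ‖w‖ ^ r ≤ (‖b‖ / 2) ^ r + (2 * ‖b‖) ^ r := by
        obtain ⟨m, rfl | rfl⟩ := r.eq_nat_or_neg
        · simp only [zpow_natCast]
          have := pow_le_pow_left₀ hw0.le h2 m
          have : 0 < (‖b‖ / 2) ^ m := by positivity
          linarith
        · simp only [zpow_neg, zpow_natCast]
          have := inv_anti₀ (by positivity) (pow_le_pow_left₀ (by positivity) h1 m)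
          have : 0 < ((2 * ‖b‖) ^ m)⁻¹ := by positivity
          linarith
      have hinv : ‖(1 - a * p ^ r)⁻¹‖ ≤ M := by
        by_cases h : a * p ^ r = 1
        · simp [h, hM0.le]
        · have h3 := hM r h
          have hpos : 0 < ‖1 - a * p ^ r‖ := norm_pos_iff.2 (sub_ne_zero.2 (Ne.symm h))
          rw [norm_inv, inv_le_iff_one_le_mul₀ hpos]
          linarith [norm_nonneg (p ^ r)]
      rw [div_eq_mul_inv, norm_mul, norm_mul, norm_zpow, norm_zpow, ← mul_add]
      gcongr
      exact hinv
  exact hd.differentiableAt (Metric.ball_mem_nhds b (by positivity))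

end AppellSum

/-! ### Change of parameter for Appell-Lerch functions. -/

section ChangeOfParameter

variable {p : ℂ}

/-- The function `m(px, p, z)`. -/
def appellM (x z p : ℂ) : ℂ := appellSum (x * z) (-z) p / j z p

lemma appellM_mul_self (hp0 : p ≠ 0) (hp : ‖p‖ < 1) {x z : ℂ} (hx : x ≠ 0) (hz : z ≠ 0)
    (hzn : ∀ n : ℤ, z ≠ p ^ n) (hxz : ∀ n : ℤ, x * z ≠ p ^ n) :
    appellM (p * x) z p = 1 - p * x * appellM x z p := by
  unfold appellM
  have hj := j_ne_zero hp0 hp hz hzn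
  rw [mul_assoc, appellSum_mul_left hp0 hp (mul_ne_zero hx hz) (neg_ne_zero.2 hz) hxz, neg_neg]
  field_simp
  ring

/-- The theta quotient in the change of parameter formula. -/
def changeTheta (x z₀ z₁ p : ℂ) : ℂ :=
  x * z₀ * qPoch p p ^ 3 * j (z₁ / z₀) p * j (x * z₀ * z₁) p /
    (j z₀ p * j z₁ p * (j (x * z₀) p * j (x * z₁) p))

lemma changeTheta_swap (hp0 : p ≠ 0) (hp : ‖p‖ < 1) {x z₀ z₁ : ℂ} (h₀ : z₀ ≠ 0) (h₁ : z₁ ≠ 0) :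
    changeTheta x z₁ z₀ p = -changeTheta x z₀ z₁ p := by
  unfold changeTheta
  have h := j_inv hp0 hp (div_ne_zero h₁ h₀)
  rw [inv_div] at h
  rw [h, show x * z₁ * z₀ = x * z₀ * z₁ by ring, ← neg_div]
  field_simp

lemma changeTheta_mul_self (hp0 : p ≠ 0) (hp : ‖p‖ < 1) {x z₀ z₁ : ℂ} (hx : x ≠ 0)
    (h₀ : z₀ ≠ 0) (h₁ : z₁ ≠ 0) :
    changeTheta (p * x) z₀ z₁ p = -(p * x) * changeTheta x z₀ z₁ p := by
  unfold changeTheta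
  rw [show p * x * z₀ * z₁ = p * (x * z₀ * z₁) by ring, mul_assoc p x z₀, mul_assoc p x z₁,
    j_mul_self hp0 hp (mul_ne_zero (mul_ne_zero hx h₀) h₁), j_mul_self hp0 hp (mul_ne_zero hx h₀),
    j_mul_self hp0 hp (mul_ne_zero hx h₁)]
  field_simp

lemma differentiableAt_j_comp_mul (hp : ‖p‖ < 1) {x c : ℂ} (hx : x ≠ 0) (hc : c ≠ 0) :
    DifferentiableAt ℂ (fun w => j (w * c) p) x :=
  (differentiableAt_j hp (mul_ne_zero hx hc)).comp x (differentiableAt_id.mul_const c)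

lemma differentiableAt_appellM (hp0 : p ≠ 0) (hp : ‖p‖ < 1) {x z : ℂ} (hx : x ≠ 0) (hz : z ≠ 0)
    (hxz : ∀ n : ℤ, x * z ≠ p ^ n) : DifferentiableAt ℂ (fun x => appellM x z p) x := by
  refine DifferentiableAt.div_const ?_ _
  exact (differentiableAt_appellSum_left hp0 hp (mul_ne_zero hx hz) (neg_ne_zero.2 hz) hxz).comp x
    (differentiableAt_id.mul_const z)

lemma tendsto_mul_const_punctured {c : ℂ} (hc : c ≠ 0) (x : ℂ) :
    Tendsto (fun w => w * c) (𝓝[≠] x) (𝓝[≠] (x * c)) := by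
  simpa only [mul_comm] using tendsto_const_mul_punctured hc x

/-- At 1/z₁ the function with parameter z₀ is regular, because z₀/z₁ is no power of p. The pole of
the other one, with residue -1/(z₁ j(z₁;p)), is cancelled by the factor 1 - w z₁ of the theta
denominator. -/
lemma tendsto_residue_change (hp0 : p ≠ 0) (hp : ‖p‖ < 1) {z₀ z₁ : ℂ}
    (h₀ : z₀ ≠ 0) (h₁ : z₁ ≠ 0) (h₀n : ∀ n : ℤ, z₀ ≠ p ^ n) (h₁n : ∀ n : ℤ, z₁ ≠ p ^ n)
    (h₀₁ : ∀ n : ℤ, z₀ / z₁ ≠ p ^ n) :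
    Tendsto (fun w => (w - z₁⁻¹) * (appellM w z₁ p - appellM w z₀ p + changeTheta w z₀ z₁ p))
      (𝓝[≠] z₁⁻¹) (𝓝 0) := by
  have hy : z₁⁻¹ ≠ 0 := inv_ne_zero h₁
  have hj₀ := j_ne_zero hp0 hp h₀ h₀n
  have hj₁ := j_ne_zero hp0 hp h₁ h₁n
  have hj₀₁ := j_ne_zero hp0 hp (div_ne_zero h₀ h₁) h₀₁
  have hJ := qPoch_self_ne_zero hp
  have hyz : z₁⁻¹ * z₀ = z₀ / z₁ := by field_simp
  have t0 := tendsto_mul_const_punctured h₁ z₁⁻¹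
  rw [inv_mul_cancel₀ h₁] at t0
  have t1 := ((tendsto_residue_appellSum hp0 hp (neg_ne_zero.2 h₁)).comp t0).const_mul
    (z₁⁻¹ * (j z₁ p)⁻¹)
  have t2 := tendsto_residue_zero_of_continuousAt (differentiableAt_appellM hp0 hp hy h₀
    (by simpa only [hyz] using h₀₁)).continuousAt
  have c1 : ContinuousAt (fun w => w * z₀ * qPoch p p ^ 3 * j (z₁ / z₀) p * j (w * (z₀ * z₁)) p)
      z₁⁻¹ :=
    (((continuousAt_id.mul continuousAt_const).mul continuousAt_const).mul continuousAt_const).mul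
      (differentiableAt_j_comp_mul hp hy (mul_ne_zero h₀ h₁)).continuousAt
  have c2 : ContinuousAt (fun w => jDiv (w * z₁) p) z₁⁻¹ := by
    refine DifferentiableAt.continuousAt (𝕜 := ℂ) ?_
    exact (differentiableAt_jDiv hp (mul_ne_zero hy h₁)).comp z₁⁻¹ (differentiableAt_id.mul_const z₁)
  have c3 : ContinuousAt (fun w => j z₀ p * j z₁ p * (j (w * z₀) p * jDiv (w * z₁) p)) z₁⁻¹ :=
    continuousAt_const.mul ((differentiableAt_j_comp_mul hp hy h₀).continuousAt.mul c2)
  have hv : j z₀ p * j z₁ p * (j (z₁⁻¹ * z₀) p * jDiv (z₁⁻¹ * z₁) p) ≠ 0 := by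
    rw [hyz, inv_mul_cancel₀ h₁, jDiv_one]
    exact mul_ne_zero (mul_ne_zero hj₀ hj₁) (mul_ne_zero hj₀₁ (pow_ne_zero 3 hJ))
  have t3 := (tendsto_punctured (c1.div c3 hv)).const_mul (-z₁⁻¹)
  have t4 := (t1.sub t2).add t3
  have hinv := j_inv hp0 hp (div_ne_zero h₀ h₁)
  rw [inv_div] at hinv
  have hval : z₁⁻¹ * (j z₁ p)⁻¹ * -1 - 0 + -z₁⁻¹ * (z₁⁻¹ * z₀ * qPoch p p ^ 3 * j (z₁ / z₀) p *
      j (z₁⁻¹ * (z₀ * z₁)) p / (j z₀ p * j z₁ p * (j (z₁⁻¹ * z₀) p * jDiv (z₁⁻¹ * z₁) p))) = 0 := by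
    rw [hyz, inv_mul_cancel₀ h₁, jDiv_one, hinv, show z₁⁻¹ * (z₀ * z₁) = z₀ by field_simp]
    field_simp
    ring
  rw [Pi.div_apply, hval] at t4
  refine t4.congr' ?_
  filter_upwards [self_mem_nhdsWithin] with w hw
  have hw1 : 1 - w * z₁ ≠ 0 := by
    intro h
    exact hw (eq_inv_of_mul_eq_one_left (sub_eq_zero.1 h).symm)
  simp only [Function.comp_apply, Pi.div_apply]
  rw [mul_add, mul_sub]
  congr 1
  · congr 1
    unfold appellM
    field_simp
  · unfold changeTheta
    rw [j_eq_mul_jDiv hp (w * z₁), show w - z₁⁻¹ = -z₁⁻¹ * (1 - w * z₁) by field_simp; ring,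
      mul_assoc (-z₁⁻¹), mul_assoc w z₀ z₁]
    congr 1
    rw [show j z₀ p * j z₁ p * (j (w * z₀) p * ((1 - w * z₁) * jDiv (w * z₁) p)) =
      (1 - w * z₁) * (j z₀ p * j z₁ p * (j (w * z₀) p * jDiv (w * z₁) p)) by ring,
      ← mul_div_assoc, mul_div_mul_left _ _ hw1]

/-- The change of parameter formula for Appell-Lerch functions. -/
theorem appellM_sub (hp0 : p ≠ 0) (hp : ‖p‖ < 1) {x z₀ z₁ : ℂ} (hx : x ≠ 0)
    (h₀ : z₀ ≠ 0) (h₁ : z₁ ≠ 0) (h₀n : ∀ n : ℤ, z₀ ≠ p ^ n) (h₁n : ∀ n : ℤ, z₁ ≠ p ^ n)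
    (h₀₁ : ∀ n : ℤ, z₀ / z₁ ≠ p ^ n) (hx₀ : ∀ n : ℤ, x * z₀ ≠ p ^ n)
    (hx₁ : ∀ n : ℤ, x * z₁ ≠ p ^ n) :
    appellM x z₁ p - appellM x z₀ p = -changeTheta x z₀ z₁ p := by
  have h₁₀ : ∀ n : ℤ, z₁ / z₀ ≠ p ^ n := fun n h => h₀₁ (-n) (by rw [zpow_neg, ← h, inv_div])
  rw [eq_neg_iff_add_eq_zero]
  -- The inhomogeneous 1 of `appellM_mul_self` drops out of the difference, so every piece is
  -- multiplied by -px, whose value at 0 is not a power of p. The pole orbits are those of 1/z₀ and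
  -- 1/z₁, interchanged by `changeTheta_swap`.
  refine eq_zero_of_qShift (q := p)
    (S := {x | (∀ n : ℤ, x * z₀ ≠ p ^ n) ∧ ∀ n : ℤ, x * z₁ ≠ p ^ n}) (μ := fun x => -(p * x))
    (D := fun x => appellM x z₁ p - appellM x z₀ p + changeTheta x z₀ z₁ p) hp0 hp
    (by fun_prop) (fun x hx => neg_ne_zero.2 (mul_ne_zero hp0 hx)) (by simp) ?_ ?_ ?_ ?_ ?_
    x ⟨hx₀, hx₁⟩ hx
  · intro k
    simpa using (pow_ne_zero k hp0).symm
  · intro x hx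
    exact ((tendsto_mul_const_punctured h₀ x).eventually
      (eventually_ne_zpow hp0 hp (mul_ne_zero hx h₀))).and
      ((tendsto_mul_const_punctured h₁ x).eventually
      (eventually_ne_zpow hp0 hp (mul_ne_zero hx h₁)))
  · rintro x ⟨hx₀, hx₁⟩ hx
    refine ((differentiableAt_appellM hp0 hp hx h₁ hx₁).sub
      (differentiableAt_appellM hp0 hp hx h₀ hx₀)).add ?_
    unfold changeTheta
    simp only [mul_assoc _ z₀ z₁]
    have d1 := differentiableAt_j_comp_mul hp hx (mul_ne_zero h₀ h₁)
    have d2 := differentiableAt_j_comp_mul hp hx h₀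
    have d3 := differentiableAt_j_comp_mul hp hx h₁
    refine DifferentiableAt.div (by fun_prop) (by fun_prop) ?_
    exact mul_ne_zero (mul_ne_zero (j_ne_zero hp0 hp h₀ h₀n) (j_ne_zero hp0 hp h₁ h₁n))
      (mul_ne_zero (j_ne_zero hp0 hp (mul_ne_zero hx h₀) hx₀)
        (j_ne_zero hp0 hp (mul_ne_zero hx h₁) hx₁))
  · rintro x ⟨hx₀, hx₁⟩ hx
    rw [appellM_mul_self hp0 hp hx h₁ h₁n hx₁, appellM_mul_self hp0 hp hx h₀ h₀n hx₀,
      changeTheta_mul_self hp0 hp hx h₀ h₁]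
    ring
  · intro x hx hxS
    by_cases hx₀ : ∀ n : ℤ, x * z₀ ≠ p ^ n
    · have hx₁ : ¬ ∀ n : ℤ, x * z₁ ≠ p ^ n := fun h => hxS ⟨hx₀, h⟩
      push Not at hx₁
      obtain ⟨n, hn⟩ := hx₁
      refine ⟨z₁⁻¹, inv_ne_zero h₁, ⟨n, by rw [← hn]; field_simp⟩, ?_⟩
      exact tendsto_residue_change hp0 hp h₀ h₁ h₀n h₁n h₀₁
    · push Not at hx₀
      obtain ⟨n, hn⟩ := hx₀
      refine ⟨z₀⁻¹, inv_ne_zero h₀, ⟨n, by rw [← hn]; field_simp⟩, ?_⟩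
      have h := (tendsto_residue_change hp0 hp h₁ h₀ h₁n h₀n h₁₀).neg
      rw [neg_zero] at h
      refine h.congr fun w => ?_
      rw [changeTheta_swap hp0 hp h₀ h₁]
      ring

end ChangeOfParameter

/-! ### The relation between Appell sums behind the residues at ±1. -/

section Symmetric

variable {q : ℂ}

lemma inv_ne_zpow {p b : ℂ} (h : ∀ n : ℤ, b ≠ p ^ n) (n : ℤ) : b⁻¹ ≠ p ^ n := by
  intro hb
  refine h (-n) ?_
  rw [zpow_neg, ← hb, inv_inv]

lemma ne_sq_zpow_of_norm (hq0 : q ≠ 0) (hq : ‖q‖ < 1) {b : ℂ} (h1 : ‖q‖ ^ 2 < ‖b‖)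
    (h2 : ‖b‖ < 1) (n : ℤ) : b ≠ (q ^ 2) ^ n :=
  ne_zpow_of_norm (pow_ne_zero 2 hq0) (norm_sq_lt_one hq) (by rwa [norm_pow]) h2 n

/-- Reflecting the second sum turns both into Appell-Lerch functions with the same x and with
parameters -ε/y and -εz; `appellM_sub` compares them. The theta quotient is, up to the factor -ε/2,
the residue of the theta summand of `G` at x = ε. -/
lemma appellSum_add_appellSum (hq0 : q ≠ 0) (hq : ‖q‖ < 1) {y z ε : ℂ} (hqy : ‖q‖ < ‖y‖)
    (hy1 : ‖y‖ < 1) (hqz : ‖q‖ < ‖z‖) (hz1 : ‖z‖ < 1) (hε : ε ^ 2 = 1) :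
    appellSum (y / q) (ε * z) (q ^ 2) / j (-(ε * z)) (q ^ 2) +
      appellSum (z / q) (ε * y) (q ^ 2) / j (-(ε * y)) (q ^ 2) =
    1 - qPoch (q ^ 2) (q ^ 2) ^ 3 * j (y * z) (q ^ 2) * j (-(ε * q)) (q ^ 2) /
      (j (-(ε * y)) (q ^ 2) * j (-(ε * z)) (q ^ 2) *
        (j (q * y) (q ^ 2) * j (q * z) (q ^ 2))) := by
  have hp0 : q ^ 2 ≠ 0 := pow_ne_zero 2 hq0
  have hp := norm_sq_lt_one hq
  have hqn : 0 < ‖q‖ := norm_pos_iff.2 hq0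
  have hyn : 0 < ‖y‖ := hqn.trans hqy
  have hzn : 0 < ‖z‖ := hqn.trans hqz
  have hy0 : y ≠ 0 := norm_pos_iff.1 hyn
  have hz0 : z ≠ 0 := norm_pos_iff.1 hzn
  have hε0 : ε ≠ 0 := by rintro rfl; simp at hε
  have hεi : ε⁻¹ = ε := by field_simp; exact hε.symm
  have hεn : ‖ε‖ = 1 := by
    have : ‖ε‖ ^ 2 = 1 := by rw [← norm_pow, hε, norm_one]
    exact (pow_eq_one_iff_of_nonneg (norm_nonneg ε) two_ne_zero).1 this
  have hsq : ‖q‖ ^ 2 < ‖q‖ := by nlinarith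
  have nεy : ∀ n : ℤ, -(ε * y) ≠ (q ^ 2) ^ n :=
    ne_sq_zpow_of_norm hq0 hq (by rw [norm_neg, norm_mul, hεn]; linarith)
      (by rw [norm_neg, norm_mul, hεn]; linarith)
  have nεz : ∀ n : ℤ, -(ε * z) ≠ (q ^ 2) ^ n :=
    ne_sq_zpow_of_norm hq0 hq (by rw [norm_neg, norm_mul, hεn]; linarith)
      (by rw [norm_neg, norm_mul, hεn]; linarith)
  have nqy : ∀ n : ℤ, q * y ≠ (q ^ 2) ^ n :=
    ne_sq_zpow_of_norm hq0 hq (by rw [norm_mul]; nlinarith) (by rw [norm_mul]; nlinarith)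
  have nqz : ∀ n : ℤ, q * z ≠ (q ^ 2) ^ n :=
    ne_sq_zpow_of_norm hq0 hq (by rw [norm_mul]; nlinarith) (by rw [norm_mul]; nlinarith)
  have nyz : ∀ n : ℤ, y * z ≠ (q ^ 2) ^ n :=
    ne_sq_zpow_of_norm hq0 hq (by rw [norm_mul]; nlinarith) (by rw [norm_mul]; nlinarith)
  have nydq : ∀ n : ℤ, y / q ≠ (q ^ 2) ^ n := fun n h => nqy (n + 1) (by
    rw [zpow_add_one₀ hp0, ← h]; field_simp)
  have nzdq : ∀ n : ℤ, z / q ≠ (q ^ 2) ^ n := fun n h => nqz (n + 1) (by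
    rw [zpow_add_one₀ hp0, ← h]; field_simp)
  have jεy := j_ne_zero hp0 hp (neg_ne_zero.2 (mul_ne_zero hε0 hy0)) nεy
  have jεz := j_ne_zero hp0 hp (neg_ne_zero.2 (mul_ne_zero hε0 hz0)) nεz
  have jqy := j_ne_zero hp0 hp (mul_ne_zero hq0 hy0) nqy
  have jqz := j_ne_zero hp0 hp (mul_ne_zero hq0 hz0) nqz
  have e0 : (-(ε * y))⁻¹ = -(ε / y) := by rw [inv_neg, mul_inv, hεi]; ring
  have e1 : j (-(ε / y)) (q ^ 2) = (ε * y)⁻¹ * j (-(ε * y)) (q ^ 2) := by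
    rw [← e0, j_inv hp0 hp (neg_ne_zero.2 (mul_ne_zero hε0 hy0)), inv_neg, neg_neg]
  have e2 : j (-(ε / q)) (q ^ 2) = (ε * q)⁻¹ * j (-(ε * q)) (q ^ 2) := by
    rw [show -(ε / q) = (-(ε * q))⁻¹ by rw [inv_neg, mul_inv, hεi]; ring,
      j_inv hp0 hp (neg_ne_zero.2 (mul_ne_zero hε0 hq0)), inv_neg, neg_neg]
  have e3 : j (q * z)⁻¹ (q ^ 2) = -(q * z)⁻¹ * j (q * z) (q ^ 2) :=
    j_inv hp0 hp (mul_ne_zero hq0 hz0)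
  have e4 : j (y / q) (q ^ 2) = -(y / q) * j (q * y) (q ^ 2) := by
    rw [show q * y = q ^ 2 * (y / q) by field_simp, j_mul_self hp0 hp (div_ne_zero hy0 hq0)]
    field_simp
  have hsecond : appellSum (z / q) (ε * y) (q ^ 2) =
      -(ε * y) * (appellSum (q * z)⁻¹ (ε / y) (q ^ 2) - j (-(ε / y)) (q ^ 2)) := by
    rw [appellSum_symm hp0 (div_ne_zero hz0 hq0) (mul_ne_zero hε0 hy0) nzdq,
      show q ^ 2 * (z / q) = q * z by field_simp,
      show q ^ 2 / (ε * y) = q ^ 2 * (ε / y) by rw [div_mul_eq_div_div, div_eq_mul_inv _ ε, hεi]; ring,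
      one_div, appellSum_mul_right hp0 hp (inv_ne_zero (mul_ne_zero hq0 hz0))
        (div_ne_zero hε0 hy0) (inv_ne_zpow nqz)]
    field_simp
  have hx0 : -(ε * y / (q * z)) * -(ε / y) = (q * z)⁻¹ := by
    field_simp; exact hε
  have hx1 : -(ε * y / (q * z)) * -(ε * z) = y / q := by
    field_simp; exact hε
  have h01 : -(ε / y) / -(ε * z) = (y * z)⁻¹ := by field_simp
  have h10 : -(ε * z) / -(ε / y) = y * z := by field_simp
  have hx01 : (q * z)⁻¹ * -(ε * z) = -(ε / q) := by field_simp
  -- This x is forced by x z₀ = 1/(qz) and x z₁ = y/q, the first arguments of the two sums.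
  have hmain := appellM_sub hp0 hp (x := -(ε * y / (q * z))) (z₀ := -(ε / y)) (z₁ := -(ε * z))
    (neg_ne_zero.2 (div_ne_zero (mul_ne_zero hε0 hy0) (mul_ne_zero hq0 hz0)))
    (neg_ne_zero.2 (div_ne_zero hε0 hy0)) (neg_ne_zero.2 (mul_ne_zero hε0 hz0))
    (by rw [← e0]; exact inv_ne_zpow nεy) nεz (by rw [h01]; exact inv_ne_zpow nyz)
    (by rw [hx0]; exact inv_ne_zpow nqz) (by rw [hx1]; exact nydq)
  unfold appellM changeTheta at hmain
  rw [hx0, hx1, h10, hx01, neg_neg, neg_neg, e1, e2, e3, e4] at hmain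
  rw [hsecond, e1]
  have hc : appellSum (y / q) (ε * z) (q ^ 2) / j (-(ε * z)) (q ^ 2) =
      appellSum (q * z)⁻¹ (ε / y) (q ^ 2) / ((ε * y)⁻¹ * j (-(ε * y)) (q ^ 2)) -
      qPoch (q ^ 2) (q ^ 2) ^ 3 * j (y * z) (q ^ 2) * j (-(ε * q)) (q ^ 2) /
      (j (-(ε * y)) (q ^ 2) * j (-(ε * z)) (q ^ 2) *
        (j (q * y) (q ^ 2) * j (q * z) (q ^ 2))) := by
    rw [sub_eq_iff_eq_add] at hmain
    rw [hmain]
    field_simp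
    ring
  rw [hc]
  field_simp
  ring

end Symmetric

/-! ### Signed geometric series and convergence over pairs of equal sign. -/

section SameSign

lemma sg_of_nonneg {r : ℤ} (h : 0 ≤ r) : sg r = 1 := if_pos h

lemma sg_of_neg {r : ℤ} (h : r < 0) : sg r = -1 := if_neg (not_le.2 h)

lemma sg_cases (r : ℤ) : (0 ≤ r ∧ sg r = 1) ∨ (r < 0 ∧ sg r = -1) :=
  (le_or_gt 0 r).imp (fun h => ⟨h, sg_of_nonneg h⟩) fun h => ⟨h, sg_of_neg h⟩

lemma zpow_le_one_of_lt_one {r : ℝ} (h0 : 0 < r) (h1 : r < 1) {n : ℤ} (hn : 0 ≤ n) : r ^ n ≤ 1 := by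
  simpa using zpow_le_zpow_right_of_le_one₀ h0 h1.le hn

/-- The sum of `u^r` over the `r` with the same sign as `k`, as a signed geometric series. -/
lemma hasSum_zpow_sameSign {u : ℂ} {k : ℤ} (h1 : 0 ≤ k → ‖u‖ < 1) (h2 : k < 0 → 1 < ‖u‖) :
    HasSum (fun r : ℤ => if sg r = sg k then u ^ r else 0) ((sg k : ℂ) / (1 - u)) := by
  rcases le_or_gt 0 k with hk | hk
  · have h := hasSum_geometric_of_norm_lt_one (h1 hk)
    rw [sg_of_nonneg hk, Int.cast_one, one_div]
    have hinj : Function.Injective (fun n : ℕ => (n : ℤ)) := Nat.cast_injective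
    refine (hinj.hasSum_iff ?_).1 ?_
    · intro r hr
      have : ¬ 0 ≤ r := fun h0 => hr ⟨r.toNat, Int.toNat_of_nonneg h0⟩
      rw [if_neg]
      rw [sg_of_neg (not_le.1 this)]; decide
    · refine h.congr_fun fun n => ?_
      simp [sg_of_nonneg]
  · have hu := h2 hk
    have hu0 : u ≠ 0 := norm_pos_iff.1 (one_pos.trans hu)
    -- Since sg 0 = 1, the negative class starts at -1: the series in 1/u begins with u⁻¹ and sums
    -- to 1/(u - 1).
    have h := (hasSum_geometric_of_norm_lt_one (ξ := u⁻¹)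
      (by rw [norm_inv]; exact inv_lt_one_of_one_lt₀ hu)).mul_left u⁻¹
    rw [sg_of_neg hk]
    have hinj : Function.Injective (fun n : ℕ => -(n : ℤ) - 1) := fun a b hab => by
      simpa using hab
    refine (hinj.hasSum_iff ?_).1 ?_
    · intro r hr
      have : 0 ≤ r := by
        by_contra h0
        refine hr ⟨(-r - 1).toNat, ?_⟩
        change -((-r - 1).toNat : ℤ) - 1 = r
        rw [Int.toNat_of_nonneg (by omega)]; ring
      rw [if_neg]
      rw [sg_of_nonneg this]; decide
    · have hne : 1 - u ≠ 0 := fun h0 => by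
        rw [← sub_eq_zero.1 h0, norm_one] at hu; exact lt_irrefl _ hu
      have hne' : u - 1 ≠ 0 := fun h0 => hne (by linear_combination -h0)
      have hval : u⁻¹ * (1 - u⁻¹)⁻¹ = ((-1 : ℤ) : ℂ) / (1 - u) := by
        rw [← mul_inv, mul_sub, mul_one, mul_inv_cancel₀ hu0, ← neg_sub 1 u, inv_neg]
        push_cast
        ring
      rw [hval] at h
      refine h.congr_fun fun n => ?_
      simp only [Function.comp_apply]
      rw [if_pos (sg_of_neg (by omega)), zpow_sub_one₀ hu0, zpow_neg, zpow_natCast, inv_pow]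
      ring

/-- `r^s` for `s ≥ 0` and `ρ^{-s}` for `s < 0`. -/
def twoSided (r ρ : ℝ) (s : ℤ) : ℝ := if 0 ≤ s then r ^ s else ρ ^ (-s)

lemma twoSided_nonneg {r ρ : ℝ} (hr : 0 ≤ r) (hρ : 0 ≤ ρ) (s : ℤ) : 0 ≤ twoSided r ρ s := by
  unfold twoSided; split_ifs <;> positivity

lemma summable_twoSided {r ρ : ℝ} (hr : 0 ≤ r) (hr1 : r < 1) (hρ : 0 ≤ ρ) (hρ1 : ρ < 1) :
    Summable (twoSided r ρ) := by
  refine Summable.of_nat_of_neg_add_one ?_ ?_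
  · refine (summable_geometric_of_lt_one hr hr1).congr fun n => ?_
    simp [twoSided]
  · refine ((summable_geometric_of_lt_one hρ hρ1).comp_injective
      (add_left_injective 1)).congr fun n => ?_
    rw [twoSided, if_neg (by omega), neg_neg]
    simp only [Function.comp_apply]
    rw [← zpow_natCast]; push_cast; rfl

/-- The weight of the pairs `(s, t)`: the common sign of `s` and `t`, or `0`. -/
def pairSign (i : ℤ × ℤ) : ℂ := if sg i.1 = sg i.2 then (sg i.1 : ℂ) else 0

lemma norm_pairSign_le (i : ℤ × ℤ) : ‖pairSign i‖ ≤ 1 := by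
  unfold pairSign sg
  split_ifs <;> simp

/-- A unit diagonal step changes the weight only when it crosses an axis; at the origin it crosses
both and the weight jumps from -1 to 1. -/
lemma pairSign_sub (s t : ℤ) :
    pairSign (s, t) - pairSign (s - 1, t - 1) =
      (if s = 0 then 1 else 0) + (if t = 0 then 1 else 0) := by
  rcases sg_cases s with ⟨h1, e1⟩ | ⟨h1, e1⟩ <;> rcases sg_cases t with ⟨h2, e2⟩ | ⟨h2, e2⟩ <;>
  rcases sg_cases (s - 1) with ⟨h3, e3⟩ | ⟨h3, e3⟩ <;>
  rcases sg_cases (t - 1) with ⟨h4, e4⟩ | ⟨h4, e4⟩ <;>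
  norm_num [pairSign, e1, e2, e3, e4] <;>
  split_ifs <;> first | omega | norm_num

/-- The coefficient `sg(s) p^{st} b^s c^t` of the pair `(s, t)`. -/
def pairCoeff (b c p : ℂ) (i : ℤ × ℤ) : ℂ :=
  pairSign i * (p ^ (i.1 * i.2) * b ^ i.1 * c ^ i.2)

variable {p : ℂ}

lemma pairCoeff_of_ne {b c : ℂ} {i : ℤ × ℤ} (h : sg i.1 ≠ sg i.2) : pairCoeff b c p i = 0 := by
  rw [pairCoeff, pairSign, if_neg h, zero_mul]

lemma pairCoeff_of_eq {b c : ℂ} {s t : ℤ} (h : sg s = sg t) :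
    pairCoeff b c p (s, t) = sg t * (p ^ (s * t) * b ^ s * c ^ t) := by
  rw [pairCoeff, pairSign, if_pos h, ← h]

lemma norm_pairCoeff_le (b c p : ℂ) (i : ℤ × ℤ) :
    ‖pairCoeff b c p i‖ ≤ ‖p‖ ^ (i.1 * i.2) * ‖b‖ ^ i.1 * ‖c‖ ^ i.2 := by
  unfold pairCoeff
  rw [norm_mul, norm_mul, norm_mul, norm_zpow, norm_zpow, norm_zpow]
  exact mul_le_of_le_one_left (by positivity) (norm_pairSign_le i)

/-- The majorant is ‖p‖⁻¹ times a product of two two-sided geometric series. The -1 in the exponent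
reflects (s + 1)(t + 1) ≥ 0 for negative s, t; k is 1 for the bare double series and 2 when
denominators help. -/
lemma summable_pairCoeff_aux (hp0 : p ≠ 0) (hp : ‖p‖ < 1) {b c : ℂ} {k : ℕ}
    (hb : ‖p‖ ^ k < ‖b‖) (hb1 : ‖b‖ < 1) (hc : ‖p‖ ^ k < ‖c‖) (hc1 : ‖c‖ < 1)
    {f : ℤ × ℤ → ℂ}
    (h0 : ∀ s t : ℤ, 0 ≤ s → 0 ≤ t → ‖f (s, t)‖ ≤ ‖b‖ ^ s * ‖c‖ ^ t)
    (h1 : ∀ s t : ℤ, s < 0 → t < 0 →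
      ‖f (s, t)‖ ≤ ‖p‖ ^ (-1 - k * s - k * t) * ‖b‖ ^ s * ‖c‖ ^ t)
    (h2 : ∀ i : ℤ × ℤ, sg i.1 ≠ sg i.2 → f i = 0) : Summable fun i => ‖f i‖ := by
  have hpn : 0 < ‖p‖ := norm_pos_iff.2 hp0
  have hbn : 0 < ‖b‖ := (by positivity : 0 ≤ ‖p‖ ^ k).trans_lt hb
  have hcn : 0 < ‖c‖ := (by positivity : 0 ≤ ‖p‖ ^ k).trans_lt hc
  have sb := summable_twoSided hbn.le hb1 (ρ := ‖p‖ ^ k / ‖b‖) (by positivity)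
    ((div_lt_one hbn).2 hb)
  have sc := summable_twoSided hcn.le hc1 (ρ := ‖p‖ ^ k / ‖c‖) (by positivity)
    ((div_lt_one hcn).2 hc)
  have hbb := twoSided_nonneg hbn.le (ρ := ‖p‖ ^ k / ‖b‖) (by positivity)
  have hcc := twoSided_nonneg hcn.le (ρ := ‖p‖ ^ k / ‖c‖) (by positivity)
  have hinv : 1 ≤ ‖p‖⁻¹ := (one_lt_inv₀ hpn).2 hp |>.le
  refine Summable.of_nonneg_of_le (fun i => norm_nonneg _) (fun i => ?_)
    ((sb.mul_of_nonneg sc hbb hcc).mul_left ‖p‖⁻¹)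
  obtain ⟨s, t⟩ := i
  have hnn := mul_nonneg (hbb s) (hcc t)
  rcases le_or_gt 0 s with hs | hs <;> rcases le_or_gt 0 t with ht | ht
  · refine (h0 s t hs ht).trans ?_
    simp only [twoSided, if_pos hs, if_pos ht] at hnn ⊢
    exact le_mul_of_one_le_left hnn hinv
  · rw [h2 (s, t) (by rw [sg_of_nonneg hs, sg_of_neg ht]; decide), norm_zero]
    exact mul_nonneg (by positivity) hnn
  · rw [h2 (s, t) (by rw [sg_of_neg hs, sg_of_nonneg ht]; decide), norm_zero]
    exact mul_nonneg (by positivity) hnn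
  · refine (h1 s t hs ht).trans (le_of_eq ?_)
    simp only [twoSided, if_neg (not_le.2 hs), if_neg (not_le.2 ht)]
    rw [div_zpow, div_zpow, ← zpow_natCast ‖p‖ k, ← zpow_mul, ← zpow_mul,
      show -1 - (k : ℤ) * s - k * t = -1 + k * -s + k * -t by ring, zpow_add₀ hpn.ne',
      zpow_add₀ hpn.ne', zpow_neg_one, zpow_neg ‖b‖, zpow_neg ‖c‖]
    field_simp

/-- The bound ‖p‖² instead of ‖p‖ is needed for the odd part of `F`, whose parameters q⁴y², q⁴z²
have norm below ‖p‖ = ‖q⁴‖. For negative indices the large weight ‖p^(s+t)‖ supplies the missing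
decay. -/
lemma summable_pairCoeff_div (hp0 : p ≠ 0) (hp : ‖p‖ < 1) {b c : ℂ} (hb : ‖p‖ ^ 2 < ‖b‖)
    (hb1 : ‖b‖ < 1) (hc : ‖p‖ ^ 2 < ‖c‖) (hc1 : ‖c‖ < 1) :
    Summable fun i : ℤ × ℤ => ‖pairCoeff b c p i‖ / (1 + ‖p ^ (i.1 + i.2)‖) := by
  have hpn : 0 < ‖p‖ := norm_pos_iff.2 hp0
  have hbn : 0 < ‖b‖ := (by positivity : 0 ≤ ‖p‖ ^ 2).trans_lt hb
  have hcn : 0 < ‖c‖ := (by positivity : 0 ≤ ‖p‖ ^ 2).trans_lt hc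
  have h := summable_pairCoeff_aux hp0 hp hb hb1 hc hc1
    (f := fun i => ((‖pairCoeff b c p i‖ / (1 + ‖p ^ (i.1 + i.2)‖) : ℝ) : ℂ)) ?_ ?_ ?_
  · refine h.congr fun i => ?_
    rw [Complex.norm_real, Real.norm_of_nonneg (by positivity)]
  · intro s t hs ht
    rw [Complex.norm_real, Real.norm_of_nonneg (by positivity)]
    refine (div_le_self (norm_nonneg _) (by linarith [norm_nonneg (p ^ (s + t))])).trans ?_
    refine (norm_pairCoeff_le b c p (s, t)).trans ?_
    have : ‖p‖ ^ (s * t) ≤ 1 := zpow_le_one_of_lt_one hpn hp (mul_nonneg hs ht)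
    rw [mul_assoc]
    exact mul_le_of_le_one_left (by positivity) this
  · intro s t hs ht
    rw [Complex.norm_real, Real.norm_of_nonneg (by positivity), div_le_iff₀ (by positivity)]
    refine (norm_pairCoeff_le b c p (s, t)).trans ?_
    have hle : ‖p‖ ^ (s * t) ≤ ‖p‖ ^ (-1 - (2 : ℕ) * s - (2 : ℕ) * t) * ‖p‖ ^ (s + t) := by
      rw [← zpow_add₀ hpn.ne']
      refine zpow_le_zpow_right_of_le_one₀ hpn hp.le ?_
      push_cast
      nlinarith
    rw [norm_zpow]
    calc ‖p‖ ^ (s * t) * ‖b‖ ^ s * ‖c‖ ^ t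
        ≤ ‖p‖ ^ (-1 - (2 : ℕ) * s - (2 : ℕ) * t) * ‖p‖ ^ (s + t) * ‖b‖ ^ s * ‖c‖ ^ t := by
          gcongr
      _ = ‖p‖ ^ (-1 - (2 : ℕ) * s - (2 : ℕ) * t) * ‖b‖ ^ s * ‖c‖ ^ t * ‖p‖ ^ (s + t) := by ring
      _ ≤ _ := by
          refine mul_le_mul_of_nonneg_left (by linarith) (by positivity)
  · intro i hi
    rw [pairCoeff_of_ne hi]
    simp

lemma summable_pairCoeff (hp0 : p ≠ 0) (hp : ‖p‖ < 1) {b c : ℂ} (hb : ‖p‖ < ‖b‖)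
    (hb1 : ‖b‖ < 1) (hc : ‖p‖ < ‖c‖) (hc1 : ‖c‖ < 1) :
    Summable fun i : ℤ × ℤ => ‖pairCoeff b c p i‖ := by
  have hpn : 0 < ‖p‖ := norm_pos_iff.2 hp0
  have hbn : 0 < ‖b‖ := hpn.trans hb
  have hcn : 0 < ‖c‖ := hpn.trans hc
  refine summable_pairCoeff_aux (k := 1) hp0 hp (by simpa using hb) hb1 (by simpa using hc) hc1
    ?_ ?_ (fun i hi => pairCoeff_of_ne hi)
  · intro s t hs ht
    refine (norm_pairCoeff_le b c p (s, t)).trans ?_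
    have : ‖p‖ ^ (s * t) ≤ 1 := zpow_le_one_of_lt_one hpn hp (mul_nonneg hs ht)
    rw [mul_assoc]
    exact mul_le_of_le_one_left (by positivity) this
  · intro s t hs ht
    refine (norm_pairCoeff_le b c p (s, t)).trans ?_
    have hle : ‖p‖ ^ (s * t) ≤ ‖p‖ ^ (-1 - (1 : ℕ) * s - (1 : ℕ) * t) := by
      refine zpow_le_zpow_right_of_le_one₀ hpn hp.le ?_
      push_cast
      nlinarith
    gcongr

end SameSign

/-! ### Double sums with denominators and their two recurrences. -/

section PairSum

variable {p : ℂ}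

/-- The sum of `sg(s) p^{st} b^s c^t / (1 - a p^{s+t})` over the pairs with `sg s = sg t`. -/
def pairSum (a b c p : ℂ) : ℂ := poleSum p (fun i : ℤ × ℤ => i.1 + i.2) (pairCoeff b c p) a

lemma one_lt_norm_mul_zpow (hp0 : p ≠ 0) (hp : ‖p‖ < 1) {b : ℂ} {k : ℕ} (hb : ‖p‖ ^ k < ‖b‖) {t : ℤ}
    (ht : t ≤ -k) : 1 < ‖b * p ^ t‖ := by
  have hpn : 0 < ‖p‖ := norm_pos_iff.2 hp0
  have h1 : ‖p‖ ^ (-(k : ℤ)) ≤ ‖p‖ ^ t := zpow_le_zpow_right_of_le_one₀ hpn hp.le ht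
  rw [zpow_neg, zpow_natCast] at h1
  rw [norm_mul, norm_zpow]
  have h2 : 1 < ‖b‖ * (‖p‖ ^ k)⁻¹ := by
    rw [← div_eq_mul_inv]; exact (one_lt_div (by positivity)).2 hb
  exact h2.trans_le (mul_le_mul_of_nonneg_left h1 (norm_nonneg b))

lemma norm_mul_zpow_lt_one (hp0 : p ≠ 0) (hp : ‖p‖ < 1) {b : ℂ} (hb1 : ‖b‖ < 1) {t : ℤ} (ht : 0 ≤ t) :
    ‖b * p ^ t‖ < 1 := by
  have hpn : 0 < ‖p‖ := norm_pos_iff.2 hp0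
  rw [norm_mul, norm_zpow]
  have := zpow_le_one_of_lt_one hpn hp ht
  nlinarith [norm_nonneg b]

/-- The double series of Kronecker's identity is the Lambert-type series. -/
lemma tsum_pairCoeff (hp0 : p ≠ 0) (hp : ‖p‖ < 1) {b c : ℂ} (hb : ‖p‖ < ‖b‖)
    (hb1 : ‖b‖ < 1) (hc : ‖p‖ < ‖c‖) (hc1 : ‖c‖ < 1) :
    ∑' i, pairCoeff b c p i = poleSum p id (fun t => c ^ t) b := by
  have hs := (summable_pairCoeff hp0 hp hb hb1 hc hc1).of_norm
  have hs' : Summable fun i : ℤ × ℤ => pairCoeff b c p ((Equiv.prodComm ℤ ℤ) i) :=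
    (Equiv.prodComm ℤ ℤ).summable_iff.2 hs
  rw [← (Equiv.prodComm ℤ ℤ).tsum_eq, Summable.tsum_prod hs']
  unfold poleSum
  refine tsum_congr fun t => ?_
  -- The sum over s is geometric of ratio b p^t, of norm below 1 for t ≥ 0 by ‖b‖ < 1 and above 1
  -- for t ≤ -1 by ‖p‖ < ‖b‖.
  have h := (hasSum_zpow_sameSign (u := b * p ^ t) (k := t)
    (fun ht => norm_mul_zpow_lt_one hp0 hp hb1 ht)
    (fun ht => one_lt_norm_mul_zpow hp0 hp (k := 1) (by simpa using hb)
      (by push_cast; omega))).mul_left ((sg t : ℂ) * c ^ t)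
  have hsg : (sg t : ℂ) * sg t = 1 := by
    unfold sg; split_ifs <;> simp
  refine Eq.trans (tsum_congr fun s => ?_) (h.tsum_eq.trans ?_)
  · change pairCoeff b c p (s, t) = _
    split_ifs with hst
    · rw [pairCoeff_of_eq hst, mul_zpow, ← zpow_mul, mul_comm t s]; ring
    · rw [pairCoeff_of_ne hst, mul_zero]
  · rw [id]
    linear_combination (c ^ t / (1 - b * p ^ t)) * hsg

/-- Replacing b, c by pb, pc inserts p^(s+t), so the numerators combine to 1 - pa p^(s+t) and cancel
the denominator, leaving the double series of Kronecker's identity. -/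
lemma pairSum_mul_sub (hp0 : p ≠ 0) (hp : ‖p‖ < 1) {a b c : ℂ} (ha : a ≠ 0)
    (han : ∀ n : ℤ, a ≠ p ^ n) (hb : ‖p‖ < ‖b‖)
    (hb1 : ‖b‖ < 1) (hc : ‖p‖ < ‖c‖) (hc1 : ‖c‖ < 1) :
    pairSum (p * a) b c p - p * a * pairSum (p * a) (p * b) (p * c) p =
      poleSum p id (fun t => c ^ t) b := by
  have hpn : 0 < ‖p‖ := norm_pos_iff.2 hp0
  have hpa := mul_ne_zero hp0 ha
  rw [← tsum_pairCoeff hp0 hp hb hb1 hc hc1]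
  unfold pairSum poleSum
  rw [← tsum_mul_left, ← Summable.tsum_sub]
  · refine tsum_congr fun i => ?_
    have h : 1 - p * a * p ^ (i.1 + i.2) ≠ 0 := by
      rw [show p * a * p ^ (i.1 + i.2) = a * p ^ (i.1 + i.2 + 1) by rw [zpow_add_one₀ hp0]; ring]
      exact sub_ne_zero.2 (Ne.symm ((mul_zpow_ne_one_iff hp0).2 han _))
    rw [mul_div_assoc', ← sub_div, div_eq_iff h]
    simp only [pairCoeff]
    rw [mul_zpow, mul_zpow, zpow_add₀ hp0 i.1 i.2]
    ring
  · exact summable_poleSum hp0 hp (summable_pairCoeff_div hp0 hp (by nlinarith) hb1 (by nlinarith) hc1) hpa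
  · refine (summable_poleSum hp0 hp (summable_pairCoeff_div hp0 hp ?_ ?_ ?_ ?_) hpa).mul_left _ <;>
      rw [norm_mul] <;> nlinarith

/-- The left side is the same series reindexed by (s, t) → (s + 1, t + 1); only the sign weight
changes. By `pairSign_sub` the discrepancy sits on the two axes, where st = 0 leaves Lambert-type
series. -/
lemma pairSum_mul_sq (hp0 : p ≠ 0) (hp : ‖p‖ < 1) {a b c : ℂ} (ha : a ≠ 0) (hb : ‖p‖ < ‖b‖)
    (hb1 : ‖b‖ < 1) (hc : ‖p‖ < ‖c‖) (hc1 : ‖c‖ < 1) :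
    p * b * c * pairSum (p ^ 2 * a) (p * b) (p * c) p = pairSum a b c p
      - poleSum p id (fun t => c ^ t) a - poleSum p id (fun t => b ^ t) a := by
  have hpn : 0 < ‖p‖ := norm_pos_iff.2 hp0
  have hb0 : b ≠ 0 := norm_pos_iff.1 (hpn.trans hb)
  have hc0 : c ≠ 0 := norm_pos_iff.1 (hpn.trans hc)
  have hpa := mul_ne_zero (pow_ne_zero 2 hp0) ha
  set f : ℤ × ℤ → ℂ := fun i => p ^ (i.1 * i.2) * b ^ i.1 * c ^ i.2 / (1 - a * p ^ (i.1 + i.2))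
    with hf
  have hs1 : Summable fun i : ℤ × ℤ => pairSign i * f i := by
    refine (summable_poleSum hp0 hp (summable_pairCoeff_div hp0 hp (b := b) (c := c)
      (by nlinarith) hb1 (by nlinarith) hc1) ha).congr fun i => ?_
    simp only [hf, pairCoeff]; ring
  have e1 : ∀ i : ℤ × ℤ, p * b * c * (pairCoeff (p * b) (p * c) p i /
      (1 - p ^ 2 * a * p ^ (i.1 + i.2))) =
      pairSign (i + (1, 1) - (1, 1)) * f (i + (1, 1)) := by
    rintro ⟨s, t⟩
    simp only [hf, pairCoeff, add_sub_cancel_right, Prod.fst_add, Prod.snd_add]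
    rw [show p ^ 2 * a * p ^ (s + t) = a * p ^ (s + 1 + (t + 1)) by
        rw [show s + 1 + (t + 1) = s + t + 2 by ring, zpow_add₀ hp0 (s + t) 2]; norm_cast; ring,
      show (s + 1) * (t + 1) = s * t + s + t + 1 by ring, zpow_add_one₀ hp0, zpow_add₀ hp0 _ t,
      zpow_add₀ hp0 _ s, mul_zpow, mul_zpow, zpow_add_one₀ hb0, zpow_add_one₀ hc0]
    ring
  have hs2' : Summable fun i : ℤ × ℤ =>
      pairSign (i + (1, 1) - (1, 1)) * f (i + (1, 1)) := by
    refine Summable.congr ((summable_poleSum (n := fun i : ℤ × ℤ => i.1 + i.2)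
      (c := pairCoeff (p * b) (p * c) p) hp0 hp (summable_pairCoeff_div hp0 hp ?_ ?_ ?_ ?_)
      hpa).mul_left (p * b * c)) e1 <;>
      rw [norm_mul] <;> nlinarith
  have hs2 : Summable fun i : ℤ × ℤ => pairSign (i - (1, 1)) * f i :=
    ((Equiv.addRight ((1, 1) : ℤ × ℤ)).summable_iff
      (f := fun i : ℤ × ℤ => pairSign (i - (1, 1)) * f i)).1 hs2'
  have hL : p * b * c * pairSum (p ^ 2 * a) (p * b) (p * c) p =
      ∑' i : ℤ × ℤ, pairSign (i - (1, 1)) * f i := by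
    unfold pairSum poleSum
    rw [← tsum_mul_left, tsum_congr e1]
    exact (Equiv.addRight ((1, 1) : ℤ × ℤ)).tsum_eq
      (fun i : ℤ × ℤ => pairSign (i - (1, 1)) * f i)
  have hR : pairSum a b c p = ∑' i : ℤ × ℤ, pairSign i * f i := by
    unfold pairSum poleSum
    refine tsum_congr fun i => ?_
    simp only [hf, pairCoeff]; ring
  have i1 : Function.Injective (fun t : ℤ => ((0, t) : ℤ × ℤ)) := fun x y h => by simpa using h
  have i2 : Function.Injective (fun s : ℤ => ((s, 0) : ℤ × ℤ)) := fun x y h => by simpa using h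
  have hsc := summable_poleSum (n := id) hp0 hp (summable_zpow_div hp0 hc hc1) ha
  have hsb := summable_poleSum (n := id) hp0 hp (summable_zpow_div hp0 hb hb1) ha
  have g1 : HasSum (fun i : ℤ × ℤ => (if i.1 = 0 then 1 else 0) * f i)
      (poleSum p id (fun t => c ^ t) a) := by
    refine (i1.hasSum_iff ?_).1 (hsc.hasSum.congr_fun fun t => ?_)
    · rintro ⟨s, t⟩ h
      have : s ≠ 0 := fun h0 => h ⟨t, by rw [h0]⟩
      simp [this]
    · simp [hf]
  have g2 : HasSum (fun i : ℤ × ℤ => (if i.2 = 0 then 1 else 0) * f i)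
      (poleSum p id (fun t => b ^ t) a) := by
    refine (i2.hasSum_iff ?_).1 (hsb.hasSum.congr_fun fun t => ?_)
    · rintro ⟨s, t⟩ h
      have : t ≠ 0 := fun h0 => h ⟨s, by rw [h0]⟩
      simp [this]
    · simp [hf]
  rw [hL, hR, sub_sub, eq_sub_iff_add_eq, ← (g1.add g2).tsum_eq,
    ← hs2.tsum_add (g1.add g2).summable]
  refine tsum_congr fun i => ?_
  obtain ⟨s, t⟩ := i
  have := pairSign_sub s t
  simp only [Prod.mk_sub_mk]
  linear_combination -(f (s, t)) * this

end PairSum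

/-! ### The two double series of F with base q⁴. -/

section Series

variable {q x y z : ℂ}

lemma zpow_two_mul' (w : ℂ) (n : ℤ) : w ^ (2 * n) = (w ^ 2) ^ n := by
  rw [zpow_mul]; norm_cast

lemma zpow_four_mul' (w : ℂ) (n : ℤ) : w ^ (4 * n) = (w ^ 4) ^ n := by
  rw [zpow_mul]; norm_cast

lemma indicator_evenTerm (i : ℤ × ℤ) :
    sameSignPairs.indicator (evenTerm x y z q) i =
      pairCoeff (y ^ 2) (z ^ 2) (q ^ 4) i / (1 - x ^ 2 * (q ^ 4) ^ (i.1 + i.2)) := by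
  obtain ⟨s, t⟩ := i
  by_cases h : sg s = sg t
  · rw [Set.indicator_of_mem (show (s, t) ∈ sameSignPairs from h), pairCoeff_of_eq h]
    simp only [evenTerm]
    rw [h, mul_assoc 4 s t, ← mul_add 4 s t, zpow_four_mul', zpow_four_mul', zpow_two_mul',
      zpow_two_mul']
    ring
  · rw [Set.indicator_of_notMem (show (s, t) ∉ sameSignPairs from h), pairCoeff_of_ne h, zero_div]

lemma indicator_oddTerm (hq : q ≠ 0) (hy : y ≠ 0) (hz : z ≠ 0) (i : ℤ × ℤ) :
    sameSignPairs.indicator (oddTerm x y z q) i =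
      q ^ 3 * y * z * (pairCoeff (q ^ 4 * y ^ 2) (q ^ 4 * z ^ 2) (q ^ 4) i /
        (1 - q ^ 4 * x ^ 2 * (q ^ 4) ^ (i.1 + i.2))) := by
  obtain ⟨s, t⟩ := i
  by_cases h : sg s = sg t
  · rw [Set.indicator_of_mem (show (s, t) ∈ sameSignPairs from h), pairCoeff_of_eq h]
    simp only [oddTerm]
    have e1 : q ^ (4 * s * t + 4 * s + 4 * t + 3) =
        (q ^ 4) ^ (s * t) * (q ^ 4) ^ s * (q ^ 4) ^ t * q ^ 3 := by
      rw [show 4 * s * t + 4 * s + 4 * t + 3 = 4 * (s * t) + 4 * s + 4 * t + 3 by ring,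
        zpow_add₀ hq, zpow_add₀ hq, zpow_add₀ hq, zpow_four_mul', zpow_four_mul', zpow_four_mul']
      norm_cast
    have e2 : q ^ (4 * s + 4 * t + 4) = q ^ 4 * (q ^ 4) ^ (s + t) := by
      rw [show 4 * s + 4 * t + 4 = 4 * (s + t) + 4 by ring, zpow_add₀ hq, zpow_four_mul',
        mul_comm]
      norm_cast
    rw [h, e1, e2, zpow_add_one₀ hy, zpow_add_one₀ hz, zpow_two_mul', zpow_two_mul', mul_zpow,
      mul_zpow]
    ring
  · rw [Set.indicator_of_notMem (show (s, t) ∉ sameSignPairs from h), pairCoeff_of_ne h]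
    simp

lemma norm_four_lt_one (hq1 : ‖q‖ < 1) : ‖q ^ 4‖ < 1 := by
  rw [norm_pow]; exact pow_lt_one₀ (norm_nonneg _) hq1 (by norm_num)

lemma norm_four_lt_norm_sq (hq1 : ‖q‖ < 1) (hy : ‖q‖ < ‖y‖) : ‖q ^ 4‖ < ‖y ^ 2‖ := by
  rw [norm_pow, norm_pow]
  have h1 : ‖q‖ ^ 4 ≤ ‖q‖ ^ 2 := pow_le_pow_of_le_one (norm_nonneg _) hq1.le (by norm_num)
  exact h1.trans_lt (pow_lt_pow_left₀ hy (norm_nonneg _) two_ne_zero)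

lemma norm_pow_two_lt_one (hy : ‖y‖ < 1) : ‖y ^ 2‖ < 1 := norm_sq_lt_one hy

lemma norm_four_sq_lt (hq1 : ‖q‖ < 1) (hy : ‖q‖ < ‖y‖) : ‖q ^ 4‖ ^ 2 < ‖y ^ 2‖ :=
  lt_of_le_of_lt (pow_le_of_le_one (norm_nonneg _) (norm_four_lt_one hq1).le two_ne_zero)
    (norm_four_lt_norm_sq hq1 hy)

lemma norm_four_sq_lt' (hq0 : q ≠ 0) (hq1 : ‖q‖ < 1) (hy : ‖q‖ < ‖y‖) :
    ‖q ^ 4‖ ^ 2 < ‖q ^ 4 * y ^ 2‖ := by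
  rw [norm_mul, sq]
  exact mul_lt_mul_of_pos_left (norm_four_lt_norm_sq hq1 hy) (norm_pos_iff.2 (pow_ne_zero 4 hq0))

lemma norm_four_mul_lt_one (hq1 : ‖q‖ < 1) (hy : ‖y‖ < 1) : ‖q ^ 4 * y ^ 2‖ < 1 := by
  rw [norm_mul]
  exact mul_lt_one_of_nonneg_of_lt_one_left (norm_nonneg _) (norm_four_lt_one hq1)
    (norm_pow_two_lt_one hy).le

lemma summable_evenCoeff (hq0 : q ≠ 0) (hq1 : ‖q‖ < 1) (hy : ‖q‖ < ‖y‖) (hy1 : ‖y‖ < 1)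
    (hz : ‖q‖ < ‖z‖) (hz1 : ‖z‖ < 1) :
    Summable fun i : ℤ × ℤ =>
      ‖pairCoeff (y ^ 2) (z ^ 2) (q ^ 4) i‖ / (1 + ‖(q ^ 4) ^ (i.1 + i.2)‖) :=
  summable_pairCoeff_div (pow_ne_zero 4 hq0) (norm_four_lt_one hq1) (norm_four_sq_lt hq1 hy)
    (norm_pow_two_lt_one hy1) (norm_four_sq_lt hq1 hz) (norm_pow_two_lt_one hz1)

lemma summable_oddCoeff (hq0 : q ≠ 0) (hq1 : ‖q‖ < 1) (hy : ‖q‖ < ‖y‖) (hy1 : ‖y‖ < 1)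
    (hz : ‖q‖ < ‖z‖) (hz1 : ‖z‖ < 1) :
    Summable fun i : ℤ × ℤ =>
      ‖pairCoeff (q ^ 4 * y ^ 2) (q ^ 4 * z ^ 2) (q ^ 4) i‖ / (1 + ‖(q ^ 4) ^ (i.1 + i.2)‖) :=
  summable_pairCoeff_div (pow_ne_zero 4 hq0) (norm_four_lt_one hq1) (norm_four_sq_lt' hq0 hq1 hy)
    (norm_four_mul_lt_one hq1 hy1) (norm_four_sq_lt' hq0 hq1 hz) (norm_four_mul_lt_one hq1 hz1)

lemma summable_evenTerm (hq0 : q ≠ 0) (hq1 : ‖q‖ < 1) (hx : x ≠ 0) (hy : ‖q‖ < ‖y‖)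
    (hy1 : ‖y‖ < 1) (hz : ‖q‖ < ‖z‖) (hz1 : ‖z‖ < 1) :
    Summable fun i : sameSignPairs => evenTerm x y z q i := by
  refine (summable_subtype_iff_indicator (f := evenTerm x y z q)).2 ?_
  simp only [funext indicator_evenTerm]
  exact summable_poleSum (pow_ne_zero 4 hq0) (norm_four_lt_one hq1)
    (summable_evenCoeff hq0 hq1 hy hy1 hz hz1) (pow_ne_zero 2 hx)

lemma summable_oddTerm (hq0 : q ≠ 0) (hq1 : ‖q‖ < 1) (hx : x ≠ 0) (hy : ‖q‖ < ‖y‖)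
    (hy1 : ‖y‖ < 1) (hz : ‖q‖ < ‖z‖) (hz1 : ‖z‖ < 1) :
    Summable fun i : sameSignPairs => oddTerm x y z q i := by
  have hy0 : y ≠ 0 := norm_pos_iff.1 ((norm_nonneg q).trans_lt hy)
  have hz0 : z ≠ 0 := norm_pos_iff.1 ((norm_nonneg q).trans_lt hz)
  refine (summable_subtype_iff_indicator (f := oddTerm x y z q)).2 ?_
  simp only [funext (indicator_oddTerm hq0 hy0 hz0)]
  exact (summable_poleSum (pow_ne_zero 4 hq0) (norm_four_lt_one hq1)
    (summable_oddCoeff hq0 hq1 hy hy1 hz hz1)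
    (mul_ne_zero (pow_ne_zero 4 hq0) (pow_ne_zero 2 hx))).mul_left _

/-- Both parts of `F` are values of one function `pairSum`, which lets its two recurrences link
them. -/
lemma F_eq (hq0 : q ≠ 0) (hy0 : y ≠ 0) (hz0 : z ≠ 0) (x : ℂ) :
    F x y z q = pairSum (x ^ 2) (y ^ 2) (z ^ 2) (q ^ 4) +
      q ^ 3 * x * y * z * pairSum (q ^ 4 * x ^ 2) (q ^ 4 * y ^ 2) (q ^ 4 * z ^ 2) (q ^ 4) := by
  unfold F
  rw [tsum_subtype sameSignPairs (evenTerm x y z q), tsum_subtype sameSignPairs (oddTerm x y z q)]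
  simp only [funext (indicator_oddTerm hq0 hy0 hz0), funext indicator_evenTerm]
  rw [tsum_mul_left]
  unfold pairSum poleSum
  ring

end Series

/-! ### The triple series as a double series. -/

section Triples

variable {p : ℂ}

/-- The term `p^{rs+rt+st} a^r b^s c^t` if `r`, `s`, `t` have the same sign, and `0` otherwise. -/
def tripleCoeff (a b c p : ℂ) (i : ℤ × ℤ × ℤ) : ℂ :=
  if sg i.1 = sg i.2.1 ∧ sg i.2.1 = sg i.2.2 then tripleTerm a b c p i else 0

lemma norm_tripleTerm (a b c p : ℂ) (r s t : ℤ) : ‖tripleTerm a b c p (r, s, t)‖ =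
    ‖p‖ ^ (r * s + r * t + s * t) * ‖a‖ ^ r * ‖b‖ ^ s * ‖c‖ ^ t := by
  simp only [tripleTerm, norm_mul, norm_zpow]

lemma summable_tripleCoeff (hp0 : p ≠ 0) (hp : ‖p‖ < 1) {a b c : ℂ} (ha : ‖p‖ ^ 2 < ‖a‖)
    (ha1 : ‖a‖ < 1) (hb : ‖p‖ ^ 2 < ‖b‖) (hb1 : ‖b‖ < 1) (hc : ‖p‖ ^ 2 < ‖c‖) (hc1 : ‖c‖ < 1) :
    Summable (tripleCoeff a b c p) := by
  have hpn : 0 < ‖p‖ := norm_pos_iff.2 hp0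
  have hp2 : 0 ≤ ‖p‖ ^ 2 := by positivity
  have han : 0 < ‖a‖ := hp2.trans_lt ha
  have hbn : 0 < ‖b‖ := hp2.trans_lt hb
  have hcn : 0 < ‖c‖ := hp2.trans_lt hc
  have key : ∀ w : ℂ, 0 < ‖w‖ → ‖w‖ < 1 → ‖p‖ ^ 2 < ‖w‖ →
      Summable (twoSided ‖w‖ (‖p‖ ^ 2 / ‖w‖)) ∧ ∀ s, 0 ≤ twoSided ‖w‖ (‖p‖ ^ 2 / ‖w‖) s :=
    fun w h0 h1 h2 => ⟨summable_twoSided h0.le h1 (by positivity) ((div_lt_one h0).2 h2),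
      twoSided_nonneg h0.le (by positivity)⟩
  obtain ⟨sa, na⟩ := key a han ha1 ha
  obtain ⟨sb, nb⟩ := key b hbn hb1 hb
  obtain ⟨sc, nc⟩ := key c hcn hc1 hc
  have sbc := sb.mul_of_nonneg sc nb nc
  have sabc := sa.mul_of_nonneg sbc na (fun i => mul_nonneg (nb i.1) (nc i.2))
  refine Summable.of_norm_bounded (sabc.mul_left (‖p‖ ^ 3)⁻¹) ?_
  rintro ⟨r, s, t⟩
  have hnn := mul_nonneg (na r) (mul_nonneg (nb s) (nc t))
  unfold tripleCoeff
  split_ifs with h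
  · rw [norm_tripleTerm]
    simp only at h hnn ⊢
    rcases le_or_gt 0 r with hr | hr
    · have hs : 0 ≤ s := by
        by_contra h'; rw [sg_of_nonneg hr, sg_of_neg (not_le.1 h')] at h; exact absurd h.1 (by decide)
      have ht : 0 ≤ t := by
        by_contra h'; rw [sg_of_nonneg hs, sg_of_neg (not_le.1 h')] at h; exact absurd h.2 (by decide)
      simp only [twoSided, if_pos hr, if_pos hs, if_pos ht] at hnn ⊢
      have h1 : ‖p‖ ^ (r * s + r * t + s * t) ≤ (‖p‖ ^ 3)⁻¹ :=
        (zpow_le_one_of_lt_one hpn hp (by positivity)).trans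
          ((one_le_inv₀ (by positivity)).2 (pow_le_one₀ hpn.le hp.le))
      calc _ = ‖p‖ ^ (r * s + r * t + s * t) * (‖a‖ ^ r * (‖b‖ ^ s * ‖c‖ ^ t)) := by ring
        _ ≤ _ := mul_le_mul_of_nonneg_right h1 hnn
    · have hs : s < 0 := by
        by_contra h'; rw [sg_of_neg hr, sg_of_nonneg (not_lt.1 h')] at h; exact absurd h.1 (by decide)
      have ht : t < 0 := by
        by_contra h'; rw [sg_of_neg hs, sg_of_nonneg (not_lt.1 h')] at h; exact absurd h.2 (by decide)
      simp only [twoSided, if_neg (not_le.2 hr), if_neg (not_le.2 hs), if_neg (not_le.2 ht)] at hnn ⊢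
      -- Sum of the three inequalities (r + 1)(s + 1) ≥ 0 and its analogues, valid for negative
      -- indices; hence the -3 and the coefficients 2.
      have h1 : ‖p‖ ^ (r * s + r * t + s * t) ≤ ‖p‖ ^ (-3 + 2 * -r + 2 * -s + 2 * -t) := by
        refine zpow_le_zpow_right_of_le_one₀ hpn hp.le ?_
        nlinarith
      have h2 : ‖p‖ ^ (-3 + 2 * -r + 2 * -s + 2 * -t) =
          (‖p‖ ^ 3)⁻¹ * (‖p‖ ^ 2) ^ (-r) * (‖p‖ ^ 2) ^ (-s) * (‖p‖ ^ 2) ^ (-t) := by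
        rw [zpow_add₀ hpn.ne', zpow_add₀ hpn.ne', zpow_add₀ hpn.ne', zpow_mul, zpow_mul, zpow_mul,
          zpow_neg]
        norm_cast
      rw [h2] at h1
      have h3 : ∀ w : ℂ, 0 < ‖w‖ → ∀ n : ℤ, (‖p‖ ^ 2 / ‖w‖) ^ (-n) = (‖p‖ ^ 2) ^ (-n) * ‖w‖ ^ n := by
        intro w hw n
        rw [div_zpow, zpow_neg ‖w‖, div_inv_eq_mul]
      rw [h3 a han, h3 b hbn, h3 c hcn]
      calc _ = ‖p‖ ^ (r * s + r * t + s * t) * (‖a‖ ^ r * (‖b‖ ^ s * ‖c‖ ^ t)) := by ring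
        _ ≤ _ := mul_le_mul_of_nonneg_right h1 (by positivity)
        _ = _ := by ring
  · rw [norm_zero]
    exact mul_nonneg (by positivity) hnn

/-- For fixed s, t the sum over r is geometric of ratio a p^(s+t). When s and t are negative, s + t
≤ -2, so ‖p‖² < ‖a‖ is enough. -/
lemma hasSum_tripleCoeff_left (hp0 : p ≠ 0) (hp : ‖p‖ < 1) {a b c : ℂ} (ha : ‖p‖ ^ 2 < ‖a‖)
    (ha1 : ‖a‖ < 1) (i : ℤ × ℤ) :
    HasSum (fun r => tripleCoeff a b c p (r, i))
      (pairCoeff b c p i / (1 - a * p ^ (i.1 + i.2))) := by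
  obtain ⟨s, t⟩ := i
  by_cases hst : sg s = sg t
  · have hsgn : (0 ≤ s ∧ 0 ≤ t) ∨ (s < 0 ∧ t < 0) := by
      rcases sg_cases s with ⟨h1, e1⟩ | ⟨h1, e1⟩ <;> rcases sg_cases t with ⟨h2, e2⟩ | ⟨h2, e2⟩ <;>
        simp_all
    have h := (hasSum_zpow_sameSign (u := a * p ^ (s + t)) (k := t)
      (fun ht => norm_mul_zpow_lt_one hp0 hp ha1 (by omega))
      (fun ht => one_lt_norm_mul_zpow hp0 hp ha (by push_cast; omega))).mul_left
      (p ^ (s * t) * b ^ s * c ^ t)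
    have hval : p ^ (s * t) * b ^ s * c ^ t * ((sg t : ℂ) / (1 - a * p ^ (s + t))) =
        pairCoeff b c p (s, t) / (1 - a * p ^ (s + t)) := by
      rw [pairCoeff_of_eq hst]; ring
    rw [hval] at h
    refine h.congr_fun fun r => ?_
    unfold tripleCoeff
    simp only [hst, and_true]
    split_ifs
    · simp only [tripleTerm]
      rw [mul_zpow, ← zpow_mul, zpow_add₀ hp0, zpow_add₀ hp0,
        show (s + t) * r = r * s + r * t by ring, zpow_add₀ hp0 (r * s)]
      ring
    · simp
  · rw [pairCoeff_of_ne hst, zero_div]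
    refine hasSum_zero.congr_fun fun r => ?_
    rw [tripleCoeff, if_neg fun h => hst h.2]

/-- The triple series, summed over `r` by geometric series. -/
lemma hasSum_tripleCoeff (hp0 : p ≠ 0) (hp : ‖p‖ < 1) {a b c : ℂ} (ha : ‖p‖ ^ 2 < ‖a‖)
    (ha1 : ‖a‖ < 1) (hb : ‖p‖ ^ 2 < ‖b‖) (hb1 : ‖b‖ < 1) (hc : ‖p‖ ^ 2 < ‖c‖) (hc1 : ‖c‖ < 1) :
    HasSum (tripleCoeff a b c p) (pairSum a b c p) := by
  have hs := summable_tripleCoeff hp0 hp ha ha1 hb hb1 hc hc1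
  obtain ⟨v, hv⟩ := hs
  have h1 : HasSum (fun i : (ℤ × ℤ) × ℤ => tripleCoeff a b c p (i.2, i.1)) v :=
    ((Equiv.prodComm (ℤ × ℤ) ℤ).hasSum_iff (f := tripleCoeff a b c p)).2 hv
  have h2 := h1.prod_fiberwise (fun i => hasSum_tripleCoeff_left hp0 hp ha ha1 i)
  have h3 : pairSum a b c p = v := by
    unfold pairSum poleSum
    exact h2.tsum_eq
  rwa [h3]

lemma sg_two_mul (r : ℤ) : sg (2 * r) = sg r := by
  unfold sg; congr 1; simp

lemma sg_two_mul_add_one (r : ℤ) : sg (2 * r + 1) = sg r := by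
  unfold sg; congr 1; simp only [eq_iff_iff]; omega

/-- The triple sum as a sum of two double sums. -/
theorem hasSum_tripleTerm {q x y z : ℂ} (hq0 : q ≠ 0) (hq1 : ‖q‖ < 1) (hx : ‖q‖ < ‖x‖)
    (hx1 : ‖x‖ < 1) (hy : ‖q‖ < ‖y‖) (hy1 : ‖y‖ < 1) (hz : ‖q‖ < ‖z‖) (hz1 : ‖z‖ < 1) :
    HasSum (fun i : sameParityTriples => tripleTerm x y z q i) (F x y z q) := by
  classical
  have hx0 : x ≠ 0 := norm_pos_iff.1 ((norm_nonneg q).trans_lt hx)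
  have hy0 : y ≠ 0 := norm_pos_iff.1 ((norm_nonneg q).trans_lt hy)
  have hz0 : z ≠ 0 := norm_pos_iff.1 ((norm_nonneg q).trans_lt hz)
  have hp0 : q ^ 4 ≠ 0 := pow_ne_zero 4 hq0
  have hp := norm_four_lt_one hq1
  have h0 := hasSum_tripleCoeff hp0 hp (norm_four_sq_lt hq1 hx) (norm_pow_two_lt_one hx1)
    (norm_four_sq_lt hq1 hy) (norm_pow_two_lt_one hy1) (norm_four_sq_lt hq1 hz)
    (norm_pow_two_lt_one hz1)
  have h1 := (hasSum_tripleCoeff hp0 hp (norm_four_sq_lt' hq0 hq1 hx) (norm_four_mul_lt_one hq1 hx1)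
    (norm_four_sq_lt' hq0 hq1 hy) (norm_four_mul_lt_one hq1 hy1) (norm_four_sq_lt' hq0 hq1 hz)
    (norm_four_mul_lt_one hq1 hz1)).mul_left (q ^ 3 * x * y * z)
  -- Both r → 2r and r → 2r + 1 preserve the sign (the latter sends -1 to -1), so each parity class
  -- is a full same-sign series with base q⁴; the odd one has the prefactor q³xyz.
  have i0 : Function.Injective (fun i : ℤ × ℤ × ℤ => (2 * i.1, 2 * i.2.1, 2 * i.2.2)) := by
    rintro ⟨r, s, t⟩ ⟨r', s', t'⟩ h
    simpa using h
  have i1 : Function.Injective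
      (fun i : ℤ × ℤ × ℤ => (2 * i.1 + 1, 2 * i.2.1 + 1, 2 * i.2.2 + 1)) := by
    rintro ⟨r, s, t⟩ ⟨r', s', t'⟩ h
    simpa using h
  have g0 : HasSum (fun i : ℤ × ℤ × ℤ =>
      if i ∈ sameParityTriples ∧ i.1 % 2 = 0 then tripleTerm x y z q i else 0)
      (pairSum (x ^ 2) (y ^ 2) (z ^ 2) (q ^ 4)) := by
    refine (i0.hasSum_iff ?_).1 (h0.congr_fun ?_)
    · rintro ⟨r, s, t⟩ hr
      rw [if_neg]
      rintro ⟨⟨-, h2, h3⟩, h4⟩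
      refine hr ⟨(r / 2, s / 2, t / 2), ?_⟩
      simp only [Int.ModEq] at h2 h3 h4
      simp only [Prod.mk.injEq]
      omega
    · rintro ⟨r, s, t⟩
      have hmem : ((2 * r, 2 * s, 2 * t) ∈ sameParityTriples ∧ (2 * r) % 2 = 0) ↔
          (sg r = sg s ∧ sg s = sg t) := by
        simp [sameParityTriples, sg_two_mul, Int.ModEq]
      simp only [Function.comp_apply, tripleCoeff, hmem]
      split_ifs
      · simp only [tripleTerm]
        rw [show 2 * r * (2 * s) + 2 * r * (2 * t) + 2 * s * (2 * t) =
          4 * (r * s + r * t + s * t) by ring, zpow_four_mul', zpow_two_mul', zpow_two_mul',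
          zpow_two_mul']
      · rfl
  have g1 : HasSum (fun i : ℤ × ℤ × ℤ =>
      if i ∈ sameParityTriples ∧ i.1 % 2 ≠ 0 then tripleTerm x y z q i else 0)
      (q ^ 3 * x * y * z *
        pairSum (q ^ 4 * x ^ 2) (q ^ 4 * y ^ 2) (q ^ 4 * z ^ 2) (q ^ 4)) := by
    refine (i1.hasSum_iff ?_).1 (h1.congr_fun ?_)
    · rintro ⟨r, s, t⟩ hr
      rw [if_neg]
      rintro ⟨⟨-, h2, h3⟩, h4⟩
      refine hr ⟨(r / 2, s / 2, t / 2), ?_⟩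
      simp only [Int.ModEq] at h2 h3 h4
      simp only [Prod.mk.injEq]
      omega
    · rintro ⟨r, s, t⟩
      have hmem : ((2 * r + 1, 2 * s + 1, 2 * t + 1) ∈ sameParityTriples ∧ (2 * r + 1) % 2 ≠ 0) ↔
          (sg r = sg s ∧ sg s = sg t) := by
        simp [sameParityTriples, sg_two_mul_add_one, Int.ModEq]
      simp only [Function.comp_apply, tripleCoeff, hmem]
      split_ifs
      · simp only [tripleTerm]
        rw [show (2 * r + 1) * (2 * s + 1) + (2 * r + 1) * (2 * t + 1) + (2 * s + 1) * (2 * t + 1) =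
          4 * (r * s + r * t + s * t) + 4 * r + 4 * s + 4 * t + 3 by ring, zpow_add₀ hq0,
          zpow_add₀ hq0, zpow_add₀ hq0, zpow_add₀ hq0, zpow_four_mul', zpow_four_mul',
          zpow_four_mul', zpow_four_mul', zpow_add_one₀ hx0, zpow_add_one₀ hy0, zpow_add_one₀ hz0,
          zpow_two_mul', zpow_two_mul', zpow_two_mul', mul_zpow, mul_zpow, mul_zpow]
        norm_cast
        ring
      · simp
  rw [F_eq hq0 hy0 hz0]
  refine (hasSum_subtype_iff_indicator (f := tripleTerm x y z q)).2
    ((g0.add g1).congr_fun fun i => ?_)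
  by_cases hi : i ∈ sameParityTriples
  · rw [Set.indicator_of_mem hi]
    by_cases h2 : i.1 % 2 = 0 <;> simp [hi, h2]
  · rw [Set.indicator_of_notMem hi]
    simp [hi]

end Triples

/-! ### Non-vanishing of theta functions in the annulus. -/

/-- The hypotheses on `q`, `y`, `z` under which the double series converge. -/
structure Admissible (q y z : ℂ) : Prop where
  q0 : q ≠ 0
  q1 : ‖q‖ < 1
  qy : ‖q‖ < ‖y‖
  y1 : ‖y‖ < 1
  qz : ‖q‖ < ‖z‖
  z1 : ‖z‖ < 1

namespace Admissible

variable {q y z : ℂ}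

lemma symm (h : Admissible q y z) : Admissible q z y := ⟨h.q0, h.q1, h.qz, h.z1, h.qy, h.y1⟩

lemma y0 (h : Admissible q y z) : y ≠ 0 := norm_pos_iff.1 ((norm_nonneg q).trans_lt h.qy)

lemma z0 (h : Admissible q y z) : z ≠ 0 := h.symm.y0

lemma norm_sq_lt (h : Admissible q y z) : ‖q‖ ^ 2 < ‖q‖ := by
  have := norm_pos_iff.2 h.q0
  nlinarith [h.q1]

lemma j_ne (h : Admissible q y z) : j y q ≠ 0 :=
  j_ne_zero h.q0 h.q1 h.y0 (ne_zpow_of_norm h.q0 h.q1 h.qy h.y1)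

lemma ne_sq (h : Admissible q y z) (n : ℤ) : y ≠ (q ^ 2) ^ n :=
  ne_sq_zpow_of_norm h.q0 h.q1 (h.norm_sq_lt.trans h.qy) h.y1 n

lemma neg_ne_sq (h : Admissible q y z) (n : ℤ) : -y ≠ (q ^ 2) ^ n :=
  ne_sq_zpow_of_norm h.q0 h.q1 (by rw [norm_neg]; exact h.norm_sq_lt.trans h.qy)
    (by rw [norm_neg]; exact h.y1) n

lemma j_sq_ne (h : Admissible q y z) : j y (q ^ 2) ≠ 0 :=
  j_ne_zero (pow_ne_zero 2 h.q0) (norm_sq_lt_one h.q1) h.y0 h.ne_sq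

lemma j_neg_sq_ne (h : Admissible q y z) : j (-y) (q ^ 2) ≠ 0 :=
  j_ne_zero (pow_ne_zero 2 h.q0) (norm_sq_lt_one h.q1) (neg_ne_zero.2 h.y0) h.neg_ne_sq

lemma mul_self_ne_sq (h : Admissible q y z) (n : ℤ) : q * y ≠ (q ^ 2) ^ n := by
  have h1 := norm_pos_iff.2 h.q0
  have h2 := h.qy
  have h3 := h.q1
  have h4 := h.y1
  exact ne_sq_zpow_of_norm h.q0 h.q1 (by rw [norm_mul]; nlinarith)
    (by rw [norm_mul]; nlinarith) n

lemma j_mul_self_ne (h : Admissible q y z) : j (q * y) (q ^ 2) ≠ 0 :=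
  j_ne_zero (pow_ne_zero 2 h.q0) (norm_sq_lt_one h.q1) (mul_ne_zero h.q0 h.y0) h.mul_self_ne_sq

lemma div_ne_sq (h : Admissible q y z) (n : ℤ) : y / q ≠ (q ^ 2) ^ n := fun h' =>
  h.mul_self_ne_sq (n + 1) (by
    have := h.q0
    rw [zpow_add_one₀ (pow_ne_zero 2 this), ← h']; field_simp)

lemma neg_mul_ne_sq (h : Admissible q y z) (n : ℤ) : -(y * z) ≠ (q ^ 2) ^ n := by
  have h1 := norm_pos_iff.2 h.q0
  have h2 := h.qy
  have h3 := h.qz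
  have h4 := h.y1
  have h5 := h.z1
  exact ne_sq_zpow_of_norm h.q0 h.q1 (by rw [norm_neg, norm_mul]; nlinarith)
    (by rw [norm_neg, norm_mul]; nlinarith) n

lemma j_neg_mul_ne (h : Admissible q y z) : j (-(y * z)) (q ^ 2) ≠ 0 :=
  j_ne_zero (pow_ne_zero 2 h.q0) (norm_sq_lt_one h.q1)
    (neg_ne_zero.2 (mul_ne_zero h.y0 h.z0)) h.neg_mul_ne_sq

lemma sq_ne_four (h : Admissible q y z) (n : ℤ) : y ^ 2 ≠ (q ^ 4) ^ n :=
  ne_zpow_of_norm (pow_ne_zero 4 h.q0) (norm_four_lt_one h.q1) (norm_four_lt_norm_sq h.q1 h.qy)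
    (norm_pow_two_lt_one h.y1) n

lemma j_four_ne (h : Admissible q y z) : j (y ^ 2) (q ^ 4) ≠ 0 :=
  j_ne_zero (pow_ne_zero 4 h.q0) (norm_four_lt_one h.q1) (pow_ne_zero 2 h.y0) h.sq_ne_four

end Admissible

/-! ### The regular form of G and the functional equations under x → q²x. -/

section RegularForm

variable {q x y z : ℂ}

lemma j_sq_four (hq1 : ‖q‖ < 1) (u : ℂ) :
    j (u ^ 2) (q ^ 4) * qPoch (q ^ 2) (q ^ 2) ^ 2 =
      qPoch (q ^ 4) (q ^ 4) * (j u (q ^ 2) * j (-u) (q ^ 2)) := by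
  have h := j_sq (norm_sq_lt_one hq1) u
  rwa [show (q ^ 2) ^ 2 = q ^ 4 by ring] at h

/-- The theta quotient `J_4³ j(y²z²;q⁴) / (j(y²;q⁴) j(z²;q⁴))`. -/
def kroneckerTheta (y z q : ℂ) : ℂ :=
  qPoch (q ^ 4) (q ^ 4) ^ 3 * j (y ^ 2 * z ^ 2) (q ^ 4) / (j (y ^ 2) (q ^ 4) * j (z ^ 2) (q ^ 4))

/-- A summand of `G` of Appell-Lerch type, without its removable singularities. -/
def crossTerm (u v w q : ℂ) : ℂ :=
  qPoch (q ^ 4) (q ^ 4) ^ 4 / qPoch (q ^ 2) (q ^ 2) ^ 2 *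
    (j (u * w) (q ^ 2) / (j (u ^ 2) (q ^ 4) * j (w ^ 2) (q ^ 4)) * appellSum (v / q) (u * w) (q ^ 2))

/-- The theta summand of `G`. -/
def thetaTerm (x y z q : ℂ) : ℂ :=
  J q 1 ^ 3 * J q 2 ^ 3 / (j x q * j y q * j z q) *
    (j (x * y) (q ^ 2) * j (x * z) (q ^ 2) * j (y * z) (q ^ 2) /
      (j (-x) (q ^ 2) * j (-y) (q ^ 2) * j (-z) (q ^ 2)))

/-- The function `G` without its removable singularities. -/
def regG (x y z q : ℂ) : ℂ :=
  crossTerm y x z q + crossTerm x y z q + thetaTerm x y z q + crossTerm x z y q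

lemma kroneckerTheta_eq (hq1 : ‖q‖ < 1) (u w : ℂ) :
    qPoch (q ^ 4) (q ^ 4) ^ 4 / qPoch (q ^ 2) (q ^ 2) ^ 2 *
      (j (u * w) (q ^ 2) / (j (u ^ 2) (q ^ 4) * j (w ^ 2) (q ^ 4)) * j (-(u * w)) (q ^ 2)) =
      kroneckerTheta u w q := by
  have hJ := qPoch_self_ne_zero (norm_sq_lt_one hq1)
  have h := j_sq_four hq1 (u * w)
  rw [← eq_div_iff (pow_ne_zero 2 hJ), mul_pow] at h
  rw [kroneckerTheta, h]
  ring

/-- The factor j(-uw;q²) of j(u²w²;q⁴) cancels the theta denominator of the Appell-Lerch function;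
this makes the singularities at uw = -q^{2n} removable. -/
lemma mul_appellLerch_eq (hq0 : q ≠ 0) (hq1 : ‖q‖ < 1) {u v w : ℂ} (hu : u ≠ 0) (hw : w ≠ 0)
    (h : j (-(u * w)) (q ^ 2) ≠ 0) :
    J q 4 ^ 3 * j (u ^ 2 * w ^ 2) (q ^ 4) / (j (u ^ 2) (q ^ 4) * j (w ^ 2) (q ^ 4)) *
      appellLerch (-(q * v / (u * w))) (q ^ 2) (-(u * w)) = crossTerm u v w q := by
  have e := kroneckerTheta_eq hq1 u w
  rw [appellLerch_eq _ _ _ (pow_ne_zero 2 hq0), neg_neg,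
    show -(q * v / (u * w)) * -(u * w) / q ^ 2 = v / q by field_simp]
  unfold J
  rw [← kroneckerTheta, ← e, crossTerm]
  field_simp

lemma G_eq_regG (H : Admissible q y z) (hx : x ≠ 0) (hxy : j (-(x * y)) (q ^ 2) ≠ 0)
    (hxz : j (-(x * z)) (q ^ 2) ≠ 0) : G x y z q = regG x y z q := by
  unfold G regG
  rw [mul_appellLerch_eq H.q0 H.q1 H.y0 H.z0 H.j_neg_mul_ne,
    mul_appellLerch_eq H.q0 H.q1 hx H.z0 hxz, mul_appellLerch_eq H.q0 H.q1 hx H.y0 hxy]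
  rfl

lemma j_four_mul (hq0 : q ≠ 0) (hq1 : ‖q‖ < 1) (hx : x ≠ 0) :
    j ((q ^ 2 * x) ^ 2) (q ^ 4) = -(x ^ 2)⁻¹ * j (x ^ 2) (q ^ 4) := by
  rw [show (q ^ 2 * x) ^ 2 = q ^ 4 * x ^ 2 by ring,
    j_mul_self (pow_ne_zero 4 hq0) (norm_four_lt_one hq1) (pow_ne_zero 2 hx)]

/-- Here x sits in the second argument of the Appell sum, so `appellSum_mul_right` applies; its
theta function completes the prefactor to a `kroneckerTheta`. In `crossTerm_mul_mid` x sits in the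
first argument instead. -/
lemma crossTerm_mul_left (H : Admissible q y z) (hx : x ≠ 0) :
    crossTerm (q ^ 2 * x) y z q =
      q * x / (y * z) * (crossTerm x y z q - kroneckerTheta x z q) := by
  have hq0 := H.q0
  have hy0 := H.y0
  have hz0 := H.z0
  have hp0 := pow_ne_zero 2 hq0
  have hp := norm_sq_lt_one H.q1
  rw [← kroneckerTheta_eq H.q1]
  unfold crossTerm
  rw [j_four_mul hq0 H.q1 hx, mul_assoc (q ^ 2) x z, j_mul_self hp0 hp (mul_ne_zero hx hz0),
    appellSum_mul_right hp0 hp (div_ne_zero hy0 hq0) (mul_ne_zero hx hz0) H.div_ne_sq]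
  field_simp

lemma crossTerm_mul_mid (H : Admissible q y z) (hx : x ≠ 0) (hxq : ∀ n : ℤ, x / q ≠ (q ^ 2) ^ n) :
    crossTerm y (q ^ 2 * x) z q = kroneckerTheta y z q + q * x / (y * z) * crossTerm y x z q := by
  have hq0 := H.q0
  have hy0 := H.y0
  have hz0 := H.z0
  have hp0 := pow_ne_zero 2 hq0
  have hp := norm_sq_lt_one H.q1
  rw [← kroneckerTheta_eq H.q1]
  unfold crossTerm
  rw [mul_div_assoc (q ^ 2) x q, appellSum_mul_left hp0 hp (div_ne_zero hx hq0)
    (mul_ne_zero hy0 hz0) hxq, show q ^ 2 * (x / q) = q * x by field_simp]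
  ring

lemma thetaTerm_mul (H : Admissible q y z) (hx : x ≠ 0) :
    thetaTerm (q ^ 2 * x) y z q = q * x / (y * z) * thetaTerm x y z q := by
  have hq0 := H.q0
  have hy0 := H.y0
  have hz0 := H.z0
  have hp0 := pow_ne_zero 2 hq0
  have hp := norm_sq_lt_one H.q1
  unfold thetaTerm
  rw [mul_assoc (q ^ 2) x y, mul_assoc (q ^ 2) x z, ← mul_neg (q ^ 2) x,
    j_mul_self hp0 hp (mul_ne_zero hx hy0), j_mul_self hp0 hp (mul_ne_zero hx hz0),
    j_mul_self hp0 hp (neg_ne_zero.2 hx), show q ^ 2 * x = q * (q * x) by ring,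
    j_mul_self hq0 H.q1 (mul_ne_zero hq0 hx), j_mul_self hq0 H.q1 hx]
  field_simp

/-- The shift swaps the two parts of `F`. The even part at q²x is, by `pairSum_mul_sub`, qx/(yz)
times the odd part at x plus a Kronecker series; the odd part at q²x is, by `pairSum_mul_sq`,
qx/(yz) times the even part at x minus two such series. -/
lemma F_mul (H : Admissible q y z) (hx : x ≠ 0) (hx2 : ∀ n : ℤ, x ^ 2 ≠ (q ^ 4) ^ n) :
    F (q ^ 2 * x) y z q = q * x / (y * z) * F x y z q + kroneckerTheta y z q -
      q * x / (y * z) * (kroneckerTheta x z q + kroneckerTheta x y q) := by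
  have hq0 := H.q0
  have hy0 := H.y0
  have hz0 := H.z0
  have hp0 := pow_ne_zero 4 hq0
  have hp := norm_four_lt_one H.q1
  have hx20 := pow_ne_zero 2 hx
  have qy := norm_four_lt_norm_sq H.q1 H.qy
  have qz := norm_four_lt_norm_sq H.q1 H.qz
  have y1 := norm_pow_two_lt_one H.y1
  have z1 := norm_pow_two_lt_one H.z1
  have h1 := pairSum_mul_sub hp0 hp hx20 hx2 qy y1 qz z1
  have h2 := pairSum_mul_sq hp0 hp hx20 qy y1 qz z1
  rw [kronecker hp0 hp qz z1 (pow_ne_zero 2 hy0) H.sq_ne_four, ← kroneckerTheta,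
    sub_eq_iff_eq_add] at h1
  rw [kronecker hp0 hp qz z1 hx20 hx2, kronecker hp0 hp qy y1 hx20 hx2, ← kroneckerTheta,
    ← kroneckerTheta] at h2
  rw [F_eq hq0 hy0 hz0, F_eq hq0 hy0 hz0, show (q ^ 2 * x) ^ 2 = q ^ 4 * x ^ 2 by ring, h1,
    show q ^ 4 * (q ^ 4 * x ^ 2) = (q ^ 4) ^ 2 * x ^ 2 by ring,
    show q ^ 3 * (q ^ 2 * x) * y * z *
      pairSum ((q ^ 4) ^ 2 * x ^ 2) (q ^ 4 * y ^ 2) (q ^ 4 * z ^ 2) (q ^ 4) = q * x / (y * z) *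
      (q ^ 4 * y ^ 2 * z ^ 2 *
        pairSum ((q ^ 4) ^ 2 * x ^ 2) (q ^ 4 * y ^ 2) (q ^ 4 * z ^ 2) (q ^ 4)) by field_simp, h2]
  field_simp
  ring

lemma sub_regG_mul (H : Admissible q y z) (hx : x ≠ 0) (hx2 : ∀ n : ℤ, x ^ 2 ≠ (q ^ 4) ^ n)
    (hxq : ∀ n : ℤ, x / q ≠ (q ^ 2) ^ n) :
    F (q ^ 2 * x) y z q - regG (q ^ 2 * x) y z q =
      q / (y * z) * x * (F x y z q - regG x y z q) := by
  rw [F_mul H hx hx2]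
  unfold regG
  rw [crossTerm_mul_left H hx, crossTerm_mul_left H.symm hx, crossTerm_mul_mid H hx hxq,
    thetaTerm_mul H hx]
  ring

end RegularForm

/-! ### Holomorphy in x of F and of the summands of G. -/

section Differentiability

variable {q x y z : ℂ}

lemma differentiableAt_pairSum_even (H : Admissible q y z) (hx : x ≠ 0)
    (hx2 : ∀ n : ℤ, x ^ 2 ≠ (q ^ 4) ^ n) :
    DifferentiableAt ℂ (fun x => pairSum (x ^ 2) (y ^ 2) (z ^ 2) (q ^ 4)) x := by
  have h := differentiableAt_poleSum (pow_ne_zero 4 H.q0) (norm_four_lt_one H.q1)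
    (summable_evenCoeff H.q0 H.q1 H.qy H.y1 H.qz H.z1) (pow_ne_zero 2 hx) fun i =>
      Or.inr ((mul_zpow_ne_one_iff (pow_ne_zero 4 H.q0)).2 hx2 _)
  exact h.comp (f := fun w : ℂ => w ^ 2) x (by fun_prop)

/-- Indices of zero weight are allowed to be singular: at x = ±1 the singular pairs have s + t = -1,
impossible for equal signs, so the odd part is regular there. -/
lemma differentiableAt_pairSum_odd (H : Admissible q y z) (hx : x ≠ 0)
    (hx2 : ∀ i : ℤ × ℤ, pairCoeff (q ^ 4 * y ^ 2) (q ^ 4 * z ^ 2) (q ^ 4) i = 0 ∨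
      q ^ 4 * x ^ 2 * (q ^ 4) ^ (i.1 + i.2) ≠ 1) :
    DifferentiableAt ℂ (fun x => q ^ 3 * x * y * z *
      pairSum (q ^ 4 * x ^ 2) (q ^ 4 * y ^ 2) (q ^ 4 * z ^ 2) (q ^ 4)) x := by
  have h := differentiableAt_poleSum (pow_ne_zero 4 H.q0) (norm_four_lt_one H.q1)
    (summable_oddCoeff H.q0 H.q1 H.qy H.y1 H.qz H.z1)
    (mul_ne_zero (pow_ne_zero 4 H.q0) (pow_ne_zero 2 hx)) hx2
  have h' := h.comp (f := fun w : ℂ => q ^ 4 * w ^ 2) x (by fun_prop)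
  exact DifferentiableAt.mul (by fun_prop) h'

lemma differentiableAt_F (H : Admissible q y z) (hx : x ≠ 0)
    (hx2 : ∀ n : ℤ, x ^ 2 ≠ (q ^ 4) ^ n) : DifferentiableAt ℂ (fun x => F x y z q) x := by
  simp only [F_eq H.q0 H.y0 H.z0]
  refine (differentiableAt_pairSum_even H hx hx2).add (differentiableAt_pairSum_odd H hx fun i => ?_)
  right
  have hp0 := pow_ne_zero 4 H.q0
  have h := (mul_zpow_ne_one_iff hp0).2 hx2 (i.1 + i.2 + 1)
  rw [zpow_add_one₀ hp0] at h
  intro h'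
  exact h (by linear_combination h')

lemma differentiableAt_j_four (hq1 : ‖q‖ < 1) (hx : x ≠ 0) :
    DifferentiableAt ℂ (fun x => j (x ^ 2) (q ^ 4)) x :=
  (differentiableAt_j (norm_four_lt_one hq1) (pow_ne_zero 2 hx)).comp (f := fun w : ℂ => w ^ 2) x
    (by fun_prop)

lemma differentiableAt_appellSum_comp (H : Admissible q y z) (hx : x ≠ 0) :
    DifferentiableAt ℂ (fun x => appellSum (y / q) (x * z) (q ^ 2)) x :=
  (differentiableAt_appellSum_right (pow_ne_zero 2 H.q0) (norm_sq_lt_one H.q1)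
    (div_ne_zero H.y0 H.q0) (mul_ne_zero hx H.z0)).comp (f := fun w : ℂ => w * z) x (by fun_prop)

lemma differentiableAt_crossTerm_left (H : Admissible q y z) (hx : x ≠ 0)
    (hx2 : ∀ n : ℤ, x ^ 2 ≠ (q ^ 4) ^ n) :
    DifferentiableAt ℂ (fun x => crossTerm x y z q) x := by
  have hj := j_ne_zero (pow_ne_zero 4 H.q0) (norm_four_lt_one H.q1) (pow_ne_zero 2 hx) hx2
  have d1 := differentiableAt_j_comp_mul (norm_sq_lt_one H.q1) hx H.z0
  have d2 := differentiableAt_j_four H.q1 hx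
  exact ((d1.div (d2.mul_const _) (mul_ne_zero hj H.symm.j_four_ne)).mul
    (differentiableAt_appellSum_comp H hx)).const_mul _

lemma differentiableAt_crossTerm_mid (H : Admissible q y z) (hx : x ≠ 0)
    (hxq : ∀ n : ℤ, x / q ≠ (q ^ 2) ^ n) :
    DifferentiableAt ℂ (fun x => crossTerm y x z q) x := by
  have h := (differentiableAt_appellSum_left (pow_ne_zero 2 H.q0) (norm_sq_lt_one H.q1)
    (div_ne_zero hx H.q0) (mul_ne_zero H.y0 H.z0) hxq).comp (f := fun w : ℂ => w / q) x
    (by fun_prop)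
  exact (h.const_mul _).const_mul _

lemma differentiableAt_thetaTerm (H : Admissible q y z) (hx : x ≠ 0) (hxq : j x q ≠ 0)
    (hxn : j (-x) (q ^ 2) ≠ 0) : DifferentiableAt ℂ (fun x => thetaTerm x y z q) x := by
  have d0 := differentiableAt_j H.q1 hx
  have d1 := differentiableAt_j_comp_mul (norm_sq_lt_one H.q1) hx H.y0
  have d2 := differentiableAt_j_comp_mul (norm_sq_lt_one H.q1) hx H.z0
  have d3 : DifferentiableAt ℂ (fun x => j (-x) (q ^ 2)) x := by
    have := differentiableAt_j_comp_mul (norm_sq_lt_one H.q1) hx (c := -1) (by norm_num)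
    simpa only [mul_neg, mul_one] using this
  have n1 : j x q * j y q * j z q ≠ 0 := mul_ne_zero (mul_ne_zero hxq H.j_ne) H.symm.j_ne
  have n2 : j (-x) (q ^ 2) * j (-y) (q ^ 2) * j (-z) (q ^ 2) ≠ 0 :=
    mul_ne_zero (mul_ne_zero hxn H.j_neg_sq_ne) H.symm.j_neg_sq_ne
  unfold thetaTerm
  exact DifferentiableAt.mul (DifferentiableAt.div (by fun_prop) (by fun_prop) n1)
    (DifferentiableAt.div (by fun_prop) (by fun_prop) n2)

end Differentiability

/-! ### Residues at 1, -1 and q. -/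

section Residues

variable {q x y z ε : ℂ}

lemma zpow_injective_of_norm_lt (hq0 : q ≠ 0) (hq1 : ‖q‖ < 1) {m n : ℤ} (h : q ^ m = q ^ n) :
    m = n := by
  have := (zpow_eq_one_iff_of_norm_lt hq1 (m - n)).1
    (by rw [zpow_sub₀ hq0, h, div_self (zpow_ne_zero n hq0)])
  omega

lemma ne_zero_of_sq_eq_one (hε : ε ^ 2 = 1) : ε ≠ 0 := by
  rintro rfl
  norm_num at hε

lemma inv_eq_self_of_sq_eq_one (hε : ε ^ 2 = 1) : ε⁻¹ = ε :=
  (eq_inv_of_mul_eq_one_left (by rw [← sq, hε])).symm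

lemma tendsto_sq_punctured (hε : ε ^ 2 = 1) : Tendsto (fun w : ℂ => w ^ 2) (𝓝[≠] ε) (𝓝[≠] 1) := by
  have h0 := ne_zero_of_sq_eq_one hε
  refine tendsto_nhdsWithin_iff.2 ⟨?_, ?_⟩
  · rw [← hε]
    exact tendsto_punctured (f := fun w : ℂ => w ^ 2) (by fun_prop)
  · have h : ∀ᶠ w in 𝓝[≠] ε, w ≠ -ε :=
      nhdsWithin_le_nhds (isOpen_ne.mem_nhds fun h => h0 (self_eq_neg.1 h))
    filter_upwards [h, self_mem_nhdsWithin] with w h1 h2 h3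
    rw [Set.mem_singleton_iff, ← hε] at h3
    rcases sq_eq_sq_iff_eq_or_eq_neg.1 h3 with h4 | h4
    · exact h2 h4
    · exact h1 h4

lemma eventually_add_ne_zero (hε : ε ^ 2 = 1) : ∀ᶠ w in 𝓝[≠] ε, w + ε ≠ 0 := by
  have h0 := ne_zero_of_sq_eq_one hε
  have h : ∀ᶠ w in 𝓝[≠] ε, w ≠ -ε :=
    nhdsWithin_le_nhds (isOpen_ne.mem_nhds fun h => h0 (self_eq_neg.1 h))
  exact h.mono fun w hw h' => hw (eq_neg_of_add_eq_zero_left h')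

lemma tendsto_residue_pairSum_one (H : Admissible q y z) :
    Tendsto (fun u => (u - 1) * pairSum u (y ^ 2) (z ^ 2) (q ^ 4)) (𝓝[≠] 1) (𝓝 (-1)) := by
  have hp := norm_four_lt_one H.q1
  have h := tendsto_residue_poleSum (pow_ne_zero 4 H.q0) hp
    (summable_evenCoeff H.q0 H.q1 H.qy H.y1 H.qz H.z1) one_ne_zero (i₀ := (0, 0)) (by simp) ?_
  · rw [pairCoeff_of_eq rfl, sg_of_nonneg le_rfl] at h
    simpa [pairSum] using h
  -- Among pairs of equal sign only (0, 0) has s + t = 0, so the pole comes from a single term.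
  · rintro ⟨s, t⟩ hc hst
    rw [one_mul, zpow_eq_one_iff_of_norm_lt hp] at hst
    have hsg : sg s = sg t := not_not.1 fun h => hc (pairCoeff_of_ne h)
    simp only [Prod.mk.injEq]
    rcases sg_cases s with ⟨h1, e1⟩ | ⟨h1, e1⟩ <;> rcases sg_cases t with ⟨h2, e2⟩ | ⟨h2, e2⟩ <;>
      omega

/-- In the variable w² the residue is -1; dividing by w + ε at ε gives -1/(2ε) = -ε/2. The odd part
is regular. -/
lemma tendsto_residue_F (H : Admissible q y z) (hε : ε ^ 2 = 1) :
    Tendsto (fun w => (w - ε) * F w y z q) (𝓝[≠] ε) (𝓝 (-(ε / 2))) := by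
  have h0 := ne_zero_of_sq_eq_one hε
  have hp := norm_four_lt_one H.q1
  have hp0 := pow_ne_zero 4 H.q0
  have h1 := (tendsto_residue_pairSum_one H).comp (tendsto_sq_punctured hε)
  have h2 : Tendsto (fun w : ℂ => (w + ε)⁻¹) (𝓝[≠] ε) (𝓝 (ε + ε)⁻¹) :=
    tendsto_punctured (f := fun w : ℂ => (w + ε)⁻¹)
      (ContinuousAt.inv₀ (by fun_prop) (by rw [← two_mul]; exact mul_ne_zero two_ne_zero h0))
  have h3 := tendsto_residue_zero_of_continuousAt
    (differentiableAt_pairSum_odd H h0 fun i => by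
      by_cases hc : pairCoeff (q ^ 4 * y ^ 2) (q ^ 4 * z ^ 2) (q ^ 4) i = 0
      · exact Or.inl hc
      · right
        obtain ⟨s, t⟩ := i
        have hsg : sg s = sg t := not_not.1 fun h => hc (pairCoeff_of_ne h)
        rw [hε, mul_one, mul_comm, ← zpow_add_one₀ hp0, Ne, zpow_eq_one_iff_of_norm_lt hp]
        rcases sg_cases s with ⟨h1, e1⟩ | ⟨h1, e1⟩ <;>
          rcases sg_cases t with ⟨h2, e2⟩ | ⟨h2, e2⟩ <;> simp only [] <;> omega).continuousAt
  have h4 := (h1.mul h2).add h3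
  have hv : -1 * (ε + ε)⁻¹ + 0 = -(ε / 2) := by
    rw [← two_mul, mul_inv, inv_eq_self_of_sq_eq_one hε]; ring
  rw [hv] at h4
  refine h4.congr' ?_
  filter_upwards [eventually_add_ne_zero hε] with w hw
  rw [F_eq H.q0 H.y0 H.z0, Function.comp_apply]
  have : w ^ 2 - 1 = (w - ε) * (w + ε) := by linear_combination hε
  rw [this]
  field_simp

/-- The pole comes from the factor 1 - w² of j(w²;q⁴). Splitting j(z²;q⁴) into j(εz;q²) j(-εz;q²)
cancels the numerator and leaves the quotient of `appellSum_add_appellSum`. -/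
lemma tendsto_residue_crossTerm_left (H : Admissible q y z) (hε : ε ^ 2 = 1) :
    Tendsto (fun w => (w - ε) * crossTerm w y z q) (𝓝[≠] ε)
      (𝓝 (-(ε / 2) * (appellSum (y / q) (ε * z) (q ^ 2) / j (-(ε * z)) (q ^ 2)))) := by
  have h0 := ne_zero_of_sq_eq_one hε
  have hp := norm_four_lt_one H.q1
  have hJ4 := qPoch_self_ne_zero hp
  have hJ2 := qPoch_self_ne_zero (norm_sq_lt_one H.q1)
  have hz4 := H.symm.j_four_ne
  have c1 := (differentiableAt_j_comp_mul (norm_sq_lt_one H.q1) h0 H.z0).continuousAt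
  have c2 : ContinuousAt (fun w => jDiv (w ^ 2) (q ^ 4)) ε := by
    refine DifferentiableAt.continuousAt (𝕜 := ℂ) ?_
    exact (differentiableAt_jDiv hp (pow_ne_zero 2 h0)).comp (f := fun w : ℂ => w ^ 2) ε
      (by fun_prop)
  have c3 := (differentiableAt_appellSum_comp H h0).continuousAt
  have hne : (ε + ε) * jDiv (ε ^ 2) (q ^ 4) * j (z ^ 2) (q ^ 4) ≠ 0 := by
    rw [hε, jDiv_one, ← two_mul]
    exact mul_ne_zero (mul_ne_zero (mul_ne_zero two_ne_zero h0) (pow_ne_zero 3 hJ4)) hz4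
  have c4 : ContinuousAt (fun w => -(qPoch (q ^ 4) (q ^ 4) ^ 4 / qPoch (q ^ 2) (q ^ 2) ^ 2 *
      (j (w * z) (q ^ 2) / ((w + ε) * jDiv (w ^ 2) (q ^ 4) * j (z ^ 2) (q ^ 4)) *
        appellSum (y / q) (w * z) (q ^ 2)))) ε :=
    (continuousAt_const.mul ((c1.div (by fun_prop) hne).mul c3)).neg
  have h := tendsto_punctured c4
  have hz1 : j (ε * z) (q ^ 2) ≠ 0 ∧ j (-(ε * z)) (q ^ 2) ≠ 0 := by
    rcases sq_eq_sq_iff_eq_or_eq_neg.1 (hε.trans (one_pow 2).symm) with rfl | rfl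
    · simpa using ⟨H.symm.j_sq_ne, H.symm.j_neg_sq_ne⟩
    · simpa using ⟨H.symm.j_neg_sq_ne, H.symm.j_sq_ne⟩
  have hj := j_sq_four H.q1 (ε * z)
  rw [mul_pow, hε, one_mul, ← eq_div_iff (pow_ne_zero 2 hJ2)] at hj
  have hv : -(qPoch (q ^ 4) (q ^ 4) ^ 4 / qPoch (q ^ 2) (q ^ 2) ^ 2 *
      (j (ε * z) (q ^ 2) / ((ε + ε) * jDiv (ε ^ 2) (q ^ 4) * j (z ^ 2) (q ^ 4)) *
        appellSum (y / q) (ε * z) (q ^ 2))) =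
      -(ε / 2) * (appellSum (y / q) (ε * z) (q ^ 2) / j (-(ε * z)) (q ^ 2)) := by
    obtain ⟨hz1, hz2⟩ := hz1
    rw [hε, jDiv_one, hj]
    generalize appellSum (y / q) (ε * z) (q ^ 2) = A
    generalize j (ε * z) (q ^ 2) = B at *
    generalize j (-(ε * z)) (q ^ 2) = C at *
    rw [← two_mul]
    field_simp
    linear_combination A * hε
  rw [hv] at h
  refine h.congr' ?_
  filter_upwards [eventually_add_ne_zero hε, self_mem_nhdsWithin] with w hw hw'
  have hw2 : w - ε ≠ 0 := sub_ne_zero.2 hw'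
  rw [crossTerm, j_eq_mul_jDiv hp (w ^ 2),
    show 1 - w ^ 2 = -((w - ε) * (w + ε)) by linear_combination -hε]
  field_simp

/-- Only the term r = 0 of the Appell sum, with denominator 1 - w/q, is singular at q. -/
lemma tendsto_residue_crossTerm_mid (H : Admissible q y z) :
    Tendsto (fun w => (w - q) * crossTerm y w z q) (𝓝[≠] q)
      (𝓝 (-q * (qPoch (q ^ 4) (q ^ 4) ^ 4 / qPoch (q ^ 2) (q ^ 2) ^ 2 *
        (j (y * z) (q ^ 2) / (j (y ^ 2) (q ^ 4) * j (z ^ 2) (q ^ 4)))))) := by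
  have hq0 := H.q0
  have t := tendsto_mul_const_punctured (inv_ne_zero hq0) q
  rw [mul_inv_cancel₀ hq0] at t
  have h := ((tendsto_residue_appellSum (pow_ne_zero 2 hq0) (norm_sq_lt_one H.q1)
    (mul_ne_zero H.y0 H.z0)).comp t).const_mul (q * (qPoch (q ^ 4) (q ^ 4) ^ 4 /
      qPoch (q ^ 2) (q ^ 2) ^ 2 * (j (y * z) (q ^ 2) / (j (y ^ 2) (q ^ 4) * j (z ^ 2) (q ^ 4)))))
  refine (h.congr fun w => ?_).trans (le_of_eq (congrArg 𝓝 (by ring)))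
  rw [Function.comp_apply, crossTerm, ← div_eq_mul_inv]
  have : w - q = q * (w / q - 1) := by field_simp
  rw [this]
  ring

lemma continuousAt_j_neg (hq1 : ‖q‖ < 1) (hx : x ≠ 0) :
    ContinuousAt (fun w => j (-w) (q ^ 2)) x := by
  have := (differentiableAt_j_comp_mul (norm_sq_lt_one hq1) hx (c := -1) (by norm_num)).continuousAt
  simpa only [mul_neg, mul_one] using this

/-- The common form of the limits of `(w - x) θ(w)` at the simple poles `x` of the theta summand:
the denominator factor that vanishes there is replaced by `g`. -/
lemma tendsto_thetaTerm (H : Admissible q y z) (hx : x ≠ 0) {g : ℂ → ℂ} (hg : ContinuousAt g x)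
    (h : ∀ᶠ w in 𝓝[≠] x, g w = (w - x) / (j w q * j (-w) (q ^ 2))) :
    Tendsto (fun w => (w - x) * thetaTerm w y z q) (𝓝[≠] x)
      (𝓝 (qPoch q q ^ 3 * qPoch (q ^ 2) (q ^ 2) ^ 3 * g x *
        (j (x * y) (q ^ 2) * j (x * z) (q ^ 2) * j (y * z) (q ^ 2)) /
        (j y q * j z q * (j (-y) (q ^ 2) * j (-z) (q ^ 2))))) := by
  have c1 := (differentiableAt_j_comp_mul (norm_sq_lt_one H.q1) hx H.y0).continuousAt
  have c2 := (differentiableAt_j_comp_mul (norm_sq_lt_one H.q1) hx H.z0).continuousAt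
  have c3 : ContinuousAt (fun w => qPoch q q ^ 3 * qPoch (q ^ 2) (q ^ 2) ^ 3 * g w *
      (j (w * y) (q ^ 2) * j (w * z) (q ^ 2) * j (y * z) (q ^ 2)) /
      (j y q * j z q * (j (-y) (q ^ 2) * j (-z) (q ^ 2)))) x := by fun_prop
  refine (tendsto_punctured c3).congr' ?_
  filter_upwards [h] with w hw
  rw [hw, thetaTerm, J, J, pow_one]
  ring

/-- The vanishing factor is 1 - w in j(w;q). The special theta values and the even-odd dissection of
j(y;q), j(z;q) bring the limit to the shape required by `appellSum_add_appellSum`. -/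
lemma tendsto_residue_thetaTerm_one (H : Admissible q y z) :
    Tendsto (fun w => (w - 1) * thetaTerm w y z q) (𝓝[≠] 1)
      (𝓝 (-(1 / 2) * (qPoch (q ^ 2) (q ^ 2) ^ 3 * j (y * z) (q ^ 2) * j (-q) (q ^ 2) /
        (j (-y) (q ^ 2) * j (-z) (q ^ 2) * (j (q * y) (q ^ 2) * j (q * z) (q ^ 2)))))) := by
  have hJ1 := qPoch_self_ne_zero H.q1
  have hJ2 := qPoch_self_ne_zero (norm_sq_lt_one H.q1)
  have hJ4 := qPoch_self_ne_zero (norm_four_lt_one H.q1)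
  have e1 := j_neg_one (norm_sq_lt_one H.q1)
  rw [show (q ^ 2) ^ 2 = q ^ 4 by ring, ← eq_div_iff hJ2] at e1
  have e2 := j_neg_self_sq H.q0 H.q1
  rw [mul_assoc, ← eq_div_iff (by positivity)] at e2
  have e3 := j_even_odd H.q0 H.q1 H.y0
  have e4 := j_even_odd H.q0 H.q1 H.z0
  rw [← eq_div_iff (pow_ne_zero 2 hJ2)] at e3 e4
  have n1 := H.j_sq_ne
  have n2 := H.symm.j_sq_ne
  have n3 := H.j_neg_sq_ne
  have n4 := H.symm.j_neg_sq_ne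
  have n5 := H.j_mul_self_ne
  have n6 := H.symm.j_mul_self_ne
  have n7 : j (-1) (q ^ 2) ≠ 0 := by
    rw [e1]; exact div_ne_zero (mul_ne_zero two_ne_zero (pow_ne_zero 2 hJ4)) hJ2
  have c1 : ContinuousAt (fun w => jDiv w q) 1 :=
    (differentiableAt_jDiv H.q1 one_ne_zero).continuousAt
  have hg : ContinuousAt (fun w => -(1 / (jDiv w q * j (-w) (q ^ 2)))) 1 := by
    refine (continuousAt_const.div (c1.mul (continuousAt_j_neg H.q1 one_ne_zero)) ?_).neg
    change jDiv 1 q * j (-1) (q ^ 2) ≠ 0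
    rw [jDiv_one]
    exact mul_ne_zero (pow_ne_zero 3 hJ1) n7
  have h := tendsto_thetaTerm H one_ne_zero hg ?_
  · refine h.trans (le_of_eq (congrArg 𝓝 ?_))
    rw [jDiv_one, one_mul, one_mul, e1, e2, e3, e4]
    field_simp
  · filter_upwards [self_mem_nhdsWithin] with w hw
    have hw' : 1 - w ≠ 0 := sub_ne_zero.2 (Ne.symm hw)
    rw [j_eq_mul_jDiv H.q1 w]
    field_simp
    ring

/-- Here the zero comes from j(-w;q²), while j(w;q) is nonzero at -1. -/
lemma tendsto_residue_thetaTerm_neg_one (H : Admissible q y z) :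
    Tendsto (fun w => (w - -1) * thetaTerm w y z q) (𝓝[≠] (-1))
      (𝓝 (1 / 2 * (qPoch (q ^ 2) (q ^ 2) ^ 3 * j (y * z) (q ^ 2) * j q (q ^ 2) /
        (j y (q ^ 2) * j z (q ^ 2) * (j (q * y) (q ^ 2) * j (q * z) (q ^ 2)))))) := by
  have h0 : (-1 : ℂ) ≠ 0 := by norm_num
  have hJ1 := qPoch_self_ne_zero H.q1
  have hJ2 := qPoch_self_ne_zero (norm_sq_lt_one H.q1)
  have e1 := j_neg_one H.q1
  rw [← eq_div_iff hJ1] at e1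
  have e2 := j_self_sq H.q0 H.q1
  rw [← eq_div_iff hJ2] at e2
  have e3 := j_even_odd H.q0 H.q1 H.y0
  have e4 := j_even_odd H.q0 H.q1 H.z0
  rw [← eq_div_iff (pow_ne_zero 2 hJ2)] at e3 e4
  have n1 := H.j_sq_ne
  have n2 := H.symm.j_sq_ne
  have n3 := H.j_neg_sq_ne
  have n4 := H.symm.j_neg_sq_ne
  have n5 := H.j_mul_self_ne
  have n6 := H.symm.j_mul_self_ne
  have n7 : j (-1) q ≠ 0 := by
    rw [e1]; exact div_ne_zero (mul_ne_zero two_ne_zero (pow_ne_zero 2 hJ2)) hJ1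
  have c1 : ContinuousAt (fun w => jDiv (-w) (q ^ 2)) (-1) := by
    refine DifferentiableAt.continuousAt (𝕜 := ℂ) ?_
    exact (differentiableAt_jDiv (norm_sq_lt_one H.q1) (neg_ne_zero.2 h0)).comp
      (f := fun w : ℂ => -w) (-1) (by fun_prop)
  have hg : ContinuousAt (fun w => 1 / (j w q * jDiv (-w) (q ^ 2))) (-1) := by
    refine continuousAt_const.div ((differentiableAt_j H.q1 h0).continuousAt.mul c1) ?_
    rw [neg_neg, jDiv_one]
    exact mul_ne_zero n7 (pow_ne_zero 3 hJ2)
  have h := tendsto_thetaTerm H h0 hg ?_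
  · refine h.trans (le_of_eq (congrArg 𝓝 ?_))
    rw [neg_neg, jDiv_one, neg_one_mul, neg_one_mul, e1, e2, e3, e4]
    field_simp
  · filter_upwards [self_mem_nhdsWithin] with w hw
    have hw' : w - -1 ≠ 0 := sub_ne_zero.2 hw
    rw [j_eq_mul_jDiv (norm_sq_lt_one H.q1) (-w), show 1 - -w = w - -1 by ring]
    field_simp

/-- The zero of j(w;q) at q is that of j(w/q;q) at w/q = 1. The limit is the negative of the one in
`tendsto_residue_crossTerm_mid`. -/
lemma tendsto_residue_thetaTerm_self (H : Admissible q y z) :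
    Tendsto (fun w => (w - q) * thetaTerm w y z q) (𝓝[≠] q)
      (𝓝 (q * (qPoch (q ^ 4) (q ^ 4) ^ 4 / qPoch (q ^ 2) (q ^ 2) ^ 2 *
        (j (y * z) (q ^ 2) / (j (y ^ 2) (q ^ 4) * j (z ^ 2) (q ^ 4)))))) := by
  have hq0 := H.q0
  have hJ1 := qPoch_self_ne_zero H.q1
  have hJ2 := qPoch_self_ne_zero (norm_sq_lt_one H.q1)
  have hJ4 := qPoch_self_ne_zero (norm_four_lt_one H.q1)
  have e2 := j_neg_self_sq H.q0 H.q1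
  rw [mul_assoc, ← eq_div_iff (by positivity)] at e2
  have e3 := j_even_odd H.q0 H.q1 H.y0
  have e4 := j_even_odd H.q0 H.q1 H.z0
  have e5 := j_sq_four H.q1 y
  have e6 := j_sq_four H.q1 z
  rw [← eq_div_iff (pow_ne_zero 2 hJ2)] at e3 e4 e5 e6
  have n1 := H.j_sq_ne
  have n2 := H.symm.j_sq_ne
  have n3 := H.j_neg_sq_ne
  have n4 := H.symm.j_neg_sq_ne
  have n5 := H.j_mul_self_ne
  have n6 := H.symm.j_mul_self_ne
  have n7 : j (-q) (q ^ 2) ≠ 0 := by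
    rw [e2]; positivity
  have c1 : ContinuousAt (fun w => jDiv (w / q) q) q := by
    refine DifferentiableAt.continuousAt (𝕜 := ℂ) ?_
    exact (differentiableAt_jDiv H.q1 (div_ne_zero hq0 hq0)).comp
      (f := fun w : ℂ => w / q) q (by fun_prop)
  have hg : ContinuousAt (fun w => w / (jDiv (w / q) q * j (-w) (q ^ 2))) q := by
    refine continuousAt_id.div (c1.mul (continuousAt_j_neg H.q1 hq0)) ?_
    rw [div_self hq0, jDiv_one]
    exact mul_ne_zero (pow_ne_zero 3 hJ1) n7
  have h := tendsto_thetaTerm H hq0 hg ?_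
  · refine h.trans (le_of_eq (congrArg 𝓝 ?_))
    rw [div_self hq0, jDiv_one, e2, e3, e4, e5, e6]
    field_simp
  · have hne : ∀ᶠ w in 𝓝[≠] q, w ≠ 0 := nhdsWithin_le_nhds (isOpen_ne.mem_nhds hq0)
    filter_upwards [self_mem_nhdsWithin, hne] with w hw hw0
    have hw' : w - q ≠ 0 := sub_ne_zero.2 hw
    have e : j w q = (w - q) * (jDiv (w / q) q / w) := by
      have h1 := j_mul_self H.q0 H.q1 (div_ne_zero hw0 hq0)
      rw [mul_div_cancel₀ w hq0, j_eq_mul_jDiv H.q1 (w / q)] at h1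
      rw [h1]
      field_simp
      ring
    rw [e]
    field_simp

end Residues

/-! ### Cancellation of the poles and the identity F = G. -/

section Main

variable {q x y z ε : ℂ}

/-- The points at which no factor `j(x;q)`, `j(-x;q²)` vanishes. -/
def regularPoints (q : ℂ) : Set ℂ := {x | (∀ n : ℤ, x ≠ q ^ n) ∧ ∀ n : ℤ, -x ≠ (q ^ 2) ^ n}

lemma sq_ne_four_zpow (h1 : ∀ n : ℤ, x ≠ (q ^ 2) ^ n) (h2 : ∀ n : ℤ, -x ≠ (q ^ 2) ^ n) (n : ℤ) :
    x ^ 2 ≠ (q ^ 4) ^ n := by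
  intro h
  have e : (q ^ 4) ^ n = ((q ^ 2) ^ n) ^ 2 := by
    rw [show q ^ 4 = q ^ 2 * q ^ 2 by ring, mul_zpow, sq ((q ^ 2) ^ n)]
  rw [e] at h
  rcases sq_eq_sq_iff_eq_or_eq_neg.1 h with h | h
  · exact h1 n h
  · exact h2 n (by rw [h, neg_neg])

lemma ne_sq_of_mem (hx : x ∈ regularPoints q) (n : ℤ) : x ≠ (q ^ 2) ^ n := by
  rw [← zpow_two_mul']
  exact hx.1 _

lemma div_ne_sq_zpow (hq0 : q ≠ 0) (h : ∀ n : ℤ, x ≠ q ^ (2 * n + 1)) (n : ℤ) :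
    x / q ≠ (q ^ 2) ^ n := fun h' => h n (by
  rw [zpow_add_one₀ hq0, zpow_two_mul', ← h', div_mul_cancel₀ x hq0])

lemma eventually_mem_regularPoints (hq0 : q ≠ 0) (hq1 : ‖q‖ < 1) (hx : x ≠ 0) :
    ∀ᶠ w in 𝓝[≠] x, w ∈ regularPoints q := by
  have h := (tendsto_mul_const_punctured (neg_ne_zero.2 one_ne_zero) x).eventually
    (eventually_ne_zpow (pow_ne_zero 2 hq0) (norm_sq_lt_one hq1)
      (mul_ne_zero hx (neg_ne_zero.2 one_ne_zero)))
  simp only [mul_neg, mul_one] at h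
  exact (eventually_ne_zpow hq0 hq1 hx).and h

/-- Each singular piece contributes a multiple of -ε/2, and the multiples add up to zero by
`appellSum_add_appellSum`. The remaining summand is regular because ±1 is no odd power of q. -/
lemma tendsto_residue_sub_sign (H : Admissible q y z) (hε : ε = 1 ∨ ε = -1) :
    Tendsto (fun w => (w - ε) * (F w y z q - regG w y z q)) (𝓝[≠] ε) (𝓝 0) := by
  have hε2 : ε ^ 2 = 1 := by rcases hε with rfl | rfl <;> norm_num
  have h0 := ne_zero_of_sq_eq_one hε2
  have hdiv : ∀ n : ℤ, ε / q ≠ (q ^ 2) ^ n := div_ne_sq_zpow H.q0 fun n h => by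
    have h1 : q ^ (2 * (2 * n + 1)) = q ^ (0 : ℤ) := by
      rw [zpow_zero, mul_comm, zpow_mul, ← h]
      exact_mod_cast hε2
    have := zpow_injective_of_norm_lt H.q0 H.q1 h1
    omega
  have hth : Tendsto (fun w => (w - ε) * thetaTerm w y z q) (𝓝[≠] ε)
      (𝓝 (-(ε / 2) * (qPoch (q ^ 2) (q ^ 2) ^ 3 * j (y * z) (q ^ 2) * j (-(ε * q)) (q ^ 2) /
        (j (-(ε * y)) (q ^ 2) * j (-(ε * z)) (q ^ 2) *
          (j (q * y) (q ^ 2) * j (q * z) (q ^ 2)))))) := by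
    rcases hε with rfl | rfl
    · simpa only [one_mul] using tendsto_residue_thetaTerm_one H
    · simpa only [neg_one_mul, neg_neg, neg_div] using tendsto_residue_thetaTerm_neg_one H
  have h := ((((tendsto_residue_F H hε2).sub (tendsto_residue_zero_of_continuousAt
    (differentiableAt_crossTerm_mid H h0 hdiv).continuousAt)).sub
    (tendsto_residue_crossTerm_left H hε2)).sub
    (tendsto_residue_crossTerm_left H.symm hε2)).sub hth
  have e := appellSum_add_appellSum H.q0 H.q1 H.qy H.y1 H.qz H.z1 hε2
  refine (h.congr fun w => ?_).trans (le_of_eq (congrArg 𝓝 ?_))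
  · rw [regG]; ring
  · linear_combination ε / 2 * e

lemma sq_ne_pow_four_zpow (hq0 : q ≠ 0) (hq1 : ‖q‖ < 1) (n : ℤ) : q ^ 2 ≠ (q ^ 4) ^ n := fun h => by
  have h1 : q ^ (2 : ℤ) = q ^ (4 * n) := by
    rw [zpow_four_mul', ← h]; norm_cast
  have := zpow_injective_of_norm_lt hq0 hq1 h1
  omega

/-- Since q² is no power of q⁴, `F` and two of the cross terms are regular at q; the poles of the
third and of the theta term cancel. -/
lemma tendsto_residue_sub_self (H : Admissible q y z) :
    Tendsto (fun w => (w - q) * (F w y z q - regG w y z q)) (𝓝[≠] q) (𝓝 0) := by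
  have hq2 := sq_ne_pow_four_zpow H.q0 H.q1
  have h := ((((tendsto_residue_zero_of_continuousAt
    (differentiableAt_F H H.q0 hq2).continuousAt).sub (tendsto_residue_crossTerm_mid H)).sub
    (tendsto_residue_zero_of_continuousAt
      (differentiableAt_crossTerm_left H H.q0 hq2).continuousAt)).sub
    (tendsto_residue_zero_of_continuousAt
      (differentiableAt_crossTerm_left H.symm H.q0 hq2).continuousAt)).sub
    (tendsto_residue_thetaTerm_self H)
  refine (h.congr fun w => ?_).trans (le_of_eq (congrArg 𝓝 ?_))
  · rw [regG]; ring
  · ring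

/-- The vanishing principle with base q² and multiplier qx/(yz), which is 0 at the origin and hence
no power of q². -/
theorem F_eq_regG (H : Admissible q y z) (hx : x ∈ regularPoints q) (hx0 : x ≠ 0) :
    F x y z q = regG x y z q := by
  have hq0 := H.q0
  have hp0 := pow_ne_zero 2 hq0
  have hp := norm_sq_lt_one H.q1
  have hyz := mul_ne_zero H.y0 H.z0
  have hmem : ∀ x ∈ regularPoints q, (∀ n : ℤ, x ^ 2 ≠ (q ^ 4) ^ n) ∧
      ∀ n : ℤ, x / q ≠ (q ^ 2) ^ n := fun x hx =>
    ⟨sq_ne_four_zpow (ne_sq_of_mem hx) hx.2, div_ne_sq_zpow hq0 fun n => hx.1 _⟩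
  refine sub_eq_zero.1 (eq_zero_of_qShift (D := fun x => F x y z q - regG x y z q)
    (μ := fun x => q / (y * z) * x) hp0 hp (by fun_prop)
    (fun x hx => mul_ne_zero (div_ne_zero hq0 hyz) hx) (by simp) (fun k => ?_)
    (fun x hx => eventually_mem_regularPoints hq0 H.q1 hx) ?_ ?_ ?_ x hx hx0)
  · rw [mul_zero]
    exact (pow_ne_zero k hp0).symm
  · intro x hx hx0
    obtain ⟨h1, h2⟩ := hmem x hx
    have hj := j_ne_zero hq0 H.q1 hx0 hx.1
    have hj' := j_ne_zero hp0 hp (neg_ne_zero.2 hx0) hx.2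
    exact (differentiableAt_F H hx0 h1).sub ((((differentiableAt_crossTerm_mid H hx0 h2).add
      (differentiableAt_crossTerm_left H hx0 h1)).add (differentiableAt_thetaTerm H hx0 hj hj')).add
      (differentiableAt_crossTerm_left H.symm hx0 h1))
  · intro x hx hx0
    exact sub_regG_mul H hx0 (hmem x hx).1 (hmem x hx).2
  · intro x hx0 hx
    have hcases : (∃ n : ℤ, x = q ^ n) ∨ ∃ n : ℤ, -x = (q ^ 2) ^ n := by
      by_contra! h
      exact hx h
    -- Three q²-orbits cover the singular points: even powers of q belong to 1, odd powers to q, and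
    -- negated even powers to -1.
    rcases hcases with ⟨n, hn⟩ | ⟨n, hn⟩
    · obtain ⟨k, rfl | rfl⟩ := Int.even_or_odd' n
      · exact ⟨1, one_ne_zero, ⟨k, by rw [hn, zpow_two_mul', mul_one]⟩,
          tendsto_residue_sub_sign H (Or.inl rfl)⟩
      · exact ⟨q, hq0, ⟨k, by rw [hn, zpow_add_one₀ hq0, zpow_two_mul']⟩,
          tendsto_residue_sub_self H⟩
    · exact ⟨-1, neg_ne_zero.2 one_ne_zero, ⟨n, by rw [← hn]; ring⟩,
        tendsto_residue_sub_sign H (Or.inr rfl)⟩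

lemma F_eq_G (H : Admissible q y z) (hx : x ∈ regularPoints q) (hx0 : x ≠ 0)
    (hxy : ∀ n : ℤ, -(x * y) ≠ (q ^ 2) ^ n) (hxz : ∀ n : ℤ, -(x * z) ≠ (q ^ 2) ^ n) :
    F x y z q = G x y z q := by
  have hp0 := pow_ne_zero 2 H.q0
  have hp := norm_sq_lt_one H.q1
  rw [F_eq_regG H hx hx0, G_eq_regG H hx0
    (j_ne_zero hp0 hp (neg_ne_zero.2 (mul_ne_zero hx0 H.y0)) hxy)
    (j_ne_zero hp0 hp (neg_ne_zero.2 (mul_ne_zero hx0 H.z0)) hxz)]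

lemma eventually_neg_mul_ne (hq0 : q ≠ 0) (hq1 : ‖q‖ < 1) (hx : x ≠ 0) (hy : y ≠ 0) :
    ∀ᶠ w in 𝓝[≠] x, ∀ n : ℤ, -(w * y) ≠ (q ^ 2) ^ n := by
  have h := (tendsto_mul_const_punctured (neg_ne_zero.2 hy) x).eventually
    (eventually_ne_zpow (pow_ne_zero 2 hq0) (norm_sq_lt_one hq1) (mul_ne_zero hx (neg_ne_zero.2 hy)))
  simpa only [mul_neg] using h

/-- `G` agrees with `F` on a punctured neighbourhood of x, and `F` is continuous at x, even at odd
powers of q, where two summands of `G` have poles. -/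
lemma tendsto_G (H : Admissible q y z) (hx : x ≠ 0) (hx2 : ∀ n : ℤ, x ^ 2 ≠ (q ^ 4) ^ n) :
    Tendsto (fun w => G w y z q) (𝓝[≠] x) (𝓝 (F x y z q)) := by
  refine (tendsto_punctured (differentiableAt_F H hx hx2).continuousAt).congr' ?_
  have hne : ∀ᶠ w in 𝓝[≠] x, w ≠ 0 := nhdsWithin_le_nhds (isOpen_ne.mem_nhds hx)
  filter_upwards [eventually_mem_regularPoints H.q0 H.q1 hx,
    eventually_neg_mul_ne H.q0 H.q1 hx H.y0, eventually_neg_mul_ne H.q0 H.q1 hx H.z0, hne]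
    with w h1 h2 h3 h4
  exact F_eq_G H h1 h4 h2 h3

end Main

end TripleSum

end

theorem theorem2 (q : ℂ) (hq0 : q ≠ 0) (hq1 : ‖q‖ < 1) :
    (∀ x y z : ℂ, ‖q‖ < ‖x‖ → ‖x‖ < 1 → ‖q‖ < ‖y‖ → ‖y‖ < 1 → ‖q‖ < ‖z‖ → ‖z‖ < 1 →
      HasSum (fun p : TripleSum.sameParityTriples => TripleSum.tripleTerm x y z q p)
        (TripleSum.G x y z q)) ∧
    (∀ x y z : ℂ, x ≠ 0 → (∀ n : ℤ, x ≠ q ^ (2 * n) ∧ x ≠ -q ^ (2 * n)) →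
      ‖q‖ < ‖y‖ → ‖y‖ < 1 → ‖q‖ < ‖z‖ → ‖z‖ < 1 →
      Summable (fun p : TripleSum.sameSignPairs => TripleSum.evenTerm x y z q p) ∧
      Summable (fun p : TripleSum.sameSignPairs => TripleSum.oddTerm x y z q p) ∧
      -- literal equality wherever no denominator of `G` vanishes
      ((∀ n : ℤ, x ≠ q ^ (2 * n + 1) ∧ x * y ≠ -q ^ (2 * n) ∧ x * z ≠ -q ^ (2 * n)) →
        TripleSum.F x y z q = TripleSum.G x y z q) ∧
      -- at the remaining points the singularity of `G` in `x` is removable, with value `F`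
      Tendsto (fun w : ℂ => TripleSum.G w y z q) (𝓝[≠] x) (𝓝 (TripleSum.F x y z q))) := by
  refine ⟨fun x y z hx hx1 hy hy1 hz hz1 => ?_, fun x y z hx0 hx hy hy1 hz hz1 => ?_⟩
  · have H : TripleSum.Admissible q y z := ⟨hq0, hq1, hy, hy1, hz, hz1⟩
    have Hxy : TripleSum.Admissible q x y := ⟨hq0, hq1, hx, hx1, hy, hy1⟩
    have Hxz : TripleSum.Admissible q x z := ⟨hq0, hq1, hx, hx1, hz, hz1⟩
    -- With x in the annulus too, no denominator of `G` vanishes, so no limit is needed.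
    have h := TripleSum.F_eq_G H ⟨TripleSum.ne_zpow_of_norm hq0 hq1 hx hx1, Hxy.neg_ne_sq⟩ Hxy.y0
      Hxy.neg_mul_ne_sq Hxz.neg_mul_ne_sq
    rw [← h]
    exact TripleSum.hasSum_tripleTerm hq0 hq1 hx hx1 hy hy1 hz hz1
  · have H : TripleSum.Admissible q y z := ⟨hq0, hq1, hy, hy1, hz, hz1⟩
    have hpos : ∀ n : ℤ, x ≠ (q ^ 2) ^ n := fun n => by
      rw [← TripleSum.zpow_two_mul']; exact (hx n).1
    have hneg : ∀ n : ℤ, -x ≠ (q ^ 2) ^ n := fun n h => (hx n).2 (by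
      rw [TripleSum.zpow_two_mul', ← h, neg_neg])
    refine ⟨TripleSum.summable_evenTerm hq0 hq1 hx0 hy hy1 hz hz1,
      TripleSum.summable_oddTerm hq0 hq1 hx0 hy hy1 hz hz1, fun h => ?_,
      TripleSum.tendsto_G H hx0 (TripleSum.sq_ne_four_zpow hpos hneg)⟩
    refine TripleSum.F_eq_G H ⟨fun n => ?_, hneg⟩ hx0 (fun n h' => (h n).2.1 ?_)
      (fun n h' => (h n).2.2 ?_)
    · obtain ⟨k, rfl | rfl⟩ := Int.even_or_odd' n
      · exact (hx k).1
      · exact (h k).1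
    · rw [TripleSum.zpow_two_mul', ← h', neg_neg]
    · rw [TripleSum.zpow_two_mul', ← h', neg_neg]
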